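/- Let $G$ be a planar circular directed graph: a finite directed graph (loops and multiple edges allowed) properly embedded in a closed oriented disk, with boundary vertices $b_1,\dots,b_n$ in clockwise order on the boundary circle and all other vertices, as well as the interiors of all edges, in the open disk. Each boundary vertex is incident to at most one edge and is designated a source (no edge enters it) or a sink (no edge leaves it); let $I=\{i_1<\dots<i_k\}\subseteq[n]$ index the sources. Let $x=(x_e)$ be formal variables indexed by the edges of $G$, and let $N=(G,x)$ be the resulting network. Assume that $G$ is perfectly oriented: every interior (i.e. non-boundary) vertex has exactly one incoming edge or exactly one outgoing edge (or both). For a directed walk $P=(e_1,\dots,e_m)$ put $\operatorname{wt}(P)=x_{e_1}\cdots x_{e_m}$. For a non-trivial walk $P$ from a boundary vertex $u$ to a boundary vertex $v$, let $\operatorname{wind}(P)\in\mathbb Z$ be its winding index, the signed number of full turns (counterclockwise positive) made by the tangent vector along $P$, after an isotopy making the tangent vectors at $u$ and at $v$ point in the same direction; for a trivial walk (no edges) put $\operatorname{wind}(P)=0$ and $\operatorname{wt}(P)=1$. Define the formal power series $$M_{ij}=\sum_{P:\,b_i\leadsto b_j}(-1)^{\operatorname{wind}(P)}\operatorname{wt}(P),$$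 the sum over all directed walks from $b_i$ to $b_j$. Let $s(i,j)$ be the number of elements of $I$ strictly between $i$ and $j$, and let $A(N)$ be the $k\times n$ boundary measurement matrix with entries $a_{tj}=(-1)^{s(i_t,j)}M_{i_t,j}$. For $J\subseteq[n]$ with $|J|=k$ let $\Delta_J(A(N))$ be the minor of $A(N)$ with columns $J$. A flow is a set $F$ of edges such that at every interior vertex the number of edges of $F$ arriving equals the number of edges of $F$ leaving; $\operatorname{wt}(F)=\prod_{e\in F}x_e$. A flow is conservative if it contains no edge incident to a boundary vertex; let $\mathcal C(G)$ be the set of conservative flows. A flow $F$ is a flow from $I$ to $J$ if every source $b_i$, $i\in I$, is connected to some $b_j$, $j\in J$, by a walk with all edges in $F$ that ends at a vertex which no edge of $F$ leaves (so the trivial walk at $b_i$ counts only if $F$ has no edge leaving $b_i$); let $\mathcal F_J(G)$ be the set of these flows. **Theorem.** For every $J\subseteq[n]$ with $|J|=|I|$, in the ring $\mathbb Z[[x_e]]$ of formal power series, where $\sum_{C\in\mathcal C(G)}\operatorname{wt}(C)$ is invertible, $$\Delta_J(A(N))=\frac{\sum_{F\in\mathcal F_J(G)}\operatorname{wt}(F)}{\sum_{C\in\mathcal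 C(G)}\operatorname{wt}(C)}.$$ -/

import Mathlib

open Filter Topology

/-- A planar circular directed graph with vertex type `V`, edge type `E` and `n` boundary vertices
`b 0, …, b (n - 1)`, properly embedded in the closed unit disk of the plane `ℂ` (with its standard,
counterclockwise orientation). Edges are arbitrary continuous arcs; loops and multiple edges are
allowed. -/
structure PlanarCircularDigraph (V E : Type*) (n : ℕ) where
  /-- tail (starting vertex) of an edge -/
  src : E → V
  /-- head (end vertex) of an edge -/
  tgt : E → V
  /-- the boundary vertices -/
  b : Fin n → V
  /-- indices of the boundary vertices designated as sources; the other ones are sinks -/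
  I : Finset (Fin n)
  /-- position of a vertex in the disk -/
  pos : V → ℂ
  /-- the arc by which an edge is drawn, directed from its tail to its head -/
  arc : ∀ e : E, Path (pos (src e)) (pos (tgt e))
  pos_injective : Function.Injective pos
  /-- the boundary vertices lie on the unit circle, in clockwise order -/
  clockwise : ∃ φ : Fin n → ℝ, StrictAnti φ ∧ (∀ i j, φ i - φ j < 2 * Real.pi) ∧
    ∀ i, pos (b i) = Complex.exp (φ i * Complex.I)
  /-- the other vertices lie in the open disk -/
  norm_pos_lt : ∀ v, v ∉ Set.range b → ‖pos v‖ < 1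
  /-- the interior of every arc lies in the open disk -/
  norm_arc_lt : ∀ (e : E) (t : unitInterval), 0 < t → t < 1 → ‖arc e t‖ < 1
  /-- the interior of an arc contains no vertex -/
  arc_ne_pos : ∀ (e : E) (t : unitInterval) (v : V), 0 < t → t < 1 → arc e t ≠ pos v
  /-- interiors of arcs are simple and pairwise disjoint -/
  arc_injective : ∀ (e e' : E) (t t' : unitInterval), 0 < t → t < 1 → 0 < t' → t' < 1 →
    arc e t = arc e' t' → e = e' ∧ t = t'
  /-- a boundary vertex is incident to at most one edge -/
  boundary_deg : ∀ (i : Fin n) (e e' : E), (src e = b i ∨ tgt e = b i) →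
    (src e' = b i ∨ tgt e' = b i) → e = e'
  /-- no edge enters a boundary source -/
  source_no_in : ∀ i ∈ I, ∀ e, tgt e ≠ b i
  /-- no edge leaves a boundary sink -/
  sink_no_out : ∀ i ∉ I, ∀ e, src e ≠ b i

/-- `w` is the winding index of the curve `γ : [0, L] → ℂ`, where `γ 0 ≠ γ L`.
All directions are measured by their angle from the direction `γ L - γ 0`. The tangent direction
of `γ` at `t` is approximated by the secant direction `γ (t + ε) - γ t`, `ε > 0` small, so that
arbitrary (locally injective) continuous curves are covered; for regular `C¹` curves the secant
directions converge uniformly to the tangent directions. The function `θ` is a continuous choice of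
the angle along the curve, counterclockwise positive. The initial and the final direction are each
straightened to the common direction `γ L - γ 0` through an angle in `(-π, π]` (`Complex.arg`),
which makes the total number of full turns an integer. For a curve in the closed unit disk with
`γ 0` and `γ L` on the unit circle, this straightening takes place inside the open half plane of
directions pointing into the disk at `γ 0`, respectively out of the disk at `γ L`. -/
def IsWindingIndex (γ : ℝ → ℂ) (L : ℝ) (w : ℤ) : Prop :=
  ∀ᶠ ε : ℝ in 𝓝[>] 0, ∃ θ : ℝ → ℝ, ContinuousOn θ (Set.Icc 0 (L - ε)) ∧
    (∀ t ∈ Set.Icc 0 (L - ε),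
      (γ (t + ε) - γ t) / (γ L - γ 0) ≠ 0 ∧
      (γ (t + ε) - γ t) / (γ L - γ 0) =
        ‖(γ (t + ε) - γ t) / (γ L - γ 0)‖ * Complex.exp (θ t * Complex.I)) ∧
    θ 0 = Complex.arg ((γ ε - γ 0) / (γ L - γ 0)) ∧
    θ (L - ε) = Complex.arg ((γ L - γ (L - ε)) / (γ L - γ 0)) + 2 * Real.pi * w

/-- The weight of a walk, the product of the formal variables of its edges. -/
noncomputable def walkWeight {E : Type*} (P : List E) : MvPowerSeries E ℤ :=
  (P.map MvPowerSeries.X).prod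

open Classical in
theorem coeff_walkWeight {E : Type*} (P : List E) (m : E →₀ ℕ) :
    MvPowerSeries.coeff m (walkWeight P) =
      if P ∈ (Finsupp.toMultiset m).lists.toFinset then 1 else 0 := by
  have h : walkWeight P = MvPowerSeries.monomial (Multiset.toFinsupp (P : Multiset E)) (1 : ℤ) := by
    induction P with
    | nil => simp [walkWeight, MvPowerSeries.monomial_zero_eq_C]
    | cons e p ih =>
      have : walkWeight (e :: p) = MvPowerSeries.X e * walkWeight p := by simp [walkWeight]
      rw [this, ih, MvPowerSeries.X, MvPowerSeries.monomial_mul_monomial, ← Multiset.cons_coe,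
        ← Multiset.singleton_add, map_add, Multiset.toFinsupp_singleton, one_mul]
  simp only [h, MvPowerSeries.coeff_monomial, Multiset.mem_toFinset, Multiset.mem_lists_iff,
    Finsupp.toMultiset_eq_iff, Multiset.quot_mk_to_coe]

namespace PlanarCircularDigraph

variable {V E : Type*} {n : ℕ} (G : PlanarCircularDigraph V E n)

/-- Every interior vertex has exactly one incoming edge or exactly one outgoing edge (or both). -/
def PerfectlyOriented : Prop :=
  ∀ v, v ∉ Set.range G.b → (∃! e, G.src e = v) ∨ (∃! e, G.tgt e = v)

/-- The sequence of edges `P` is a walk from `u` to `v`; the empty sequence is the trivial walk. -/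
def IsWalk : V → List E → V → Prop
  | u, [], v => u = v
  | u, e :: p, v => G.src e = u ∧ IsWalk (G.tgt e) p v

/-- The curve traced by a walk `P` with at least one edge, parametrized by `[0, P.length]`: the
`k`-th edge is traversed during `[k - 1, k]`. -/
noncomputable def walkCurve : List E → ℝ → ℂ
  | [], _ => 0
  | e :: p, t => if t ≤ 1 then (G.arc e).extend t else walkCurve p (t - 1)

open Classical in
/-- The winding index of a walk between boundary vertices; it is `0` for a trivial walk. (Walks
with at least one edge, between boundary vertices, always have a unique winding index.) -/
noncomputable def wind (P : List E) : ℤ :=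
  if h : P ≠ [] ∧ ∃ w, IsWindingIndex (G.walkCurve P) P.length w then h.2.choose else 0

open Classical in
/-- The boundary measurement: the formal power series `∑_P (-1)^wind(P) wt(P)` over all walks `P`
from `b i` to `b j`. It is given through its coefficients; to the coefficient of the
monomial with exponent `m` only the finitely many lists of edges `P` contribute that arrange the
multiset `m`. -/
noncomputable def boundaryMeasurement (i j : Fin n) : MvPowerSeries E ℤ := fun m =>
  ∑ P ∈ (Finsupp.toMultiset m).lists.toFinset with G.IsWalk (G.b i) P (G.b j),
    ((G.wind P).negOnePow : ℤ) * MvPowerSeries.coeff m (walkWeight P)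

/-- The number of elements of `I` strictly between `i` and `j`. -/
def between (i j : Fin n) : ℕ :=
  (G.I ∩ Finset.Ioo (min i j) (max i j)).card

/-- The boundary measurement matrix; its rows correspond to the boundary sources in increasing
order of their indices, its columns to all boundary vertices. -/
noncomputable def boundaryMatrix : Matrix (Fin G.I.card) (Fin n) (MvPowerSeries E ℤ) :=
  fun t j => (-1) ^ G.between (G.I.orderEmbOfFin rfl t) j *
    G.boundaryMeasurement (G.I.orderEmbOfFin rfl t) j

/-- The maximal minor whose columns are those indexed by `J`, in increasing order. -/
noncomputable def maximalMinor (J : Finset (Fin n)) (hJ : J.card = G.I.card) :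
    MvPowerSeries E ℤ :=
  (G.boundaryMatrix.submatrix id (J.orderEmbOfFin hJ)).det

open Classical in
/-- A set of edges is a flow if, at every interior vertex, it has as many incoming as outgoing
edges. -/
def IsFlow (F : Finset E) : Prop :=
  ∀ v, v ∉ Set.range G.b → (F.filter (G.tgt · = v)).card = (F.filter (G.src · = v)).card

/-- A flow is conservative if it contains no edge incident to the boundary. -/
def IsConservativeFlow (F : Finset E) : Prop :=
  G.IsFlow F ∧ ∀ e ∈ F, G.src e ∉ Set.range G.b ∧ G.tgt e ∉ Set.range G.b

/-- The boundary vertex `b i` is connected to the boundary vertex `b j` by a walk in `F`. The walk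
is followed to its end, that is, no edge of `F` leaves `b j`: in particular `b i` is connected to
itself (by the trivial walk) only if no edge of `F` leaves it. -/
def Connects (F : Finset E) (i j : Fin n) : Prop :=
  (∃ P : List E, G.IsWalk (G.b i) P (G.b j) ∧ ∀ e ∈ P, e ∈ F) ∧ ∀ e ∈ F, G.src e ≠ G.b j

/-- `F` is a flow from `I` to `J`, where `|J| = |I|`: it connects every boundary source to a
boundary vertex with index in `J`. -/
def IsFlowTo (J : Finset (Fin n)) (F : Finset E) : Prop :=
  G.IsFlow F ∧ ∀ i ∈ G.I, ∃ j ∈ J, G.Connects F i j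

open Classical in
/-- The weight generating function of the flows from `I` to `J`. -/
noncomputable def flowPolynomial [Fintype E] (J : Finset (Fin n)) : MvPolynomial E ℤ :=
  ∑ F : Finset E with G.IsFlowTo J F, ∏ e ∈ F, MvPolynomial.X e

open Classical in
/-- The weight generating function of the conservative flows. -/
noncomputable def conservativeFlowPolynomial [Fintype E] : MvPolynomial E ℤ :=
  ∑ F : Finset E with G.IsConservativeFlow F, ∏ e ∈ F, MvPolynomial.X e

end PlanarCircularDigraph

/-!
The theorem follows from writing both generating functions of flows as determinants of one and the
same kind of matrix, in which the winding index of a walk has been broken up into local signs.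

*Signs.* Along a walk, the secants `γ (t + 1/2) - γ t` do not vanish, so they have a continuous
square root. Such a root changes its sign with every full turn, hence it sees exactly the parity of
the winding index (`re_sqrt_end_of_isWindingIndex`). Fixing one square root of the first secant of
every edge, the continuation from an edge to the next one costs a sign `σ e e'`, so that
`(-1) ^ wind P` is a product of signs of turns, of a sign `η` of the last edge and of the sign of the
chord between the end points (`exists_turning_signs`). The planar topology enters through three
facts, each proved by continuing a square root of `γ t - γ s` over a convex set of pairs `(s, t)`,
as in Hopf's proof of the theorem on turning tangents: a simple curve crossing the disk has even
winding index (`re_sqrt_end_of_simple`), the square root changes its sign along a simple closed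
curve (`sqrt_end_of_closed`), and the end points of two disjoint curves crossing the disk do not
separate each other (`chordSign_eq_of_disjoint`).

*Determinants.* Let `T` be the transfer matrix `σ e e' * X e'` of consecutive edges. The signed
walks starting with an edge satisfy a linear recursion, so that they are the entries of
`(1 - T)⁻¹ * C`, where `C` marks the last edges. Therefore the maximal minor times `det (1 - T)` is
the determinant of a matrix indexed by `Fin k ⊕ E` with the Schur complement given by boundary
measurements (`det_columnMatrix_linkEntry`), and `det (1 - T)` itself is the case `k = 0`.

*Expansion.* The column of an edge `e` is a multiple of `X e` plus a unit vector. Expanding the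
determinant accordingly gives a sum over sets `F` of edges (`det_columnMatrix`), the coefficient of
`∏ e ∈ F, X e` being a signed sum over permutations of `Fin k ⊕ E` that fix the edges outside `F` and
send each edge of `F` to one preceding it. In a perfectly oriented graph there is at most one
such permutation, a routing of `F`, and there is one precisely if `F` is a flow from `I` to `J`
(`exists_isRouting_iff_isFlowTo`), or a conservative flow if `k = 0`
(`exists_isRouting_iff_isConservativeFlow`). The walks and cycles of a routing are simple and
pairwise disjoint, so that by the three facts all its signs, including the sign of the permutation,
cancel (`IsRouting.sign_mul_prod_linkSign`).
-/

/-! ### Continuous square roots -/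

/-- A continuous nowhere vanishing function on a convex plane set has a continuous logarithm. -/
theorem exists_continuousOn_exp_eq {D : Set (ℝ × ℝ)} (hD : Convex ℝ D) {f : ℝ × ℝ → ℂ}
    (hf : ContinuousOn f D) (h0 : ∀ p ∈ D, f p ≠ 0) :
    ∃ h : ℝ × ℝ → ℂ, ContinuousOn h D ∧ ∀ p ∈ D, Complex.exp (h p) = f p := by
  classical
  rcases D.eq_empty_or_nonempty with rfl | hne
  · exact ⟨0, by simp, by simp⟩
  have := hD.contractibleSpace hne
  have := hD.locallyPathConnectedSpace
  obtain ⟨x₀, hx₀⟩ := hne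
  rcases Complex.isCoveringMapOn_exp.existsUnique_continuousMap_lifts
    (⟨D.domRestrict f, continuousOn_iff_continuous_domRestrict.mp hf⟩ : C(D, ℂ))
    (a₀ := ⟨x₀, hx₀⟩) (Complex.exp_log (h0 x₀ hx₀))
    (fun x ↦ h0 x x.2) with ⟨F, ⟨-, hF⟩, -⟩
  refine ⟨fun z ↦ if hz : z ∈ D then F ⟨z, hz⟩ else 0, ?_, ?_⟩
  · rw [continuousOn_iff_continuous_domRestrict]
    convert! map_continuous F
    ext z
    simp
  · intro x hx
    simpa [hx] using congr($hF ⟨x, hx⟩)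

/-- A continuous nowhere vanishing function on a convex plane set has a continuous square root with
a prescribed value at one point. -/
theorem exists_continuousOn_sq_eq {D : Set (ℝ × ℝ)} (hD : Convex ℝ D) {f : ℝ × ℝ → ℂ}
    (hf : ContinuousOn f D) (h0 : ∀ p ∈ D, f p ≠ 0) {p₀ : ℝ × ℝ} (hp₀ : p₀ ∈ D) {z : ℂ}
    (hz : z ^ 2 = f p₀) :
    ∃ g : ℝ × ℝ → ℂ, ContinuousOn g D ∧ (∀ p ∈ D, g p ^ 2 = f p) ∧ g p₀ = z := by
  obtain ⟨h, hc, he⟩ := exists_continuousOn_exp_eq hD hf h0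
  have hsq : ∀ p ∈ D, Complex.exp (h p / 2) ^ 2 = f p := fun p hp => by
    rw [← Complex.exp_nat_mul, ← he p hp]; congr 1; push_cast; ring
  have hcont : ContinuousOn (fun p => Complex.exp (h p / 2)) D :=
    Complex.continuous_exp.comp_continuousOn (hc.div_const 2)
  rcases sq_eq_sq_iff_eq_or_eq_neg.mp ((hsq p₀ hp₀).trans hz.symm) with h1 | h1
  · exact ⟨_, hcont, hsq, h1⟩
  · exact ⟨fun p => - Complex.exp (h p / 2), hcont.neg,
      fun p hp => by rw [neg_sq, hsq p hp], by simp [h1]⟩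

theorem exists_continuousOn_Icc_sq_eq {a b : ℝ} (hab : a ≤ b) {f : ℝ → ℂ}
    (hf : ContinuousOn f (Set.Icc a b)) (h0 : ∀ t ∈ Set.Icc a b, f t ≠ 0) {z : ℂ}
    (hz : z ^ 2 = f a) :
    ∃ g : ℝ → ℂ, ContinuousOn g (Set.Icc a b) ∧ (∀ t ∈ Set.Icc a b, g t ^ 2 = f t) ∧ g a = z := by
  obtain ⟨g, hg, hsq, hz⟩ := exists_continuousOn_sq_eq (D := Set.Icc a b ×ˢ Set.univ)
    ((convex_Icc a b).prod convex_univ) (f := fun p => f p.1)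
    (hf.comp continuousOn_fst fun p hp => hp.1) (fun p hp => h0 _ hp.1)
    (p₀ := (a, 0)) ⟨Set.left_mem_Icc.2 hab, trivial⟩ hz
  exact ⟨fun t => g (t, 0), hg.comp (by fun_prop) fun t ht => ⟨ht, trivial⟩,
    fun t ht => hsq _ ⟨ht, trivial⟩, hz⟩

/-- Two continuous square roots of the same nowhere vanishing function on an interval agree
everywhere or nowhere. -/
theorem eqOn_of_sq_eq {X : Type*} [TopologicalSpace X] {S : Set X} (hS : IsPreconnected S)
    {f g h : X → ℂ}
    (hg : ContinuousOn g S) (hh : ContinuousOn h S) (hgf : ∀ t ∈ S, g t ^ 2 = f t)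
    (hhf : ∀ t ∈ S, h t ^ 2 = f t) (h0 : ∀ t ∈ S, f t ≠ 0) {t₀ : X} (ht₀ : t₀ ∈ S)
    (he : g t₀ = h t₀) : ∀ t ∈ S, g t = h t := by
  refine hS.eq_of_sq_eq hg hh (fun t ht => ?_) (fun {t} ht h1 => h0 t ht ?_) ht₀ he
  · simp [hgf t ht, hhf t ht]
  · rw [← hhf t ht, h1]; simp

theorem re_ne_zero_of_re_sq_pos {w : ℂ} (h : 0 < (w ^ 2).re) : w.re ≠ 0 := by
  intro h0
  rw [sq, Complex.mul_re, h0] at h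
  nlinarith [mul_self_nonneg w.im]

/-- A continuous square root of a function with values in the half plane around `ω ^ 2` stays in
the half plane around `ω`, or in the opposite one. -/
theorem re_pos_of_re_sq_pos {X : Type*} [TopologicalSpace X] {S : Set X} (hS : IsPreconnected S)
    {g : X → ℂ} {ω : ℂ} (hg : ContinuousOn g S)
    (hpos : ∀ t ∈ S, 0 < (g t ^ 2 / ω ^ 2).re) {t₀ t : X} (ht₀ : t₀ ∈ S) (ht : t ∈ S)
    (h : 0 < (g t₀ / ω).re) : 0 < (g t / ω).re := by
  by_contra hneg
  push Not at hneg
  have hc : ContinuousOn (fun t => (g t / ω).re) S :=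
    Complex.continuous_re.comp_continuousOn (hg.div_const ω)
  obtain ⟨u, hu, hu0⟩ := hS.intermediate_value ht ht₀ hc ⟨hneg, h.le⟩
  refine re_ne_zero_of_re_sq_pos ?_ hu0
  rw [div_pow]
  exact hpos u hu

theorem eq_of_sq_eq_of_re_pos {a b ω : ℂ} (h : a ^ 2 = b ^ 2) (ha : 0 < (a / ω).re)
    (hb : 0 < (b / ω).re) : a = b := by
  rcases sq_eq_sq_iff_eq_or_eq_neg.mp h with h | h
  · exact h
  · rw [h, neg_div, Complex.neg_re] at ha; linarith

/-- Let `z ^ 2` and `u` lie in the right half plane. Turning the square root `z` of `z ^ 2` by half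
the principal angle from `z ^ 2` to `u` gives the direction of the square root of `u` that lies in
the right half plane like `z`. -/
theorem re_mul_exp_arg_pos {z u : ℂ} (hz : 0 < z.re) (hz2 : 0 < (z ^ 2).re) (hu : 0 < u.re) :
    0 < (z * Complex.exp (Complex.arg (u / z ^ 2) / 2 * Complex.I)).re := by
  have hz0 : z ≠ 0 := by rintro rfl; simp at hz
  have hu0 : u ≠ 0 := by rintro rfl; simp at hu
  set a : ℝ := Complex.arg (u / z ^ 2) with ha
  set e := Complex.exp (a / 2 * Complex.I) with he
  set y := z * e with hy
  have hnorm : 0 < ‖u / z ^ 2‖ := norm_pos_iff.2 (div_ne_zero hu0 (pow_ne_zero _ hz0))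
  have he2 : e ^ 2 * ‖u / z ^ 2‖ = u / z ^ 2 := by
    rw [he, ← Complex.exp_nat_mul]
    conv_rhs => rw [← Complex.norm_mul_exp_arg_mul_I (u / z ^ 2), ← ha]
    rw [mul_comm]; congr 2; push_cast; ring
  have hy2 : 0 < (y ^ 2).re := by
    have h1 : y ^ 2 * (‖u / z ^ 2‖ : ℝ) = u := by
      rw [hy, mul_pow, mul_assoc, he2]; field_simp
    have h2 : (y ^ 2).re * ‖u / z ^ 2‖ = u.re := by
      conv_rhs => rw [← h1]
      rw [Complex.re_mul_ofReal]
    by_contra hcon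
    push Not at hcon
    nlinarith
  have here : 0 ≤ e.re := by
    rw [he, show (a / 2 * Complex.I : ℂ) = ((a / 2 : ℝ) : ℂ) * Complex.I by push_cast; ring,
      Complex.exp_ofReal_mul_I_re]
    have := Complex.neg_pi_lt_arg (u / z ^ 2)
    have := Complex.arg_le_pi (u / z ^ 2)
    exact Real.cos_nonneg_of_neg_pi_div_two_le_of_le (by linarith) (by linarith)
  have hyne := re_ne_zero_of_re_sq_pos hy2
  by_contra hcon
  have hlt : y.re < 0 := lt_of_le_of_ne (not_lt.mp hcon) hyne
  -- both `z` and `-y` lie in the sector around the positive axis, so `-e` is in the half plane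
  rw [sq, Complex.mul_re] at hy2 hz2
  have h1 : |z.im| < |z.re| := sq_lt_sq.mp (by nlinarith)
  have h2 : |y.im| < |y.re| := sq_lt_sq.mp (by nlinarith)
  have h3 : |z.im| * |y.im| < |z.re| * |y.re| :=
    mul_lt_mul'' h1 h2 (abs_nonneg _) (abs_nonneg _)
  rw [← abs_mul, ← abs_mul, abs_of_neg (mul_neg_of_pos_of_neg hz hlt)] at h3
  have h4 : z.re * y.re + z.im * y.im = e.re * (z.re * z.re + z.im * z.im) := by
    rw [hy, Complex.mul_re, Complex.mul_im]; ring
  have h5 := le_abs_self (z.im * y.im)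
  have h6 : 0 ≤ e.re * (z.re * z.re + z.im * z.im) :=
    mul_nonneg here (add_nonneg (mul_self_nonneg _) (mul_self_nonneg _))
  linarith

/-! ### Chords of the unit circle -/

/-- The square root of the chord `exp (iα) - exp (iβ)` of the unit circle, where `α ≠ β` and
`|α - β| < 2π`, in the half plane around `inwardRoot β`, see `re_chordRoot_div_inwardRoot_pos`. -/
noncomputable def chordRoot (α β : ℝ) : ℂ :=
  (√(2 * |Real.sin ((α - β) / 2)|) : ℝ) *
    Complex.exp (((α + β + if β < α then Real.pi else 3 * Real.pi) / 4 : ℝ) * Complex.I)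

theorem sin_half_sub_ne_zero {α β : ℝ} (hne : α ≠ β) (h : |α - β| < 2 * Real.pi) :
    Real.sin ((α - β) / 2) ≠ 0 := by
  rw [abs_lt] at h
  intro h0
  rw [Real.sin_eq_zero_iff_of_lt_of_lt (by linarith) (by linarith)] at h0
  exact hne (by linarith)

theorem chordRoot_sq {α β : ℝ} (hne : α ≠ β) (h : |α - β| < 2 * Real.pi) :
    chordRoot α β ^ 2 = Complex.exp (α * Complex.I) - Complex.exp (β * Complex.I) := by
  have hs := sin_half_sub_ne_zero hne h
  rw [abs_lt] at h
  have hre : Complex.exp (α * Complex.I) - Complex.exp (β * Complex.I) =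
      2 * Real.sin ((α - β) / 2) * (Complex.I * Complex.exp (((α + β) / 2 : ℝ) * Complex.I)) := by
    have h1 : (α * Complex.I : ℂ) = ((α - β) / 2 : ℝ) * Complex.I + ((α + β) / 2 : ℝ) * Complex.I := by
      push_cast; ring
    have h2 : (β * Complex.I : ℂ) = -(((α - β) / 2 : ℝ) : ℂ) * Complex.I + ((α + β) / 2 : ℝ) * Complex.I := by
      push_cast; ring
    rw [h1, h2, Complex.exp_add, Complex.exp_add, Complex.ofReal_sin, Complex.sin]
    have := Complex.I_mul_I
    linear_combination (Complex.exp ((((α - β) / 2 : ℝ) : ℂ) * Complex.I) -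
      Complex.exp (-(((α - β) / 2 : ℝ) : ℂ) * Complex.I)) *
      Complex.exp (((α + β) / 2 : ℝ) * Complex.I) * this
  rw [hre, chordRoot, mul_pow, ← Complex.exp_nat_mul, ← Complex.ofReal_pow,
    Real.sq_sqrt (by positivity)]
  split_ifs with hlt
  · rw [abs_of_pos (Real.sin_pos_of_pos_of_lt_pi (by linarith) (by linarith)),
      show (((2 : ℕ) : ℂ) * (((α + β + Real.pi) / 4 : ℝ) * Complex.I)) =
        Real.pi / 2 * Complex.I + ((α + β) / 2 : ℝ) * Complex.I by push_cast; ring,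
      Complex.exp_add, Complex.exp_pi_div_two_mul_I]
    push_cast; ring
  · have hlt' : α < β := lt_of_le_of_ne (not_lt.mp hlt) hne
    rw [abs_of_neg (Real.sin_neg_of_neg_of_neg_pi_lt (by linarith) (by linarith)),
      show (((2 : ℕ) : ℂ) * (((α + β + 3 * Real.pi) / 4 : ℝ) * Complex.I)) =
        Real.pi * Complex.I + (Real.pi / 2 * Complex.I + ((α + β) / 2 : ℝ) * Complex.I) by
          push_cast; ring,
      Complex.exp_add, Complex.exp_add, Complex.exp_pi_div_two_mul_I, Complex.exp_pi_mul_I]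
    push_cast; ring

/-- A square root `exp (i(β + π)/2)` of the inward normal `-exp (iβ)` of the unit disk. -/
noncomputable def inwardRoot (β : ℝ) : ℂ := Complex.exp (((β + Real.pi) / 2 : ℝ) * Complex.I)

/-- A square root `exp (iα/2)` of the outward normal `exp (iα)` of the unit disk. -/
noncomputable def outwardRoot (α : ℝ) : ℂ := Complex.exp ((α / 2 : ℝ) * Complex.I)

theorem inwardRoot_sq (β : ℝ) : inwardRoot β ^ 2 = -Complex.exp (β * Complex.I) := by
  rw [inwardRoot, ← Complex.exp_nat_mul, show (((2 : ℕ) : ℂ) *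
    (((β + Real.pi) / 2 : ℝ) * Complex.I)) = β * Complex.I + Real.pi * Complex.I by
      push_cast; ring, Complex.exp_add, Complex.exp_pi_mul_I]
  ring

theorem outwardRoot_sq (α : ℝ) : outwardRoot α ^ 2 = Complex.exp (α * Complex.I) := by
  rw [outwardRoot, ← Complex.exp_nat_mul]; congr 1; push_cast; ring

theorem re_chordRoot_div (α β γ : ℝ) :
    (chordRoot α β / Complex.exp (γ * Complex.I)).re = √(2 * |Real.sin ((α - β) / 2)|) *
      Real.cos ((α + β + if β < α then Real.pi else 3 * Real.pi) / 4 - γ) := by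
  rw [chordRoot, mul_div_assoc, ← Complex.exp_sub, Complex.re_ofReal_mul, ← sub_mul,
    ← Complex.ofReal_sub, Complex.exp_ofReal_mul_I_re]

theorem re_chordRoot_div_inwardRoot_pos {α β : ℝ} (hne : α ≠ β) (h : |α - β| < 2 * Real.pi) :
    0 < (chordRoot α β / inwardRoot β).re := by
  have hs := sin_half_sub_ne_zero hne h
  rw [abs_lt] at h
  rw [inwardRoot, re_chordRoot_div]
  refine mul_pos (by positivity) ?_
  have := Real.pi_pos
  split_ifs with hlt
  · exact Real.cos_pos_of_mem_Ioo ⟨by linarith, by linarith⟩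
  · have hlt' : α < β := lt_of_le_of_ne (not_lt.mp hlt) hne
    exact Real.cos_pos_of_mem_Ioo ⟨by linarith, by linarith⟩

/-- The sign telling whether `chordRoot α β` lies in the half plane around `outwardRoot α` or in the
opposite one; it is the orientation of the chord from `exp (iβ)` to `exp (iα)`. -/
noncomputable def chordSign (α β : ℝ) : ℤ := if β < α then 1 else -1

theorem chordSign_sq (α β : ℝ) : chordSign α β * chordSign α β = 1 := by
  unfold chordSign; split_ifs <;> simp

theorem re_chordRoot_div_outwardRoot_pos {α β : ℝ} (hne : α ≠ β) (h : |α - β| < 2 * Real.pi) :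
    0 < (chordSign α β * chordRoot α β / outwardRoot α).re := by
  have hs := sin_half_sub_ne_zero hne h
  rw [abs_lt] at h
  rw [mul_div_assoc, ← Complex.ofReal_intCast, Complex.re_ofReal_mul, outwardRoot, re_chordRoot_div, chordSign]
  have := Real.pi_pos
  have h1 : 0 < √(2 * |Real.sin ((α - β) / 2)|) := by positivity
  split_ifs with hlt
  · have : 0 < Real.cos ((α + β + Real.pi) / 4 - α / 2) :=
      Real.cos_pos_of_mem_Ioo ⟨by linarith, by linarith⟩
    simpa using mul_pos h1 this
  · have hlt' : α < β := lt_of_le_of_ne (not_lt.mp hlt) hne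
    have h2 : Real.cos ((α + β + 3 * Real.pi) / 4 - α / 2) < 0 :=
      Real.cos_neg_of_pi_div_two_lt_of_lt (by linarith) (by linarith)
    have := mul_pos_of_neg_of_neg (neg_neg_of_pos h1) h2
    push_cast; linarith

theorem re_div_lt_one {z w : ℂ} (hz : ‖z‖ ≤ 1) (hw : ‖w‖ = 1) (h : z ≠ w) :
    (z / w).re < 1 := by
  have hw0 : w ≠ 0 := by rintro rfl; simp at hw
  have hn : ‖z / w‖ ≤ 1 := by rw [norm_div, hw, div_one]; exact hz
  have hne : z / w ≠ 1 := by rwa [Ne, div_eq_one_iff_eq hw0]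
  refine lt_of_le_of_ne ((Complex.re_le_norm _).trans hn) fun h1 => hne ?_
  have h2 : Complex.normSq (z / w) ≤ 1 := by
    rw [Complex.normSq_eq_norm_sq]; nlinarith [norm_nonneg (z / w)]
  rw [Complex.normSq_apply, h1] at h2
  apply Complex.ext
  · simpa using h1
  · simp only [Complex.one_im]; nlinarith

theorem re_sub_div_inwardRoot_sq_pos {z : ℂ} {β : ℝ} (hz : ‖z‖ ≤ 1)
    (h : z ≠ Complex.exp (β * Complex.I)) :
    0 < ((z - Complex.exp (β * Complex.I)) / inwardRoot β ^ 2).re := by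
  have := re_div_lt_one hz (Complex.norm_exp_ofReal_mul_I β) h
  rw [inwardRoot_sq, div_neg, sub_div, div_self (Complex.exp_ne_zero _)]
  simp only [Complex.neg_re, Complex.sub_re, Complex.one_re]
  linarith

theorem re_sub_div_outwardRoot_sq_pos {z : ℂ} {α : ℝ} (hz : ‖z‖ ≤ 1)
    (h : z ≠ Complex.exp (α * Complex.I)) :
    0 < ((Complex.exp (α * Complex.I) - z) / outwardRoot α ^ 2).re := by
  have := re_div_lt_one hz (Complex.norm_exp_ofReal_mul_I α) h
  rw [outwardRoot_sq, sub_div, div_self (Complex.exp_ne_zero _)]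
  simp only [Complex.sub_re, Complex.one_re]
  linarith

/-! ### Secants of plane curves -/

theorem continuousOn_secant {γ : ℝ → ℂ} {S : Set ℝ} (hγ : ContinuousOn γ S) {D : Set (ℝ × ℝ)}
    (hD : ∀ p ∈ D, p.1 ∈ S ∧ p.2 ∈ S) : ContinuousOn (fun p : ℝ × ℝ => γ p.2 - γ p.1) D :=
  (hγ.comp continuousOn_snd fun p hp => (hD p hp).2).sub
    (hγ.comp continuousOn_fst fun p hp => (hD p hp).1)

/-- The parameter pairs `(s, t)` of the secants `γ t - γ s` of a curve on `[0, L]` with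
`0 < t - s ≤ δ`. -/
def secantStrip (L δ : ℝ) : Set (ℝ × ℝ) := {p | 0 ≤ p.1 ∧ p.1 < p.2 ∧ p.2 ≤ p.1 + δ ∧ p.2 ≤ L}

theorem convex_secantStrip (L δ : ℝ) : Convex ℝ (secantStrip L δ) := by
  rintro ⟨a, b⟩ ⟨h1, h2, h3, h4⟩ ⟨c, d⟩ ⟨k1, k2, k3, k4⟩ x y hx hy hxy
  simp only [secantStrip, Set.mem_ofPred_eq, Prod.smul_mk, Prod.mk_add_mk, smul_eq_mul] at *
  have hy' : y = 1 - x := by linarith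
  subst hy'
  refine ⟨by positivity, ?_, by nlinarith, by nlinarith⟩
  rcases hx.eq_or_lt with rfl | hx
  · simpa using k2
  · nlinarith

theorem secantStrip_mem {L δ : ℝ} {p : ℝ × ℝ} (hp : p ∈ secantStrip L δ) :
    p.1 ∈ Set.Icc 0 L ∧ p.2 ∈ Set.Icc 0 L := by
  obtain ⟨h1, h2, -, h4⟩ := hp
  exact ⟨⟨h1, by linarith⟩, ⟨by linarith, h4⟩⟩

/-- A continuous square root of the secants over `[t, t + 1/2]` extends to all short secants. -/
theorem exists_secant_sqrt {γ : ℝ → ℂ} {L δ : ℝ} (hL : 1 / 2 ≤ L) (hδ : 1 / 2 ≤ δ)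
    (hγ : ContinuousOn γ (Set.Icc 0 L))
    (hinj : ∀ s t, 0 ≤ s → s < t → t ≤ s + δ → t ≤ L → γ t ≠ γ s)
    {g : ℝ → ℂ} (hg : ContinuousOn g (Set.Icc 0 (L - 1 / 2)))
    (hgsq : ∀ t ∈ Set.Icc 0 (L - 1 / 2), g t ^ 2 = γ (t + 1 / 2) - γ t) :
    ∃ G : ℝ × ℝ → ℂ, ContinuousOn G (secantStrip L δ) ∧
      (∀ p ∈ secantStrip L δ, G p ^ 2 = γ p.2 - γ p.1) ∧
      ∀ t ∈ Set.Icc 0 (L - 1 / 2), G (t, t + 1 / 2) = g t := by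
  have hmem : ∀ t ∈ Set.Icc 0 (L - 1 / 2), (t, t + 1 / 2) ∈ secantStrip L δ :=
    fun t ht => ⟨ht.1, by dsimp; linarith, by dsimp; linarith, by dsimp; linarith [ht.2]⟩
  have hne : ∀ p ∈ secantStrip L δ, γ p.2 - γ p.1 ≠ 0 := fun p hp =>
    sub_ne_zero.2 (hinj _ _ hp.1 hp.2.1 hp.2.2.1 hp.2.2.2)
  have h0 : (0 : ℝ) ∈ Set.Icc 0 (L - 1 / 2) := ⟨le_rfl, by linarith⟩
  obtain ⟨G, hG, hGsq, hG0⟩ := exists_continuousOn_sq_eq (convex_secantStrip L δ)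
    (continuousOn_secant hγ fun p hp => secantStrip_mem hp) hne (hmem 0 h0)
    (by simpa using hgsq 0 h0)
  refine ⟨G, hG, hGsq, ?_⟩
  exact eqOn_of_sq_eq isPreconnected_Icc (hG.comp (by fun_prop) hmem) hg
    (fun t ht => hGsq _ (hmem t ht)) hgsq (fun t ht => hne _ (hmem t ht)) h0 hG0

section Chord

variable {γ : ℝ → ℂ} {L α β : ℝ}

/-- The secants from the initial point of a curve in the disk point into the disk, so that their
continuous square root stays in one half plane. -/
theorem re_secant_sqrt_start {δ : ℝ} (hnorm : ∀ t ∈ Set.Icc 0 L, ‖γ t‖ ≤ 1)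
    (hinj : ∀ s t, 0 ≤ s → s < t → t ≤ s + δ → t ≤ L → γ t ≠ γ s)
    (hγ0 : γ 0 = Complex.exp (β * Complex.I)) {G : ℝ × ℝ → ℂ}
    (hG : ContinuousOn G (secantStrip L δ))
    (hGsq : ∀ p ∈ secantStrip L δ, G p ^ 2 = γ p.2 - γ p.1) {t t' : ℝ}
    (ht : t ∈ Set.Ioc 0 (min δ L)) (ht' : t' ∈ Set.Ioc 0 (min δ L))
    (h : 0 < (G (0, t) / inwardRoot β).re) : 0 < (G (0, t') / inwardRoot β).re := by
  have hmem : ∀ t ∈ Set.Ioc 0 (min δ L), (0, t) ∈ secantStrip L δ := fun t ht =>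
    ⟨le_rfl, ht.1, by simpa using ht.2.trans (min_le_left _ _), ht.2.trans (min_le_right _ _)⟩
  refine re_pos_of_re_sq_pos (g := fun t => G (0, t)) (isPreconnected_Ioc (a := 0) (b := min δ L))
    (hG.comp (by fun_prop) hmem) (fun t ht => ?_) ht ht' h
  have hm := hmem t ht
  have := re_sub_div_inwardRoot_sq_pos (β := β) (hnorm t (secantStrip_mem hm).2)
    (hγ0 ▸ hinj 0 t hm.1 hm.2.1 hm.2.2.1 hm.2.2.2)
  rwa [hGsq _ hm, hγ0]

/-- The secants to the final point of a curve in the disk point out of the disk, so that their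
continuous square root stays in one half plane. -/
theorem re_secant_sqrt_end {δ : ℝ} (hnorm : ∀ t ∈ Set.Icc 0 L, ‖γ t‖ ≤ 1)
    (hinj : ∀ s t, 0 ≤ s → s < t → t ≤ s + δ → t ≤ L → γ t ≠ γ s)
    (hγL : γ L = Complex.exp (α * Complex.I)) {G : ℝ × ℝ → ℂ}
    (hG : ContinuousOn G (secantStrip L δ))
    (hGsq : ∀ p ∈ secantStrip L δ, G p ^ 2 = γ p.2 - γ p.1) {s s' : ℝ} {c : ℤ} (hc : c * c = 1)
    (hs : s ∈ Set.Ico (max 0 (L - δ)) L) (hs' : s' ∈ Set.Ico (max 0 (L - δ)) L)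
    (h : 0 < (c * G (s, L) / outwardRoot α).re) : 0 < (c * G (s', L) / outwardRoot α).re := by
  have hmem : ∀ s ∈ Set.Ico (max 0 (L - δ)) L, (s, L) ∈ secantStrip L δ := fun s hs =>
    ⟨(le_max_left _ _).trans hs.1, hs.2,
      by have := (le_max_right _ _).trans hs.1; dsimp; linarith, le_rfl⟩
  refine re_pos_of_re_sq_pos (g := fun s => c * G (s, L))
    (isPreconnected_Ico (a := max 0 (L - δ)) (b := L))
    (continuousOn_const.mul (hG.comp (by fun_prop) hmem)) (fun s hs => ?_) hs hs' h
  have hm := hmem s hs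
  have hc' : (c : ℂ) ^ 2 = 1 := by rw [sq]; exact_mod_cast hc
  have := re_sub_div_outwardRoot_sq_pos (α := α) (hnorm s (secantStrip_mem hm).1)
    (hγL ▸ (hinj s L hm.1 hm.2.1 hm.2.2.1 hm.2.2.2).symm)
  rwa [mul_pow, hc', one_mul, hGsq _ hm, hγL]

/-- The square root of the short secants of a simple curve crossing the disk turns as little as that
of its chord: both endpoints of a short secant can be slid to those of the whole curve. -/
theorem re_sqrt_end_of_simple (hL : 1 ≤ L) (hγ : ContinuousOn γ (Set.Icc 0 L))
    (hnorm : ∀ t ∈ Set.Icc 0 L, ‖γ t‖ ≤ 1) (hinj : ∀ s t, 0 ≤ s → s < t → t ≤ L → γ t ≠ γ s)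
    (hγ0 : γ 0 = Complex.exp (β * Complex.I)) (hγL : γ L = Complex.exp (α * Complex.I))
    (hne : α ≠ β) (h2 : |α - β| < 2 * Real.pi)
    {g : ℝ → ℂ} (hg : ContinuousOn g (Set.Icc 0 (L - 1 / 2)))
    (hgsq : ∀ t ∈ Set.Icc 0 (L - 1 / 2), g t ^ 2 = γ (t + 1 / 2) - γ t)
    (hg0 : 0 < (g 0 / inwardRoot β).re) :
    0 < (chordSign α β * g (L - 1 / 2) / outwardRoot α).re := by
  have hinj' : ∀ s t, 0 ≤ s → s < t → t ≤ s + L → t ≤ L → γ t ≠ γ s :=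
    fun s t hs hst _ ht => hinj s t hs hst ht
  obtain ⟨G, hG, hGsq, hGg⟩ := exists_secant_sqrt (by linarith) (by linarith) hγ hinj' hg hgsq
  have h0L : 0 < (G (0, L) / inwardRoot β).re := by
    refine re_secant_sqrt_start hnorm hinj' hγ0 hG hGsq (t := 1 / 2) (by norm_num; linarith)
      (by norm_num; linarith) ?_
    have := hGg 0 ⟨le_rfl, by linarith⟩
    rw [zero_add] at this
    rwa [this]
  have hGκ : G (0, L) = chordRoot α β := by
    refine eq_of_sq_eq_of_re_pos ?_ h0L (re_chordRoot_div_inwardRoot_pos hne h2)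
    rw [hGsq _ ⟨le_rfl, by dsimp; linarith, by dsimp; linarith, le_rfl⟩, chordRoot_sq hne h2]
    simp only [hγ0, hγL]
  have := re_secant_sqrt_end hnorm hinj' hγL hG hGsq (chordSign_sq α β) (s := 0) (s' := L - 1 / 2)
    (by simp; linarith) (by simp; linarith)
    (by rw [hGκ]; exact re_chordRoot_div_outwardRoot_pos hne h2)
  have h3 := hGg (L - 1 / 2) ⟨by linarith, le_rfl⟩
  rw [sub_add_cancel] at h3
  rwa [h3] at this

theorem exp_half_add_int_mul_pi (x : ℝ) (w : ℤ) :
    Complex.exp (((x + 2 * Real.pi * w : ℝ) : ℂ) / 2 * Complex.I) =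
      ((w.negOnePow : ℤ) : ℂ) * Complex.exp (x / 2 * Complex.I) := by
  rw [show (((x + 2 * Real.pi * w : ℝ) : ℂ) / 2 * Complex.I) =
    w * (Real.pi * Complex.I) + x / 2 * Complex.I by push_cast; ring, Complex.exp_add,
    Complex.exp_int_mul, Complex.exp_pi_mul_I]
  rcases Int.even_or_odd w with hw | hw
  · simp [Int.negOnePow_even w hw, hw.neg_one_zpow]
  · simp [Int.negOnePow_odd w hw, hw.neg_one_zpow]

theorem val_negOnePow_mul_self (w : ℤ) : (w.negOnePow : ℤ) * (w.negOnePow : ℤ) = 1 := by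
  rw [← Units.val_mul, Int.units_mul_self, Units.val_one]

/-- The parity of the winding index is read off from a continuous square root of the secants, by
comparing it with the square root `exp (iθ/2)` given by the angle function `θ`. The angles by which
the initial and the final direction are straightened do not matter by `re_mul_exp_arg_pos`. -/
theorem re_sqrt_end_of_isWindingIndex (hL : 1 ≤ L) (hγ : ContinuousOn γ (Set.Icc 0 L))
    (hnorm : ∀ t ∈ Set.Icc 0 L, ‖γ t‖ ≤ 1)
    (hinj : ∀ s t, 0 ≤ s → s < t → t ≤ s + 1 / 2 → t ≤ L → γ t ≠ γ s)
    (hγ0 : γ 0 = Complex.exp (β * Complex.I)) (hγL : γ L = Complex.exp (α * Complex.I))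
    (hne : α ≠ β) (h2 : |α - β| < 2 * Real.pi)
    {g : ℝ → ℂ} (hg : ContinuousOn g (Set.Icc 0 (L - 1 / 2)))
    (hgsq : ∀ t ∈ Set.Icc 0 (L - 1 / 2), g t ^ 2 = γ (t + 1 / 2) - γ t)
    (hg0 : 0 < (g 0 / inwardRoot β).re) {w : ℤ} (hw : IsWindingIndex γ L w) :
    0 < ((w.negOnePow * chordSign α β : ℤ) * g (L - 1 / 2) / outwardRoot α).re := by
  obtain ⟨G, hG, hGsq, hGg⟩ := exists_secant_sqrt (by linarith) le_rfl hγ hinj hg hgsq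
  obtain ⟨ε, ⟨θ, hθ, hθF, hθ0, hθL⟩, hε, hε2⟩ :=
    (hw.and (Ioc_mem_nhdsGT (show (0 : ℝ) < 1 / 2 by norm_num))).exists
  have hεm : ε ∈ Set.Ioc 0 (min (1 / 2) L) := ⟨hε, le_min hε2 (by linarith)⟩
  have h0ε : 0 < (G (0, ε) / inwardRoot β).re := by
    refine re_secant_sqrt_start hnorm hinj hγ0 hG hGsq (t := 1 / 2)
      ⟨by norm_num, le_min le_rfl (by linarith)⟩ hεm ?_
    have := hGg 0 ⟨le_rfl, by linarith⟩
    rw [zero_add] at this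
    rwa [this]
  set c := γ L - γ 0 with hc
  set κ := chordRoot α β with hκ
  have hκc : κ ^ 2 = c := by rw [hκ, chordRoot_sq hne h2, hc, hγ0, hγL]
  have hκin := re_chordRoot_div_inwardRoot_pos hne h2
  have hκout := re_chordRoot_div_outwardRoot_pos hne h2
  have hκ0 : κ ≠ 0 := by rintro h; rw [← hκ, h] at hκin; simp at hκin
  have hc0 : c ≠ 0 := hκc ▸ pow_ne_zero 2 hκ0
  -- the square root obtained from the angle function of the winding index
  set F : ℝ → ℂ := fun t => (γ (t + ε) - γ t) / c with hF
  set h : ℝ → ℂ := fun t => κ * (√‖F t‖ : ℝ) * Complex.exp (θ t / 2 * Complex.I) with hh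
  have hmem : ∀ t ∈ Set.Icc 0 (L - ε), (t, t + ε) ∈ secantStrip L (1 / 2) :=
    fun t ht => ⟨ht.1, by dsimp; linarith, by dsimp; linarith, by dsimp; linarith [ht.2]⟩
  have hFc : ContinuousOn F (Set.Icc 0 (L - ε)) :=
    ((continuousOn_secant hγ fun p hp => secantStrip_mem hp).comp
      (f := fun t => (t, t + ε)) (by fun_prop) hmem).div_const c
  have hhc : ContinuousOn h (Set.Icc 0 (L - ε)) := by
    refine ((continuousOn_const).mul ?_).mul ?_
    · exact Complex.continuous_ofReal.comp_continuousOn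
        (Real.continuous_sqrt.comp_continuousOn hFc.norm)
    · refine Complex.continuous_exp.comp_continuousOn ?_
      exact ((Complex.continuous_ofReal.comp_continuousOn hθ).div_const 2).mul continuousOn_const
  have hhsq : ∀ t ∈ Set.Icc 0 (L - ε), h t ^ 2 = γ (t + ε) - γ t := by
    intro t ht
    have h1 : F t = ‖F t‖ * Complex.exp (θ t * Complex.I) := (hθF t ht).2
    have h3 : F t * c = γ (t + ε) - γ t := div_mul_cancel₀ _ hc0
    have h4 : ((2 : ℕ) : ℂ) * (θ t / 2 * Complex.I) = θ t * Complex.I := by push_cast; ring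
    rw [hh]
    simp only [mul_pow]
    rw [← Complex.exp_nat_mul, h4, ← Complex.ofReal_pow, Real.sq_sqrt (norm_nonneg _), hκc,
      mul_assoc, ← h1, mul_comm, h3]
  have h0m : (0 : ℝ) ∈ Set.Icc 0 (L - ε) := ⟨le_rfl, by linarith⟩
  have hLm : L - ε ∈ Set.Icc 0 (L - ε) := ⟨by linarith, le_rfl⟩
  have hFpos : ∀ t ∈ Set.Icc 0 (L - ε), 0 < √‖F t‖ := fun t ht =>
    Real.sqrt_pos.2 (norm_pos_iff.2 (hθF t ht).1)
  have hh0 : 0 < (h 0 / inwardRoot β).re := by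
    have hu : 0 < ((γ ε - γ 0) / inwardRoot β ^ 2).re := by
      have hm := hmem 0 h0m
      rw [hγ0]
      refine re_sub_div_inwardRoot_sq_pos (hnorm ε ⟨hε.le, by linarith⟩) ?_
      rw [← hγ0]
      exact hinj 0 ε le_rfl hε (by linarith) (by linarith)
    have hz2 : 0 < ((κ / inwardRoot β) ^ 2).re := by
      rw [div_pow, hκc, hc, hγ0]
      refine re_sub_div_inwardRoot_sq_pos (hnorm L ⟨by linarith, le_rfl⟩) ?_
      rw [hγL]
      intro he
      exact hc0 (by rw [hc, hγL, hγ0, he, sub_self])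
    have h3 := re_mul_exp_arg_pos hκin hz2 hu
    have h4 : h 0 / inwardRoot β = (√‖F 0‖ : ℝ) * (κ / inwardRoot β * Complex.exp
        (Complex.arg ((γ ε - γ 0) / inwardRoot β ^ 2 / (κ / inwardRoot β) ^ 2) / 2 *
          Complex.I)) := by
      have hi : inwardRoot β ^ 2 ≠ 0 := pow_ne_zero 2 (Complex.exp_ne_zero _)
      rw [div_pow, div_div_div_cancel_right₀ hi, hκc, ← hθ0]
      simp only [hh]; ring
    rw [h4, Complex.re_ofReal_mul]
    exact mul_pos (hFpos 0 h0m) h3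
  have hhL : 0 < ((w.negOnePow * chordSign α β : ℤ) * h (L - ε) / outwardRoot α).re := by
    have hu : 0 < ((γ L - γ (L - ε)) / outwardRoot α ^ 2).re := by
      rw [hγL]
      refine re_sub_div_outwardRoot_sq_pos (hnorm _ ⟨by linarith, by linarith⟩) ?_
      rw [← hγL]
      exact (hinj (L - ε) L (by linarith) (by linarith) (by linarith) le_rfl).symm
    have hs2 : (chordSign α β : ℂ) ^ 2 = 1 := by rw [sq]; exact_mod_cast chordSign_sq α β
    have hw2 : ((w.negOnePow : ℤ) : ℂ) ^ 2 = 1 := by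
      rw [sq]; exact_mod_cast val_negOnePow_mul_self w
    have hz2 : 0 < ((chordSign α β * κ / outwardRoot α) ^ 2).re := by
      rw [div_pow, mul_pow, hs2, one_mul, hκc, hc, hγL]
      refine re_sub_div_outwardRoot_sq_pos (hnorm 0 ⟨le_rfl, by linarith⟩) ?_
      rw [hγ0]
      intro he
      exact hc0 (by rw [hc, hγL, hγ0, he, sub_self])
    have h3 := re_mul_exp_arg_pos hκout hz2 hu
    have h4 : (w.negOnePow * chordSign α β : ℤ) * h (L - ε) / outwardRoot α = (√‖F (L - ε)‖ : ℝ) *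
        (chordSign α β * κ / outwardRoot α * Complex.exp
        (Complex.arg ((γ L - γ (L - ε)) / outwardRoot α ^ 2 /
          (chordSign α β * κ / outwardRoot α) ^ 2) / 2 * Complex.I)) := by
      have hi : outwardRoot α ^ 2 ≠ 0 := pow_ne_zero 2 (Complex.exp_ne_zero _)
      rw [div_pow, mul_pow, hs2, one_mul, div_div_div_cancel_right₀ hi, hκc]
      simp only [hh]
      rw [hθL, exp_half_add_int_mul_pi]
      push_cast
      linear_combination ((chordSign α β : ℂ) * κ * (√‖F (L - ε)‖ : ℝ) * Complex.exp
        (Complex.arg ((γ L - γ (L - ε)) / c) / 2 * Complex.I) / outwardRoot α) * hw2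
    rw [h4, Complex.re_ofReal_mul]
    exact mul_pos (hFpos _ hLm) h3
  have heq := eqOn_of_sq_eq isPreconnected_Icc hhc (hG.comp (by fun_prop) hmem) hhsq
    (fun t ht => hGsq _ (hmem t ht)) (fun t ht => by
      rw [← hhsq t ht]
      refine pow_ne_zero 2 (mul_ne_zero (mul_ne_zero hκ0 ?_) (Complex.exp_ne_zero _))
      exact_mod_cast (hFpos t ht).ne') h0m
    (eq_of_sq_eq_of_re_pos (ω := inwardRoot β)
      (by rw [hhsq 0 h0m, Function.comp, hGsq _ (hmem 0 h0m)]) hh0 (by simpa using h0ε))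
  have hGL := heq _ hLm
  simp only [Function.comp, sub_add_cancel] at hGL
  rw [hGL] at hhL
  have hc2 : (w.negOnePow * chordSign α β : ℤ) * (w.negOnePow * chordSign α β : ℤ) = (1 : ℤ) := by
    have h1 := val_negOnePow_mul_self w
    have h3 := chordSign_sq α β
    linear_combination (chordSign α β * chordSign α β) * h1 + h3
  have := re_secant_sqrt_end hnorm hinj hγL hG hGsq hc2 (s := L - ε) (s' := L - 1 / 2)
    ⟨max_le (by linarith) (by linarith), by linarith⟩
    ⟨max_le (by linarith) (by linarith), by linarith⟩ hhL
  have h3 := hGg (L - 1 / 2) ⟨by linarith, le_rfl⟩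
  rw [sub_add_cancel] at h3
  rwa [h3] at this

end Chord

/-! ### Existence of the winding index -/

/-- Two continuous logarithms of the same function differ by a constant. -/
theorem exists_int_of_exp_eq {X : Type*} [TopologicalSpace X] {S : Set X} (hS : IsPreconnected S)
    {a b : X → ℂ} (ha : ContinuousOn a S) (hb : ContinuousOn b S)
    (h : ∀ t ∈ S, Complex.exp (a t) = Complex.exp (b t)) :
    ∃ k : ℤ, ∀ t ∈ S, a t = b t + k * (2 * Real.pi * Complex.I) := by
  have hd : IsDiscrete (Set.range ((↑) : ℤ → ℝ)) := by
    refine ⟨?_⟩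
    exact Int.isClosedEmbedding_coe_real.toHomeomorph.symm.isEmbedding.discreteTopology
  have hpi : (2 * Real.pi : ℝ) ≠ 0 := by have := Real.pi_pos; positivity
  have key : ∀ t ∈ S, ∃ k : ℤ, a t = b t + k * (2 * Real.pi * Complex.I) := fun t ht =>
    Complex.exp_eq_exp_iff_exists_int.1 (h t ht)
  have him : ∀ (k : ℤ) (t : X), a t = b t + k * (2 * Real.pi * Complex.I) →
      (a t - b t).im / (2 * Real.pi) = k := by
    intro k t hk
    rw [hk, add_sub_cancel_left, show (k * (2 * Real.pi * Complex.I) : ℂ) =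
      ((k * (2 * Real.pi) : ℝ) : ℂ) * Complex.I by push_cast; ring, Complex.im_ofReal_mul,
      Complex.I_im, mul_one, mul_div_assoc, div_self hpi, mul_one]
  obtain ⟨y, ⟨k, rfl⟩, hk⟩ := hS.eqOn_const_of_mapsTo hd
    (f := fun t => (a t - b t).im / (2 * Real.pi))
    ((Complex.continuous_im.comp_continuousOn (ha.sub hb)).div_const _)
    (fun t ht => by obtain ⟨k, hk⟩ := key t ht; exact ⟨k, (him k t hk).symm⟩) ⟨_, 0, rfl⟩
  refine ⟨k, fun t ht => ?_⟩
  obtain ⟨k', hk'⟩ := key t ht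
  have h1 := him k' t hk'
  have h2 := hk ht
  simp only [Function.const] at h2
  rw [h1] at h2
  have : k' = k := by exact_mod_cast h2
  rw [hk', this]

theorem div_mem_slitPlane {u v : ℂ} (hu : 0 < u.re) (hv : 0 < v.re) : u / v ∈ Complex.slitPlane := by
  have hv0 : v ≠ 0 := by rintro rfl; simp at hv
  rw [Complex.mem_slitPlane_iff]
  by_contra hcon
  push Not at hcon
  have h1 : u = ((u / v).re : ℝ) * v := by
    conv_lhs => rw [← div_mul_cancel₀ u hv0]
    congr 1
    exact Complex.ext (by simp) (by simpa using hcon.2)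
  have h2 : u.re = (u / v).re * v.re := by conv_lhs => rw [h1, Complex.re_ofReal_mul]
  nlinarith [hcon.1]

/-- A locally injective curve in the disk between different points of its boundary has a winding
index. -/
theorem exists_isWindingIndex {γ : ℝ → ℂ} {L α β : ℝ} (hL : 1 ≤ L)
    (hγ : ContinuousOn γ (Set.Icc 0 L)) (hnorm : ∀ t ∈ Set.Icc 0 L, ‖γ t‖ ≤ 1)
    (hinj : ∀ s t, 0 ≤ s → s < t → t ≤ s + 1 / 2 → t ≤ L → γ t ≠ γ s)
    (hγ0 : γ 0 = Complex.exp (β * Complex.I)) (hγL : γ L = Complex.exp (α * Complex.I))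
    (hne : γ L ≠ γ 0) : ∃ w, IsWindingIndex γ L w := by
  set c := γ L - γ 0 with hc
  have hc0 : c ≠ 0 := sub_ne_zero.2 hne
  set D := secantStrip L (1 / 2) with hD
  obtain ⟨h, hh, hexp⟩ := exists_continuousOn_exp_eq (convex_secantStrip L (1 / 2))
    (f := fun p => (γ p.2 - γ p.1) / c)
    ((continuousOn_secant hγ fun p hp => secantStrip_mem hp).div_const c)
    (fun p hp => div_ne_zero (sub_ne_zero.2 (hinj _ _ hp.1 hp.2.1 hp.2.2.1 hp.2.2.2)) hc0)
  have hpre : IsPreconnected (Set.Ioc (0 : ℝ) (1 / 2)) := isPreconnected_Ioc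
  have hm0 : ∀ ε ∈ Set.Ioc (0 : ℝ) (1 / 2), (0, ε) ∈ D := fun ε hε =>
    ⟨le_rfl, hε.1, by simpa using hε.2, by have := hε.2; dsimp; linarith⟩
  have hmL : ∀ ε ∈ Set.Ioc (0 : ℝ) (1 / 2), (L - ε, L) ∈ D := fun ε hε =>
    ⟨by have := hε.2; dsimp; linarith, by have := hε.1; dsimp; linarith,
      by have := hε.2; dsimp; linarith, le_rfl⟩
  have hs0 : ∀ ε ∈ Set.Ioc (0 : ℝ) (1 / 2), (γ ε - γ 0) / c ∈ Complex.slitPlane := by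
    intro ε hε
    have hm := hm0 ε hε
    have hi : inwardRoot β ^ 2 ≠ 0 := pow_ne_zero 2 (Complex.exp_ne_zero _)
    rw [← div_div_div_cancel_right₀ hi]
    refine div_mem_slitPlane ?_ ?_
    · rw [hγ0]
      refine re_sub_div_inwardRoot_sq_pos (hnorm _ (secantStrip_mem hm).2) ?_
      rw [← hγ0]; exact hinj 0 ε le_rfl hm.2.1 hm.2.2.1 hm.2.2.2
    · rw [hc, hγ0]
      refine re_sub_div_inwardRoot_sq_pos (hnorm _ ⟨by linarith, le_rfl⟩) ?_
      rwa [← hγ0]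
  have hsL : ∀ ε ∈ Set.Ioc (0 : ℝ) (1 / 2), (γ L - γ (L - ε)) / c ∈ Complex.slitPlane := by
    intro ε hε
    have hm := hmL ε hε
    have hi : outwardRoot α ^ 2 ≠ 0 := pow_ne_zero 2 (Complex.exp_ne_zero _)
    rw [← div_div_div_cancel_right₀ hi]
    refine div_mem_slitPlane ?_ ?_
    · rw [hγL]
      refine re_sub_div_outwardRoot_sq_pos (hnorm _ (secantStrip_mem hm).1) ?_
      rw [← hγL]; exact (hinj (L - ε) L hm.1 hm.2.1 hm.2.2.1 hm.2.2.2).symm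
    · rw [hc, hγL]
      refine re_sub_div_outwardRoot_sq_pos (hnorm _ ⟨le_rfl, by linarith⟩) ?_
      rw [← hγL]; exact hne.symm
  have hb0 : ContinuousOn (fun ε => (γ ε - γ 0) / c) (Set.Ioc (0 : ℝ) (1 / 2)) :=
    ((continuousOn_secant hγ fun p hp => secantStrip_mem hp).comp
      (f := fun ε => ((0 : ℝ), ε)) (by fun_prop) hm0).div_const c
  have hbL : ContinuousOn (fun ε => (γ L - γ (L - ε)) / c) (Set.Ioc (0 : ℝ) (1 / 2)) :=
    ((continuousOn_secant hγ fun p hp => secantStrip_mem hp).comp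
      (f := fun ε => (L - ε, L)) (by fun_prop) hmL).div_const c
  obtain ⟨k0, hk0⟩ := exists_int_of_exp_eq hpre (hh.comp (by fun_prop) hm0) (hb0.clog hs0)
    (fun ε hε => by
      rw [Function.comp, hexp _ (hm0 ε hε), Complex.exp_log (Complex.slitPlane_ne_zero (hs0 ε hε))])
  obtain ⟨k1, hk1⟩ := exists_int_of_exp_eq hpre
    (hh.comp (f := fun ε => (L - ε, L)) (by fun_prop) hmL) (hbL.clog hsL)
    (fun ε hε => by
      rw [Function.comp, hexp _ (hmL ε hε), Complex.exp_log (Complex.slitPlane_ne_zero (hsL ε hε))])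
  have him : ∀ (z : ℂ) (k : ℤ), (Complex.log z + k * (2 * Real.pi * Complex.I)).im =
      Complex.arg z + k * (2 * Real.pi) := by
    intro z k
    rw [Complex.add_im, Complex.log_im, show (k * (2 * Real.pi * Complex.I) : ℂ) =
      ((k * (2 * Real.pi) : ℝ) : ℂ) * Complex.I by push_cast; ring, Complex.im_ofReal_mul,
      Complex.I_im, mul_one]
  refine ⟨k1 - k0, ?_⟩
  filter_upwards [Ioc_mem_nhdsGT (show (0 : ℝ) < 1 / 2 by norm_num)] with ε hε
  have hmem : ∀ t ∈ Set.Icc 0 (L - ε), (t, t + ε) ∈ D :=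
    fun t ht => ⟨ht.1, by have := hε.1; dsimp; linarith, by have := hε.2; dsimp; linarith,
      by dsimp; linarith [ht.2]⟩
  refine ⟨fun t => (h (t, t + ε)).im - k0 * (2 * Real.pi), ?_, ?_, ?_, ?_⟩
  · exact (Complex.continuous_im.comp_continuousOn (hh.comp (by fun_prop) hmem)).sub
      continuousOn_const
  · intro t ht
    have h1 := hexp _ (hmem t ht)
    dsimp only at h1
    rw [← h1]
    refine ⟨Complex.exp_ne_zero _, ?_⟩
    rw [Complex.norm_exp, Complex.ofReal_exp, ← Complex.exp_add,
      Complex.exp_eq_exp_iff_exists_int]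
    refine ⟨k0, ?_⟩
    conv_lhs => rw [← Complex.re_add_im (h (t, t + ε))]
    push_cast; ring
  · have := congrArg Complex.im (hk0 ε hε)
    simp only [Function.comp, him] at this
    beta_reduce
    rw [zero_add, this, hc]; ring
  · have := congrArg Complex.im (hk1 ε hε)
    simp only [Function.comp, him] at this
    beta_reduce
    rw [sub_add_cancel, this, hc]; push_cast; ring

/-! ### Simple closed curves and disjoint curves -/

/-- The parameter pairs `(s, t)` of the secants `γ t - γ s`, `0 < t - s < m`, of a closed curve of
period `m` that is traversed twice, the starting point being restricted to `[0, c]`. -/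
def closedSecantStrip (m c : ℝ) : Set (ℝ × ℝ) :=
  {p | 0 ≤ p.1 ∧ p.1 < p.2 ∧ p.2 < p.1 + m ∧ p.2 ≤ 2 * m ∧ p.1 ≤ c}

theorem convex_closedSecantStrip (m c : ℝ) : Convex ℝ (closedSecantStrip m c) := by
  rintro ⟨a, b⟩ ⟨h1, h2, h3, h4, h5⟩ ⟨a', b'⟩ ⟨k1, k2, k3, k4, k5⟩ x y hx hy hxy
  simp only [closedSecantStrip, Set.mem_ofPred_eq, Prod.smul_mk, Prod.mk_add_mk,
    smul_eq_mul] at *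
  have hy' : y = 1 - x := by linarith
  subst hy'
  rcases hx.eq_or_lt with rfl | hx
  · simp only [zero_mul, sub_zero, one_mul, zero_add]
    exact ⟨k1, k2, k3, k4, k5⟩
  · exact ⟨by positivity, by nlinarith, by nlinarith, by nlinarith, by nlinarith⟩

/-- The rotation number of a simple closed curve is odd: a square root of the secants is multiplied
by a fourth root of unity `± i` under `(s, t) ↦ (t, s + m)`, which reverses the secant, and applying
this twice gives one full turn along the curve. -/
theorem sqrt_end_of_closed {γ : ℝ → ℂ} {m : ℝ} (hm : 1 ≤ m)
    (hγ : ContinuousOn γ (Set.Icc 0 (2 * m))) (hper : ∀ t ∈ Set.Icc 0 m, γ (t + m) = γ t)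
    (hinj : ∀ s t, 0 ≤ s → s < t → t < s + m → t ≤ 2 * m → γ t ≠ γ s)
    {g : ℝ → ℂ} (hg : ContinuousOn g (Set.Icc 0 m))
    (hgsq : ∀ t ∈ Set.Icc 0 m, g t ^ 2 = γ (t + 1 / 2) - γ t) : g m = - g 0 := by
  have hsub : closedSecantStrip m m ⊆ closedSecantStrip m (2 * m) := fun p hp =>
    ⟨hp.1, hp.2.1, hp.2.2.1, hp.2.2.2.1, by have := hp.2.2.2.2; linarith⟩
  have hne : ∀ p ∈ closedSecantStrip m (2 * m), γ p.2 - γ p.1 ≠ 0 := fun p hp =>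
    sub_ne_zero.2 (hinj _ _ hp.1 hp.2.1 hp.2.2.1 hp.2.2.2.1)
  have hmem : ∀ t ∈ Set.Icc 0 m, (t, t + 1 / 2) ∈ closedSecantStrip m (2 * m) := fun t ht =>
    ⟨ht.1, by dsimp; linarith, by dsimp; linarith, by have := ht.2; dsimp; linarith,
      by have := ht.2; dsimp; linarith⟩
  have h0 : (0 : ℝ) ∈ Set.Icc 0 m := ⟨le_rfl, by linarith⟩
  obtain ⟨G, hG, hGsq, hG0⟩ := exists_continuousOn_sq_eq (convex_closedSecantStrip m (2 * m))
    (f := fun p => γ p.2 - γ p.1) (continuousOn_secant hγ fun p hp => ⟨⟨hp.1, by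
      have := hp.2.2.2.2; linarith⟩, ⟨by have := hp.1; have := hp.2.1; linarith, hp.2.2.2.1⟩⟩)
    hne (hmem 0 h0) (by simpa using hgsq 0 h0)
  have hGg : ∀ t ∈ Set.Icc 0 m, G (t, t + 1 / 2) = g t :=
    eqOn_of_sq_eq isPreconnected_Icc (hG.comp (by fun_prop) hmem) hg
      (fun t ht => hGsq _ (hmem t ht)) hgsq (fun t ht => hne _ (hmem t ht)) h0 hG0
  have hmap : ∀ p ∈ closedSecantStrip m m, (p.2, p.1 + m) ∈ closedSecantStrip m (2 * m) :=
    fun p ⟨h1, h2, h3, h4, h5⟩ => ⟨by dsimp; linarith, h3, by dsimp; linarith,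
      by dsimp; linarith, h4⟩
  have hflip := (convex_closedSecantStrip m m).isPreconnected.eq_or_eq_neg_of_sq_eq
    (f := fun p => G (p.2, p.1 + m)) (g := fun p => Complex.I * G p)
    (hG.comp (by fun_prop) hmap) (continuousOn_const.mul (hG.mono hsub))
    (fun p hp => by
      simp only [Pi.pow_apply]
      rw [hGsq _ (hmap p hp), mul_pow, Complex.I_sq, hGsq _ (hsub hp)]
      dsimp only
      rw [hper p.1 ⟨hp.1, hp.2.2.2.2⟩]; ring)
    (fun {p} hp h1 => hne p (hsub hp) (by
      rw [← hGsq p (hsub hp), (mul_eq_zero.1 h1).resolve_left Complex.I_ne_zero]; simp))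
  have hp1 : ((0 : ℝ), (1 / 2 : ℝ)) ∈ closedSecantStrip m m :=
    ⟨le_rfl, by norm_num, by dsimp; linarith, by dsimp; linarith, by dsimp; linarith⟩
  have hp2 : ((1 / 2 : ℝ), m) ∈ closedSecantStrip m m :=
    ⟨by norm_num, by dsimp; linarith, by dsimp; linarith, by dsimp; linarith, by dsimp; linarith⟩
  have hgm := hGg m ⟨by linarith, le_rfl⟩
  have hg0 := hGg 0 h0
  rw [zero_add] at hg0
  rcases hflip with hflip | hflip
  · have h1 := hflip hp1
    have h2 := hflip hp2
    simp only [zero_add] at h1 h2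
    rw [add_comm, hgm, h1, hg0, ← mul_assoc, Complex.I_mul_I] at h2
    simpa using h2
  · have h1 := hflip hp1
    have h2 := hflip hp2
    simp only [zero_add, Pi.neg_apply] at h1 h2
    rw [add_comm, hgm, h1, hg0, mul_neg, neg_neg, ← mul_assoc, Complex.I_mul_I] at h2
    simpa using h2

/-- Two disjoint curves in the disk between points of its boundary: the end points of the second
one are not separated by those of the first one. A continuous square root of `γ s - η t` is
continued along the two ways from `(0, 0)` to `(K, L)` around the rectangle of parameters. -/
theorem chordSign_eq_of_disjoint {γ η : ℝ → ℂ} {K L α α' β β' : ℝ} (hK : 0 ≤ K) (hL : 0 ≤ L)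
    (hγ : ContinuousOn γ (Set.Icc 0 K)) (hη : ContinuousOn η (Set.Icc 0 L))
    (hγn : ∀ t ∈ Set.Icc 0 K, ‖γ t‖ ≤ 1) (hηn : ∀ t ∈ Set.Icc 0 L, ‖η t‖ ≤ 1)
    (hdisj : ∀ s ∈ Set.Icc 0 K, ∀ t ∈ Set.Icc 0 L, γ s ≠ η t)
    (hγ0 : γ 0 = Complex.exp (α * Complex.I)) (hγK : γ K = Complex.exp (α' * Complex.I))
    (hη0 : η 0 = Complex.exp (β * Complex.I)) (hηL : η L = Complex.exp (β' * Complex.I))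
    (h1 : |α - β| < 2 * Real.pi) (h2 : |α' - β| < 2 * Real.pi)
    (h3 : |α - β'| < 2 * Real.pi) (h4 : |α' - β'| < 2 * Real.pi) :
    chordSign α β * chordSign α β' = chordSign α' β * chordSign α' β' := by
  have ha : (0 : ℝ) ∈ Set.Icc 0 K := ⟨le_rfl, hK⟩
  have ha' : K ∈ Set.Icc 0 K := ⟨hK, le_rfl⟩
  have hb : (0 : ℝ) ∈ Set.Icc 0 L := ⟨le_rfl, hL⟩
  have hb' : L ∈ Set.Icc 0 L := ⟨hL, le_rfl⟩
  have hn1 : α ≠ β := by rintro rfl; exact hdisj _ ha _ hb (hγ0.trans hη0.symm)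
  have hn2 : α' ≠ β := by rintro rfl; exact hdisj _ ha' _ hb (hγK.trans hη0.symm)
  have hn3 : α ≠ β' := by rintro rfl; exact hdisj _ ha _ hb' (hγ0.trans hηL.symm)
  have hn4 : α' ≠ β' := by rintro rfl; exact hdisj _ ha' _ hb' (hγK.trans hηL.symm)
  set D : Set (ℝ × ℝ) := Set.Icc 0 K ×ˢ Set.Icc 0 L with hD
  obtain ⟨G, hG, hGsq, hG0⟩ := exists_continuousOn_sq_eq (D := D)
    ((convex_Icc 0 K).prod (convex_Icc 0 L)) (f := fun p => γ p.1 - η p.2)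
    ((hγ.comp continuousOn_fst fun p hp => hp.1).sub (hη.comp continuousOn_snd fun p hp => hp.2))
    (fun p hp => sub_ne_zero.2 (hdisj _ hp.1 _ hp.2)) (p₀ := (0, 0)) ⟨ha, hb⟩
    (z := chordRoot α β) (by rw [chordRoot_sq hn1 h1, hγ0, hη0])
  -- sliding the end of a secant along `γ`
  have slideγ : ∀ (t b : ℝ) (ht : t ∈ Set.Icc 0 L) (hbt : η t = Complex.exp (b * Complex.I)) (c : ℤ)
      (hc : c * c = 1) (hab : α ≠ b) (hab' : |α - b| < 2 * Real.pi) (ha'b : α' ≠ b)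
      (ha'b' : |α' - b| < 2 * Real.pi) (h : c * G (0, t) = chordRoot α b),
      c * G (K, t) = chordRoot α' b := by
    intro t b ht hbt c hc hab hab' ha'b ha'b' h
    have hc' : (c : ℂ) ^ 2 = 1 := by rw [sq]; exact_mod_cast hc
    refine eq_of_sq_eq_of_re_pos ?_ ?_ (re_chordRoot_div_inwardRoot_pos ha'b ha'b')
    · rw [mul_pow, hc', one_mul, hGsq _ ⟨ha', ht⟩, chordRoot_sq ha'b ha'b', hγK, hbt]
    · refine re_pos_of_re_sq_pos (g := fun s => c * G (s, t)) (isPreconnected_Icc (a := 0) (b := K))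
        (continuousOn_const.mul (hG.comp (by fun_prop) fun s hs => ⟨hs, ht⟩))
        (fun s hs => ?_) ha ha' ?_
      · rw [mul_pow, hc', one_mul, hGsq _ ⟨hs, ht⟩, hbt]
        exact re_sub_div_inwardRoot_sq_pos (hγn s hs) (hbt ▸ hdisj s hs t ht)
      · rw [h]; exact re_chordRoot_div_inwardRoot_pos hab hab'
  -- sliding the start of a secant along `η`
  have slideη : ∀ (s a : ℝ) (hs : s ∈ Set.Icc 0 K) (has : γ s = Complex.exp (a * Complex.I))
      (hab : a ≠ β) (hab' : |a - β| < 2 * Real.pi) (ha'b : a ≠ β')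
      (ha'b' : |a - β'| < 2 * Real.pi) (h : G (s, 0) = chordRoot a β),
      ((chordSign a β * chordSign a β' : ℤ) : ℂ) * G (s, L) = chordRoot a β' := by
    intro s a hs has hab hab' ha'b ha'b' h
    have hc1 : (chordSign a β : ℂ) ^ 2 = 1 := by rw [sq]; exact_mod_cast chordSign_sq a β
    have hc2 : (chordSign a β' : ℂ) ^ 2 = 1 := by rw [sq]; exact_mod_cast chordSign_sq a β'
    have key : chordSign a β * G (s, L) = chordSign a β' * chordRoot a β' := by
      refine eq_of_sq_eq_of_re_pos ?_ ?_ (re_chordRoot_div_outwardRoot_pos ha'b ha'b')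
      · rw [mul_pow, hc1, one_mul, hGsq _ ⟨hs, hb'⟩, mul_pow, hc2, one_mul,
          chordRoot_sq ha'b ha'b', has, hηL]
      · refine re_pos_of_re_sq_pos (g := fun t => chordSign a β * G (s, t))
          (isPreconnected_Icc (a := 0) (b := L))
          (continuousOn_const.mul (hG.comp (by fun_prop) fun t ht => ⟨hs, ht⟩))
          (fun t ht => ?_) hb hb' ?_
        · rw [mul_pow, hc1, one_mul, hGsq _ ⟨hs, ht⟩, has]
          exact re_sub_div_outwardRoot_sq_pos (hηn t ht) (has ▸ (hdisj s hs t ht).symm)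
        · rw [h]; exact re_chordRoot_div_outwardRoot_pos hab hab'
    push_cast
    linear_combination (chordSign a β' : ℂ) * key + chordRoot a β' * hc2
  have e1 := slideη 0 α ha hγ0 hn1 h1 hn3 h3 hG0
  have hcc : (chordSign α β * chordSign α β') * (chordSign α β * chordSign α β') = 1 := by
    linear_combination (chordSign α β * chordSign α β) * chordSign_sq α β' + chordSign_sq α β
  have e2 := slideγ L β' hb' hηL _ hcc hn3 h3 hn4 h4 e1
  have e3 := slideγ 0 β hb hη0 1 (by norm_num) hn1 h1 hn2 h2 (by simpa using hG0)
  have e4 := slideη K α' ha' hγK hn2 h2 hn4 h4 (by simpa using e3)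
  have hG0 : G (K, L) ≠ 0 := by
    intro h0
    have := hGsq _ (show (K, L) ∈ D from ⟨ha', hb'⟩)
    rw [h0] at this
    exact sub_ne_zero.2 (hdisj _ ha' _ hb') (by simpa using this.symm)
  exact_mod_cast mul_right_cancel₀ hG0 (e2.trans e4.symm)

/-! ### The curve traced by a walk -/

namespace PlanarCircularDigraph

variable {V E : Type*} {n : ℕ} (G : PlanarCircularDigraph V E n)

/-- The vertex reached by the walk `P` with end vertex `v` after `k` steps. -/
def walkVertex (P : List E) (v : V) (k : ℕ) : V :=
  if h : k < P.length then G.src P[k] else v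

theorem b_injective : Function.Injective G.b := by
  obtain ⟨φ, hφ, hφ2, hb⟩ := G.clockwise
  intro i j hij
  by_contra hne
  have h1 : Complex.exp (φ i * Complex.I) = Complex.exp (φ j * Complex.I) := by
    rw [← hb, ← hb, hij]
  obtain ⟨k, hk⟩ := Complex.exp_eq_exp_iff_exists_int.1 h1
  have h2 : φ i = φ j + k * (2 * Real.pi) := by
    have := congrArg Complex.im hk
    simpa using this
  have h3 := hφ2 i j
  have h4 := hφ2 j i
  have hpi := Real.pi_pos
  have h5 : (k : ℝ) < 1 := by by_contra h; push Not at h; nlinarith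
  have h6 : (-1 : ℝ) < k := by by_contra h; push Not at h; nlinarith
  have h7 : k < 1 := by exact_mod_cast h5
  have h8 : -1 < k := by exact_mod_cast h6
  have h9 : k = 0 := by omega
  rw [h9] at h2
  exact hne (hφ.injective (by simpa using h2))

theorem norm_pos_le (v : V) : ‖G.pos v‖ ≤ 1 := by
  by_cases hv : v ∈ Set.range G.b
  · obtain ⟨i, rfl⟩ := hv
    obtain ⟨φ, -, -, hb⟩ := G.clockwise
    rw [hb, Complex.norm_exp_ofReal_mul_I]
  · exact (G.norm_pos_lt v hv).le

variable {G}

theorem walkCurve_zero_cons (e : E) (p : List E) : G.walkCurve (e :: p) 0 = G.pos (G.src e) := by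
  simp [walkCurve]

/-- A point of the curve of a walk lies in the interior of an arc or is one of the vertices. -/
theorem walkCurve_cases : ∀ {P : List E} {u v : V}, G.IsWalk u P v → P ≠ [] → ∀ {t : ℝ},
    0 ≤ t → t ≤ P.length →
    (∃ k, ∃ h : k < P.length, (k : ℝ) < t ∧ t < k + 1 ∧
      G.walkCurve P t = (G.arc P[k]).extend (t - k)) ∨
    (∃ k ≤ P.length, t = (k : ℝ) ∧ G.walkCurve P t = G.pos (G.walkVertex P v k))
  | [], _, _, _, h, _, _, _ => absurd rfl h
  | e :: p, u, v, hP, _, t, h0, hl => by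
    rcases lt_trichotomy t 1 with ht | rfl | ht
    · rcases h0.eq_or_lt with rfl | h0
      · exact .inr ⟨0, by simp, by simp, by simp [walkCurve, walkVertex]⟩
      · exact .inl ⟨0, by simp, by simpa using h0, by simpa using ht, by simp [walkCurve, ht.le]⟩
    · refine .inr ⟨1, by simp, by simp, ?_⟩
      cases p with
      | nil => simp [walkCurve, walkVertex, show G.tgt e = v from hP.2]
      | cons e' q => simp [walkCurve, walkVertex, show G.src e' = G.tgt e from hP.2.1]
    · have hp : p ≠ [] := by
        rintro rfl
        simp at hl; linarith
      have hcur : G.walkCurve (e :: p) t = G.walkCurve p (t - 1) := by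
        simp [walkCurve, not_le.2 ht]
      simp only [List.length_cons, Nat.cast_add, Nat.cast_one] at hl
      rcases walkCurve_cases hP.2 hp (t := t - 1) (by linarith) (by linarith) with
        ⟨k, hk, h1, h2, h3⟩ | ⟨k, hk, h1, h2⟩
      · refine .inl ⟨k + 1, by simpa using hk, by push_cast; linarith, by push_cast; linarith, ?_⟩
        rw [hcur, h3]
        simp only [List.getElem_cons_succ]
        congr 1; push_cast; ring
      · refine .inr ⟨k + 1, by simpa using hk, by push_cast; linarith, ?_⟩
        rw [hcur, h2]
        simp [walkVertex]

theorem walkCurve_length {P : List E} {u v : V} (hP : G.IsWalk u P v) (hne : P ≠ []) :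
    G.walkCurve P P.length = G.pos v := by
  rcases walkCurve_cases hP hne (t := P.length) (by positivity) le_rfl with
    ⟨k, hk, h1, h2, -⟩ | ⟨k, hk, h1, h2⟩
  · have h3 : P.length < k + 1 := by exact_mod_cast h2
    omega
  · have h3 : P.length = k := by exact_mod_cast h1
    rw [h2, walkVertex, dif_neg (by omega)]

theorem walkCurve_zero {P : List E} {u v : V} (hP : G.IsWalk u P v) (hne : P ≠ []) :
    G.walkCurve P 0 = G.pos u := by
  cases P with
  | nil => exact absurd rfl hne
  | cons e p => rw [walkCurve_zero_cons, show G.src e = u from hP.1]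

theorem norm_arc_extend_lt (e : E) {t : ℝ} (h0 : 0 < t) (h1 : t < 1) :
    ‖(G.arc e).extend t‖ < 1 := by
  rw [Path.extend_apply _ ⟨h0.le, h1.le⟩]
  exact G.norm_arc_lt _ _ (by exact_mod_cast h0) (by exact_mod_cast h1)

theorem arc_extend_ne_pos (e : E) {t : ℝ} (h0 : 0 < t) (h1 : t < 1) (v : V) :
    (G.arc e).extend t ≠ G.pos v := by
  rw [Path.extend_apply _ ⟨h0.le, h1.le⟩]
  exact G.arc_ne_pos _ _ _ (by exact_mod_cast h0) (by exact_mod_cast h1)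

theorem arc_extend_injective {e e' : E} {t t' : ℝ} (h0 : 0 < t) (h1 : t < 1) (h0' : 0 < t')
    (h1' : t' < 1) (h : (G.arc e).extend t = (G.arc e').extend t') : e = e' ∧ t = t' := by
  rw [Path.extend_apply _ ⟨h0.le, h1.le⟩, Path.extend_apply _ ⟨h0'.le, h1'.le⟩] at h
  have := G.arc_injective _ _ _ _ (by exact_mod_cast h0) (by exact_mod_cast h1)
    (by exact_mod_cast h0') (by exact_mod_cast h1') h
  exact ⟨this.1, congrArg Subtype.val this.2⟩

theorem norm_walkCurve_le {P : List E} {u v : V} (hP : G.IsWalk u P v) (hne : P ≠ []) {t : ℝ}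
    (ht : t ∈ Set.Icc (0 : ℝ) P.length) : ‖G.walkCurve P t‖ ≤ 1 := by
  rcases walkCurve_cases hP hne ht.1 ht.2 with ⟨k, hk, h1, h2, h3⟩ | ⟨k, hk, h1, h2⟩
  · rw [h3]; exact (norm_arc_extend_lt _ (by linarith) (by linarith)).le
  · rw [h2]; exact G.norm_pos_le _

/-- Where two walks meet, they are at the same point of the same edge or at the same vertex. -/
theorem walkCurve_collision {P Q : List E} {u v u' v' : V} (hP : G.IsWalk u P v) (hPne : P ≠ [])
    (hQ : G.IsWalk u' Q v') (hQne : Q ≠ []) {s t : ℝ} (hs : s ∈ Set.Icc (0 : ℝ) P.length)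
    (ht : t ∈ Set.Icc (0 : ℝ) Q.length) (h : G.walkCurve P s = G.walkCurve Q t) :
    (∃ k l, ∃ (hk : k < P.length) (hl : l < Q.length), P[k] = Q[l] ∧ s - k = t - l) ∨
    ∃ k ≤ P.length, ∃ l ≤ Q.length, s = (k : ℝ) ∧ t = (l : ℝ) ∧
      G.walkVertex P v k = G.walkVertex Q v' l := by
  rcases walkCurve_cases hP hPne hs.1 hs.2 with ⟨k, hk, h1, h2, h3⟩ | ⟨k, hk, h1, h2⟩ <;>
  rcases walkCurve_cases hQ hQne ht.1 ht.2 with ⟨l, hl, k1, k2, k3⟩ | ⟨l, hl, k1, k2⟩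
  · rw [h3, k3] at h
    have := arc_extend_injective (by linarith) (by linarith) (by linarith) (by linarith) h
    exact .inl ⟨k, l, hk, hl, this⟩
  · rw [h3, k2] at h
    exact absurd h (arc_extend_ne_pos _ (by linarith) (by linarith) _)
  · rw [h2, k3] at h
    exact absurd h.symm (arc_extend_ne_pos _ (by linarith) (by linarith) _)
  · rw [h2, k2] at h
    exact .inr ⟨k, hk, l, hl, h1, k1, G.pos_injective h⟩

theorem continuousOn_walkCurve : ∀ {P : List E} {u v : V}, G.IsWalk u P v →
    ContinuousOn (G.walkCurve P) (Set.Icc 0 P.length)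
  | [], _, _, _ => by simp
  | e :: p, u, v, hP => by
    have hsub : Set.Icc (0 : ℝ) (e :: p).length ⊆ Set.Icc 0 1 ∪ Set.Icc 1 (e :: p).length := by
      intro t ht
      rcases le_total t 1 with h | h
      · exact .inl ⟨ht.1, h⟩
      · exact .inr ⟨h, ht.2⟩
    refine (ContinuousOn.union_of_isClosed ?_ ?_ isClosed_Icc isClosed_Icc).mono hsub
    · refine (G.arc e).continuous_extend.continuousOn.congr fun t ht => ?_
      simp [walkCurve, ht.2]
    · have h1 : ContinuousOn (fun t => G.walkCurve p (t - 1)) (Set.Icc 1 (e :: p).length) := by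
        refine (continuousOn_walkCurve hP.2).comp (by fun_prop) fun t ht => ?_
        simp only [List.length_cons, Nat.cast_add, Nat.cast_one] at ht
        exact ⟨by linarith [ht.1], by linarith [ht.2]⟩
      cases p with
      | nil =>
        have : Set.Icc (1 : ℝ) [e].length = {1} := by simp
        rw [this]; exact continuousOn_singleton _ _
      | cons e' q =>
        refine h1.congr fun t ht => ?_
        rcases ht.1.eq_or_lt with rfl | h
        · simp [walkCurve, show G.src e' = G.tgt e from hP.2.1]
        · simp [walkCurve, not_le.2 h]

/-- Walks are locally injective. -/
theorem walkCurve_ne_of_lt {P : List E} {u v : V} (hP : G.IsWalk u P v) (hne : P ≠ []) {s t : ℝ}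
    (h0 : 0 ≤ s) (hst : s < t) (ht : t ≤ s + 1 / 2) (htl : t ≤ P.length) :
    G.walkCurve P t ≠ G.walkCurve P s := by
  intro h
  have : ∃ k l : ℕ, t - s = l - k := by
    rcases walkCurve_collision hP hne hP hne ⟨by linarith, htl⟩ ⟨h0, by linarith⟩ h with
      ⟨k, l, hk, hl, h1, h2⟩ | ⟨k, hk, l, hl, h1, h2, h3⟩
    · exact ⟨l, k, by linarith⟩
    · exact ⟨l, k, by rw [h1, h2]⟩
  obtain ⟨k, l, hkl⟩ := this
  have h1 : (k : ℝ) < l := by linarith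
  have h2 : (l : ℝ) < k + 1 := by linarith
  have h3 : k < l := by exact_mod_cast h1
  have h4 : l < k + 1 := by exact_mod_cast h2
  omega

/-- A walk without repeated edges and vertices is injective, the end point being left out unless it
is not visited before. -/
theorem walkCurve_injective {P : List E} {u v : V} (hP : G.IsWalk u P v) (hne : P ≠ [])
    (hnd : P.Nodup) (hsrc : ∀ e ∈ P, ∀ e' ∈ P, G.src e = G.src e' → e = e') {s t : ℝ}
    (hs : s ∈ Set.Icc (0 : ℝ) P.length) (ht : t ∈ Set.Icc (0 : ℝ) P.length)
    (hv : (s < P.length ∧ t < P.length) ∨ ∀ e ∈ P, G.src e ≠ v)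
    (h : G.walkCurve P s = G.walkCurve P t) : s = t := by
  rcases walkCurve_collision hP hne hP hne hs ht h with
    ⟨k, l, hk, hl, h1, h2⟩ | ⟨k, hk, l, hl, h1, h2, h3⟩
  · have := (hnd.getElem_inj_iff).1 h1
    subst this; linarith
  · suffices k = l by rw [h1, h2, this]
    unfold walkVertex at h3
    split_ifs at h3 with hk' hl' hl'
    · exact hnd.getElem_inj_iff.1
        (hsrc _ (List.getElem_mem hk') _ (List.getElem_mem hl') h3)
    · rcases hv with hv | hv
      · have : l < P.length := by have := hv.2; rw [h2] at this; exact_mod_cast this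
        omega
      · exact absurd h3 (hv _ (List.getElem_mem _))
    · rcases hv with hv | hv
      · have : k < P.length := by have := hv.1; rw [h1] at this; exact_mod_cast this
        omega
      · exact absurd h3.symm (hv _ (List.getElem_mem _))
    · omega

theorem walkCurve_append_left : ∀ {P : List E} (R : List E) {t : ℝ}, P ≠ [] → t ≤ P.length →
    G.walkCurve (P ++ R) t = G.walkCurve P t
  | [], _, _, h, _ => absurd rfl h
  | e :: p, R, t, _, ht => by
    simp only [List.cons_append, walkCurve]
    split_ifs with h
    · rfl
    · simp only [List.length_cons, Nat.cast_add, Nat.cast_one] at ht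
      refine walkCurve_append_left R ?_ (by linarith)
      rintro rfl
      simp at ht; linarith

theorem walkCurve_append_right : ∀ (P R : List E) {t : ℝ}, 0 < t →
    G.walkCurve (P ++ R) (t + P.length) = G.walkCurve R t
  | [], R, t, ht => by simp
  | e :: p, R, t, ht => by
    simp only [List.cons_append, walkCurve, List.length_cons, Nat.cast_add, Nat.cast_one]
    rw [if_neg (by have : (0 : ℝ) ≤ p.length := by positivity
                   linarith), ← walkCurve_append_right p R ht]
    congr 1; ring

theorem isWalk_append : ∀ {P R : List E} {u v : V},
    G.IsWalk u (P ++ R) v ↔ ∃ w, G.IsWalk u P w ∧ G.IsWalk w R v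
  | [], R, u, v => by simp [IsWalk]
  | e :: p, R, u, v => by
    simp only [List.cons_append, IsWalk, isWalk_append (P := p)]
    constructor
    · rintro ⟨h1, w, h2, h3⟩; exact ⟨w, ⟨h1, h2⟩, h3⟩
    · rintro ⟨w, ⟨h1, h2⟩, h3⟩; exact ⟨h1, w, h2, h3⟩

end PlanarCircularDigraph

/-! ### Local turning signs -/

/-- The sign of the walk `e :: P` computed from signs `σ` of its turns and `η` of its last edge. -/
def transferSign {E : Type*} (σ : E → E → ℤ) (η : E → ℤ) : E → List E → ℤ
  | e, [] => η e
  | e, e' :: P => σ e e' * transferSign σ η e' P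

/-- The product of the signs `σ` of the turns of the walk `e :: P`. -/
def turnSign {E : Type*} (σ : E → E → ℤ) : E → List E → ℤ
  | _, [] => 1
  | e, e' :: P => σ e e' * turnSign σ e' P

/-- The secant of a curve over `[t, t + 1/2]`. -/
noncomputable def halfSecant (γ : ℝ → ℂ) (t : ℝ) : ℂ := γ (t + 1 / 2) - γ t

namespace PlanarCircularDigraph

variable {V E : Type*} {n : ℕ} {G : PlanarCircularDigraph V E n}

theorem continuousOn_halfSecant {γ : ℝ → ℂ} {L : ℝ} (hγ : ContinuousOn γ (Set.Icc 0 L)) :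
    ContinuousOn (halfSecant γ) (Set.Icc 0 (L - 1 / 2)) :=
  (hγ.comp (by fun_prop) fun t ht => ⟨by linarith [ht.1], by linarith [ht.2]⟩).sub
    (hγ.mono (Set.Icc_subset_Icc le_rfl (by linarith)))

theorem halfSecant_ne_zero {P : List E} {u v : V} (hP : G.IsWalk u P v) (hne : P ≠ []) {t : ℝ}
    (ht : t ∈ Set.Icc (0 : ℝ) (P.length - 1 / 2)) : halfSecant (G.walkCurve P) t ≠ 0 :=
  sub_ne_zero.2 (walkCurve_ne_of_lt hP hne ht.1 (by linarith) le_rfl (by linarith [ht.2]))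

theorem one_le_length {P : List E} (hne : P ≠ []) : (1 : ℝ) ≤ P.length := by
  exact_mod_cast List.length_pos_iff.2 hne

theorem exists_sqrt_halfSecant {P : List E} {u v : V} (hP : G.IsWalk u P v) (hne : P ≠ []) {z : ℂ}
    (hz : z ^ 2 = halfSecant (G.walkCurve P) 0) :
    ∃ g : ℝ → ℂ, ContinuousOn g (Set.Icc 0 (P.length - 1 / 2)) ∧
      (∀ t ∈ Set.Icc (0 : ℝ) (P.length - 1 / 2), g t ^ 2 = halfSecant (G.walkCurve P) t) ∧
      g 0 = z :=
  exists_continuousOn_Icc_sq_eq (by linarith [one_le_length hne])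
    (continuousOn_halfSecant (continuousOn_walkCurve hP))
    (fun _ ht => halfSecant_ne_zero hP hne ht) hz

theorem halfSecant_cons_zero (e : E) (P : List E) :
    halfSecant (G.walkCurve (e :: P)) 0 = (G.arc e).extend (1 / 2) - (G.arc e).extend 0 := by
  simp [halfSecant, walkCurve, show (2⁻¹ : ℝ) ≤ 1 by norm_num]

theorem halfSecant_cons_succ {e e' : E} {P : List E} (h : G.src e' = G.tgt e) {t : ℝ}
    (ht : 0 ≤ t) :
    halfSecant (G.walkCurve (e :: e' :: P)) (t + 1) = halfSecant (G.walkCurve (e' :: P)) t := by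
  unfold halfSecant
  congr 1
  · rw [walkCurve, if_neg (by linarith)]
    congr 1; ring
  · rcases ht.eq_or_lt with rfl | ht
    · simp [walkCurve, h]
    · rw [walkCurve, if_neg (by linarith)]
      congr 1; ring

theorem halfSecant_cons_cons (e e' : E) (P : List E) {t : ℝ} (ht : t ≤ 1) :
    halfSecant (G.walkCurve (e :: e' :: P)) t = halfSecant (G.walkCurve [e, e']) t := by
  have h : ∀ {t : ℝ}, t ≤ 2 →
      G.walkCurve (e :: e' :: P) t = G.walkCurve [e, e'] t := fun {t} ht =>
    walkCurve_append_left (P := [e, e']) P (by simp) (by simpa using ht)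
  unfold halfSecant
  rw [h (by linarith), h (by linarith)]

theorem sq_eq_one_of_or {c : ℤ} (h : c = 1 ∨ c = -1) : (c : ℂ) * c = 1 := by
  rcases h with rfl | rfl <;> simp

/-- Compatible choices of square roots `z e`, `y e` of the first and the last secant of every edge,
together with the signs `σ`, `η` by which they change under continuation along the turn from an
edge to the next one and along an edge, respectively. The vertex `b i` is at the angle `φ i`; at the
boundary the square roots are chosen in fixed half planes, so that the signs of walks with the same
end points are comparable. -/
structure TurningData (G : PlanarCircularDigraph V E n) (φ : Fin n → ℝ) where
  /-- a square root of the secant over the first half of an edge -/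
  z : E → ℂ
  /-- a square root of the secant over the second half of an edge -/
  y : E → ℂ
  /-- the sign of the turn from an edge to the next one -/
  σ : E → E → ℤ
  /-- the sign of the passage from the first to the second half of an edge -/
  η : E → ℤ
  z_sq : ∀ e, z e ^ 2 = (G.arc e).extend (1 / 2) - (G.arc e).extend 0
  z_pos : ∀ e i, G.src e = G.b i → 0 < (z e / inwardRoot (φ i)).re
  y_pos : ∀ e i, G.tgt e = G.b i → 0 < (y e / outwardRoot (φ i)).re
  σ_unit : ∀ e e', σ e e' = 1 ∨ σ e e' = -1
  η_unit : ∀ e, η e = 1 ∨ η e = -1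
  exists_turn : ∀ e e', G.src e' = G.tgt e → ∃ g : ℝ → ℂ, ContinuousOn g (Set.Icc 0 1) ∧
    (∀ t ∈ Set.Icc (0 : ℝ) 1, g t ^ 2 = halfSecant (G.walkCurve [e, e']) t) ∧ g 0 = z e ∧
    g 1 = σ e e' * z e'
  exists_edge : ∀ e, ∃ g : ℝ → ℂ, ContinuousOn g (Set.Icc 0 (1 / 2)) ∧
    (∀ t ∈ Set.Icc (0 : ℝ) (1 / 2), g t ^ 2 = halfSecant (G.walkCurve [e]) t) ∧ g 0 = z e ∧
    g (1 / 2) = η e * y e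

theorem exists_sqrt_re_pos {w ω : ℂ} (h : 0 < (w / ω ^ 2).re) :
    ∃ z : ℂ, z ^ 2 = w ∧ 0 < (z / ω).re := by
  obtain ⟨z, hz⟩ := IsAlgClosed.exists_pow_nat_eq w (n := 2) (by norm_num)
  have h1 : (z / ω).re ≠ 0 := re_ne_zero_of_re_sq_pos (by rwa [div_pow, hz])
  rcases h1.lt_or_gt with h1 | h1
  · refine ⟨-z, by rw [neg_sq, hz], ?_⟩
    rw [neg_div, Complex.neg_re]; linarith
  · exact ⟨z, hz, h1⟩

theorem norm_arc_extend_le (e : E) {t : ℝ} (h0 : 0 ≤ t) (h1 : t ≤ 1) :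
    ‖(G.arc e).extend t‖ ≤ 1 := by
  rcases h0.eq_or_lt with rfl | h0
  · simpa using G.norm_pos_le _
  rcases h1.eq_or_lt with rfl | h1
  · simpa using G.norm_pos_le _
  exact (norm_arc_extend_lt _ h0 h1).le

theorem exists_turningData (G : PlanarCircularDigraph V E n) {φ : Fin n → ℝ}
    (hφ : ∀ i, G.pos (G.b i) = Complex.exp (φ i * Complex.I)) : Nonempty (TurningData G φ) := by
  have hz : ∀ e, ∃ z : ℂ, z ^ 2 = (G.arc e).extend (1 / 2) - (G.arc e).extend 0 ∧
      ∀ i, G.src e = G.b i → 0 < (z / inwardRoot (φ i)).re := by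
    intro e
    by_cases h : ∃ i, G.src e = G.b i
    · obtain ⟨i, hi⟩ := h
      have hpos : (G.arc e).extend 0 = Complex.exp (φ i * Complex.I) := by
        rw [Path.extend_zero, hi, hφ]
      obtain ⟨z, hz, hz'⟩ := exists_sqrt_re_pos (re_sub_div_inwardRoot_sq_pos (β := φ i)
        (norm_arc_extend_le e (t := 1 / 2) (by norm_num) (by norm_num)) (by
          rw [← hφ]; exact arc_extend_ne_pos e (by norm_num) (by norm_num) _))
      refine ⟨z, by rw [hz, hpos], fun j hj => ?_⟩
      rwa [G.b_injective (hj.symm.trans hi)]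
    · obtain ⟨z, hz⟩ := IsAlgClosed.exists_pow_nat_eq
        ((G.arc e).extend (1 / 2) - (G.arc e).extend 0) (n := 2) (by norm_num)
      exact ⟨z, hz, fun i hi => absurd ⟨i, hi⟩ h⟩
  have hy : ∀ e, ∃ y : ℂ, y ^ 2 = (G.arc e).extend 1 - (G.arc e).extend (1 / 2) ∧
      ∀ i, G.tgt e = G.b i → 0 < (y / outwardRoot (φ i)).re := by
    intro e
    by_cases h : ∃ i, G.tgt e = G.b i
    · obtain ⟨i, hi⟩ := h
      have hpos : (G.arc e).extend 1 = Complex.exp (φ i * Complex.I) := by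
        rw [Path.extend_one, hi, hφ]
      obtain ⟨z, hz, hz'⟩ := exists_sqrt_re_pos (re_sub_div_outwardRoot_sq_pos (α := φ i)
        (norm_arc_extend_le e (t := 1 / 2) (by norm_num) (by norm_num)) (by
          rw [← hφ]; exact arc_extend_ne_pos e (by norm_num) (by norm_num) _))
      refine ⟨z, by rw [hz, hpos], fun j hj => ?_⟩
      rwa [G.b_injective (hj.symm.trans hi)]
    · obtain ⟨z, hz⟩ := IsAlgClosed.exists_pow_nat_eq
        ((G.arc e).extend 1 - (G.arc e).extend (1 / 2)) (n := 2) (by norm_num)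
      exact ⟨z, hz, fun i hi => absurd ⟨i, hi⟩ h⟩
  choose z hz hzpos using hz
  choose y hy hypos using hy
  have hσ : ∀ e e', ∃ c : ℤ, (c = 1 ∨ c = -1) ∧ (G.src e' = G.tgt e →
      ∃ g : ℝ → ℂ, ContinuousOn g (Set.Icc 0 1) ∧
        (∀ t ∈ Set.Icc (0 : ℝ) 1, g t ^ 2 = halfSecant (G.walkCurve [e, e']) t) ∧ g 0 = z e ∧
        g 1 = c * z e') := by
    intro e e'
    by_cases h : G.src e' = G.tgt e
    · have hw : G.IsWalk (G.src e) [e, e'] (G.tgt e') := ⟨rfl, h, rfl⟩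
      obtain ⟨g, hg, hgsq, hg0⟩ := exists_sqrt_halfSecant hw (by simp) (z := z e)
        (by rw [hz, halfSecant_cons_zero])
      have hsub : Set.Icc (0 : ℝ) 1 ⊆ Set.Icc 0 (([e, e'].length : ℝ) - 1 / 2) :=
        Set.Icc_subset_Icc le_rfl (by norm_num)
      have h1 : g 1 ^ 2 = z e' ^ 2 := by
        rw [hgsq 1 (hsub ⟨by norm_num, le_rfl⟩), hz, ← halfSecant_cons_zero e' []]
        simpa using halfSecant_cons_succ (P := []) h le_rfl
      rcases sq_eq_sq_iff_eq_or_eq_neg.1 h1 with h1 | h1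
      · exact ⟨1, .inl rfl, fun _ => ⟨g, hg.mono hsub, fun t ht => hgsq t (hsub ht), hg0,
          by simpa using h1⟩⟩
      · exact ⟨-1, .inr rfl, fun _ => ⟨g, hg.mono hsub, fun t ht => hgsq t (hsub ht), hg0,
          by simpa using h1⟩⟩
    · exact ⟨1, .inl rfl, fun h' => absurd h' h⟩
  have hη : ∀ e, ∃ c : ℤ, (c = 1 ∨ c = -1) ∧
      ∃ g : ℝ → ℂ, ContinuousOn g (Set.Icc 0 (1 / 2)) ∧
        (∀ t ∈ Set.Icc (0 : ℝ) (1 / 2), g t ^ 2 = halfSecant (G.walkCurve [e]) t) ∧ g 0 = z e ∧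
        g (1 / 2) = c * y e := by
    intro e
    have hw : G.IsWalk (G.src e) [e] (G.tgt e) := ⟨rfl, rfl⟩
    obtain ⟨g, hg, hgsq, hg0⟩ := exists_sqrt_halfSecant hw (by simp) (z := z e)
      (by rw [hz, halfSecant_cons_zero])
    have hsub : Set.Icc (0 : ℝ) (1 / 2) ⊆ Set.Icc 0 (([e].length : ℝ) - 1 / 2) :=
      Set.Icc_subset_Icc le_rfl (by norm_num)
    have h1 : g (1 / 2) ^ 2 = y e ^ 2 := by
      rw [hgsq _ (hsub ⟨by norm_num, le_rfl⟩), hy, halfSecant]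
      norm_num [walkCurve]
    rcases sq_eq_sq_iff_eq_or_eq_neg.1 h1 with h1 | h1
    · exact ⟨1, .inl rfl, g, hg.mono hsub, fun t ht => hgsq t (hsub ht), hg0, by simpa using h1⟩
    · exact ⟨-1, .inr rfl, g, hg.mono hsub, fun t ht => hgsq t (hsub ht), hg0, by simpa using h1⟩
  choose σ hσ1 hσ2 using hσ
  choose η hη1 hη2 using hη
  exact ⟨⟨z, y, σ, η, hz, hzpos, hypos, hσ1, hη1, hσ2, hη2⟩⟩

namespace TurningData

variable {φ : Fin n → ℝ} (d : TurningData G φ)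

/-- The turn from `e` to `e'` depends on these two edges only, not on how the walk continues. -/
theorem turn_eq {e e' : E} (h : G.src e' = G.tgt e) (P : List E) {g : ℝ → ℂ}
    (hg : ContinuousOn g (Set.Icc 0 1))
    (hgsq : ∀ t ∈ Set.Icc (0 : ℝ) 1, g t ^ 2 = halfSecant (G.walkCurve (e :: e' :: P)) t)
    (hg0 : g 0 = d.z e) : g 1 = d.σ e e' * d.z e' := by
  obtain ⟨g', hg', hgsq', hg0', hg1'⟩ := d.exists_turn e e' h
  have hw : G.IsWalk (G.src e) [e, e'] (G.tgt e') := ⟨rfl, h, rfl⟩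
  rw [← hg1']
  refine eqOn_of_sq_eq isPreconnected_Icc hg hg'
    (fun t ht => by rw [hgsq t ht, halfSecant_cons_cons _ _ _ ht.2]) hgsq'
    (fun t ht => halfSecant_ne_zero hw (by simp) ⟨ht.1, ?_⟩)
    (Set.left_mem_Icc.2 zero_le_one) (hg0.trans hg0'.symm) 1 ⟨zero_le_one, le_rfl⟩
  have := ht.2
  norm_num; linarith

/-- The continuation of the square root of the secants beyond the first edge of a walk. -/
theorem shift {e e' : E} (h : G.src e' = G.tgt e) (P : List E) {g : ℝ → ℂ} {L : ℝ} (hL : 0 ≤ L)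
    (hg : ContinuousOn g (Set.Icc 0 (L + 1)))
    (hgsq : ∀ t ∈ Set.Icc (0 : ℝ) (L + 1), g t ^ 2 = halfSecant (G.walkCurve (e :: e' :: P)) t)
    (hg0 : g 0 = d.z e) :
    ∃ g' : ℝ → ℂ, ContinuousOn g' (Set.Icc 0 L) ∧
      (∀ t ∈ Set.Icc (0 : ℝ) L, g' t ^ 2 = halfSecant (G.walkCurve (e' :: P)) t) ∧
      g' 0 = d.z e' ∧ g (L + 1) = d.σ e e' * g' L := by
  have hsub : Set.Icc (0 : ℝ) 1 ⊆ Set.Icc 0 (L + 1) := Set.Icc_subset_Icc le_rfl (by linarith)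
  have h1 := d.turn_eq h P (hg.mono hsub) (fun t ht => hgsq t (hsub ht)) hg0
  have hc := sq_eq_one_of_or (d.σ_unit e e')
  refine ⟨fun t => d.σ e e' * g (t + 1), continuousOn_const.mul (hg.comp (by fun_prop)
    fun t ht => ⟨by linarith [ht.1], by linarith [ht.2]⟩), fun t ht => ?_, ?_, ?_⟩
  · rw [mul_pow, sq, hc, one_mul, hgsq _ ⟨by linarith [ht.1], by linarith [ht.2]⟩,
      halfSecant_cons_succ h ht.1]
  · dsimp only
    rw [zero_add, h1, ← mul_assoc, hc, one_mul]
  · rw [← mul_assoc, hc, one_mul]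

/-- A continuous square root of the secants, followed to the last half of the last edge. -/
theorem sqrt_end : ∀ (P : List E) (e : E) {u v : V}, G.IsWalk u (e :: P) v → ∀ {g : ℝ → ℂ},
    ContinuousOn g (Set.Icc 0 ((e :: P).length - 1 / 2)) →
    (∀ t ∈ Set.Icc (0 : ℝ) ((e :: P).length - 1 / 2),
      g t ^ 2 = halfSecant (G.walkCurve (e :: P)) t) → g 0 = d.z e →
    g ((e :: P).length - 1 / 2) = transferSign d.σ d.η e P * d.y ((e :: P).getLast (by simp))
  | [], e, u, v, hP, g, hg, hgsq, hg0 => by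
    obtain ⟨g', hg', hgsq', hg0', hg1'⟩ := d.exists_edge e
    have h2 : (([e].length : ℝ) - 1 / 2) = 1 / 2 := by norm_num
    have hne : ∀ t ∈ Set.Icc (0 : ℝ) (1 / 2), halfSecant (G.walkCurve [e]) t ≠ 0 :=
      fun t ht => halfSecant_ne_zero hP (by simp) (by rwa [h2])
    rw [h2] at hg hgsq ⊢
    rw [List.getLast_singleton, transferSign, ← hg1']
    exact eqOn_of_sq_eq isPreconnected_Icc hg hg' hgsq hgsq' hne
      (Set.left_mem_Icc.2 (by norm_num)) (hg0.trans hg0'.symm) _ ⟨by norm_num, le_rfl⟩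
  | e' :: P, e, u, v, hP, g, hg, hgsq, hg0 => by
    have hlen : (((e :: e' :: P).length : ℝ) - 1 / 2) = ((e' :: P).length - 1 / 2) + 1 := by
      simp; ring
    rw [hlen] at hg hgsq ⊢
    obtain ⟨g', hg', hgsq', hg0', h⟩ := d.shift hP.2.1 P
      (by linarith [one_le_length (List.cons_ne_nil e' P)]) hg hgsq hg0
    rw [h, sqrt_end P e' hP.2 hg' hgsq' hg0', transferSign, List.getLast_cons_cons]
    push_cast; ring

/-- A continuous square root of the secants, followed to the first half of the last edge of
`e :: P`; the remaining walk `R` makes the secants across the end of an edge available. -/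
theorem sqrt_turns : ∀ (P R : List E) (e : E) {u v : V}, G.IsWalk u (e :: (P ++ R)) v →
    ∀ {g : ℝ → ℂ}, ContinuousOn g (Set.Icc 0 P.length) →
    (∀ t ∈ Set.Icc (0 : ℝ) P.length, g t ^ 2 = halfSecant (G.walkCurve (e :: (P ++ R))) t) →
    g 0 = d.z e → g P.length = turnSign d.σ e P * d.z ((e :: P).getLast (by simp))
  | [], R, e, u, v, hP, g, hg, hgsq, hg0 => by simp [turnSign, hg0]
  | e' :: P, R, e, u, v, hP, g, hg, hgsq, hg0 => by
    have hlen : ((e' :: P).length : ℝ) = P.length + 1 := by simp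
    rw [hlen] at hg hgsq ⊢
    obtain ⟨g', hg', hgsq', hg0', h⟩ := d.shift hP.2.1 (P ++ R) (Nat.cast_nonneg P.length) hg hgsq hg0
    rw [h, sqrt_turns P R e' hP.2 hg' hgsq' hg0', turnSign, List.getLast_cons_cons]
    push_cast; ring

end TurningData

theorem transferSign_unit {σ : E → E → ℤ} {η : E → ℤ} (hσ : ∀ e e', σ e e' = 1 ∨ σ e e' = -1)
    (hη : ∀ e, η e = 1 ∨ η e = -1) : ∀ (e : E) (P : List E),
    transferSign σ η e P = 1 ∨ transferSign σ η e P = -1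
  | e, [] => hη e
  | e, e' :: P => by
    rw [transferSign]
    rcases hσ e e' with h | h <;> rcases transferSign_unit hσ hη e' P with h' | h' <;>
      simp [h, h']

/-- The sign `1` if `j < i`, `-1` otherwise, of the chord of a walk from `b i` to `b j`. -/
def chordIndexSign (i j : Fin n) : ℤ := if j < i then 1 else -1

theorem chordSign_eq_chordIndexSign {φ : Fin n → ℝ} (hφ : StrictAnti φ) (i j : Fin n) :
    chordSign (φ j) (φ i) = chordIndexSign i j := by
  simp [chordSign, chordIndexSign, hφ.lt_iff_gt]

theorem chordIndexSign_sq (i j : Fin n) : chordIndexSign i j * chordIndexSign i j = 1 := by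
  unfold chordIndexSign; split_ifs <;> simp

theorem isWalk_getLast : ∀ {P : List E} {u v : V} (_ : G.IsWalk u P v) (hne : P ≠ []),
    G.tgt (P.getLast hne) = v
  | [], _, _, _, h => absurd rfl h
  | [e], _, _, h, _ => h.2
  | e :: e' :: P, u, v, h, _ => by
    rw [List.getLast_cons (by simp)]
    exact isWalk_getLast h.2 (by simp)

theorem source_of_isWalk {i : Fin n} {e : E} {P : List E} {v : V}
    (h : G.IsWalk (G.b i) (e :: P) v) : i ∈ G.I := by
  by_contra hi
  exact G.sink_no_out i hi e h.1

theorem sink_of_isWalk {j : Fin n} {P : List E} {u : V} (h : G.IsWalk u P (G.b j)) (hne : P ≠ []) :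
    j ∉ G.I := fun hj => G.source_no_in j hj _ (isWalk_getLast h hne)

/-- The winding signs of a planar circular network are products of signs of turns, up to the
orientation of the chord between the end points. Moreover, a walk between boundary vertices without
repeated edges or vertices has even winding index, and the turns of a simple cycle multiply
to `-1`. -/
theorem exists_turning_signs (G : PlanarCircularDigraph V E n) : ∃ (σ : E → E → ℤ) (η : E → ℤ),
    (∀ (i j : Fin n) (e : E) (P : List E), G.IsWalk (G.b i) (e :: P) (G.b j) →
      ((G.wind (e :: P)).negOnePow : ℤ) = chordIndexSign i j * transferSign σ η e P) ∧
    (∀ (i j : Fin n) (e : E) (P : List E), G.IsWalk (G.b i) (e :: P) (G.b j) → (e :: P).Nodup →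
      (∀ f ∈ e :: P, ∀ f' ∈ e :: P, G.src f = G.src f' → f = f') →
      transferSign σ η e P = chordIndexSign i j) ∧
    (∀ (v : V) (e : E) (P : List E), G.IsWalk v (e :: P) v → (e :: P).Nodup →
      (∀ f ∈ e :: P, ∀ f' ∈ e :: P, G.src f = G.src f' → f = f') →
      turnSign σ e (P ++ [e]) = -1) := by
  obtain ⟨φ, hφ, hφ2, hb⟩ := G.clockwise
  obtain ⟨d⟩ := exists_turningData G hb
  have habs : ∀ i j, |φ i - φ j| < 2 * Real.pi := fun i j =>
    abs_lt.2 ⟨by linarith [hφ2 j i], hφ2 i j⟩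
  have hsign : ∀ (c : ℤ) (e : E) (P : List E) (j : Fin n), c * c = 1 →
      G.tgt ((e :: P).getLast (by simp)) = G.b j →
      0 < ((c : ℂ) * (transferSign d.σ d.η e P * d.y ((e :: P).getLast (by simp))) /
        outwardRoot (φ j)).re → c = transferSign d.σ d.η e P := by
    intro c e P j hc ht hpos
    have h1 := d.y_pos _ j ht
    have h2 : (c : ℂ) * (transferSign d.σ d.η e P * d.y ((e :: P).getLast (by simp))) /
        outwardRoot (φ j) = ((c * transferSign d.σ d.η e P : ℤ) : ℝ) *
          (d.y ((e :: P).getLast (by simp)) / outwardRoot (φ j)) := by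
      push_cast; ring
    rw [h2, Complex.re_ofReal_mul] at hpos
    have h3 := pos_of_mul_pos_left hpos h1.le
    have h4 : 0 < c * transferSign d.σ d.η e P := by exact_mod_cast h3
    rcases transferSign_unit d.σ_unit d.η_unit e P with h | h <;> rw [h] at h4 ⊢ <;> nlinarith
  refine ⟨d.σ, d.η, ?_, ?_, ?_⟩
  · intro i j e P hP
    have hi := source_of_isWalk hP
    have hj := sink_of_isWalk hP (by simp)
    have hne : i ≠ j := by rintro rfl; exact hj hi
    have hφne : φ j ≠ φ i := fun h => hne (hφ.injective h).symm
    have hL := one_le_length (List.cons_ne_nil e P)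
    have hcont := continuousOn_walkCurve hP
    have hnorm : ∀ t ∈ Set.Icc (0 : ℝ) (e :: P).length, ‖G.walkCurve (e :: P) t‖ ≤ 1 :=
      fun t ht => norm_walkCurve_le hP (by simp) ht
    have hinj : ∀ s t, 0 ≤ s → s < t → t ≤ s + 1 / 2 → t ≤ ((e :: P).length : ℝ) →
        G.walkCurve (e :: P) t ≠ G.walkCurve (e :: P) s :=
      fun s t h0 h1 h2 h3 => walkCurve_ne_of_lt hP (by simp) h0 h1 h2 h3
    have h0 := (walkCurve_zero hP (by simp)).trans (hb i)
    have hl := (walkCurve_length hP (by simp)).trans (hb j)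
    have hex : (e :: P) ≠ [] ∧ ∃ w, IsWindingIndex (G.walkCurve (e :: P)) (e :: P).length w :=
      ⟨by simp, exists_isWindingIndex hL hcont hnorm hinj h0 hl (by
        rw [walkCurve_zero hP (by simp), walkCurve_length hP (by simp)]
        exact fun h => hne (G.b_injective (G.pos_injective h)).symm)⟩
    have hw : IsWindingIndex (G.walkCurve (e :: P)) (e :: P).length (G.wind (e :: P)) := by
      rw [wind, dif_pos hex]; exact hex.2.choose_spec
    obtain ⟨g, hg, hgsq, hg0⟩ := exists_sqrt_halfSecant hP (by simp) (z := d.z e)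
      (by rw [d.z_sq, halfSecant_cons_zero])
    have hpos := re_sqrt_end_of_isWindingIndex hL hcont hnorm hinj h0 hl hφne (habs j i) hg hgsq
      (by rw [hg0]; exact d.z_pos e i hP.1) hw
    rw [d.sqrt_end P e hP hg hgsq hg0, chordSign_eq_chordIndexSign hφ] at hpos
    have hnn := val_negOnePow_mul_self (G.wind (e :: P))
    have hcc := chordIndexSign_sq i j
    have := hsign _ e P j (by linear_combination (chordIndexSign i j * chordIndexSign i j) * hnn +
      hcc) (isWalk_getLast hP (by simp)) hpos
    rw [← this]
    linear_combination -((G.wind (e :: P)).negOnePow : ℤ) * hcc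
  · intro i j e P hP hnd hsrc
    have hi := source_of_isWalk hP
    have hj := sink_of_isWalk hP (by simp)
    have hne : i ≠ j := by rintro rfl; exact hj hi
    have hφne : φ j ≠ φ i := fun h => hne (hφ.injective h).symm
    have hL := one_le_length (List.cons_ne_nil e P)
    obtain ⟨g, hg, hgsq, hg0⟩ := exists_sqrt_halfSecant hP (by simp) (z := d.z e)
      (by rw [d.z_sq, halfSecant_cons_zero])
    have hpos := re_sqrt_end_of_simple hL (continuousOn_walkCurve hP)
      (fun t ht => norm_walkCurve_le hP (by simp) ht)
      (fun s t h0 h1 h2 h => h1.ne' (walkCurve_injective hP (by simp) hnd hsrc ⟨by linarith, h2⟩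
        ⟨h0, by linarith⟩ (.inr fun f _ => G.sink_no_out j hj f) h))
      ((walkCurve_zero hP (by simp)).trans (hb i)) ((walkCurve_length hP (by simp)).trans (hb j))
      hφne (habs j i) hg hgsq (by rw [hg0]; exact d.z_pos e i hP.1)
    rw [d.sqrt_end P e hP hg hgsq hg0, chordSign_eq_chordIndexSign hφ] at hpos
    exact (hsign _ e P j (chordIndexSign_sq i j) (isWalk_getLast hP (by simp)) hpos).symm
  · -- the closed curve is traversed twice
    intro v e P hP hnd hsrc
    set m : ℝ := ((e :: P).length : ℝ) with hm
    have hL : 1 ≤ m := one_le_length (List.cons_ne_nil e P)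
    have hQ : G.IsWalk v ((e :: P) ++ (e :: P)) v := isWalk_append.2 ⟨v, hP, hP⟩
    have hQlen : (((e :: P) ++ (e :: P)).length : ℝ) = 2 * m := by
      rw [List.length_append, Nat.cast_add]; ring
    have hleft : ∀ t ≤ m, G.walkCurve ((e :: P) ++ (e :: P)) t = G.walkCurve (e :: P) t :=
      fun t ht => walkCurve_append_left _ (by simp) ht
    have hright : ∀ t, 0 ≤ t → G.walkCurve ((e :: P) ++ (e :: P)) (t + m) =
        G.walkCurve (e :: P) t := by
      intro t ht
      rcases ht.eq_or_lt with rfl | ht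
      · rw [zero_add, hleft m le_rfl, walkCurve_length hP (by simp), walkCurve_zero hP (by simp)]
      · exact walkCurve_append_right _ _ ht
    have hper : G.walkCurve (e :: P) m = G.walkCurve (e :: P) 0 := by
      rw [walkCurve_length hP (by simp), walkCurve_zero hP (by simp)]
    have hinj : ∀ s t, 0 ≤ s → s < m → 0 ≤ t → t < m →
        G.walkCurve (e :: P) s = G.walkCurve (e :: P) t → s = t := fun s t h0 h1 h2 h3 h =>
      walkCurve_injective hP (by simp) hnd hsrc ⟨h0, h1.le⟩ ⟨h2, h3.le⟩ (.inl ⟨h1, h3⟩) h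
    have hcont := continuousOn_walkCurve hQ
    rw [hQlen] at hcont
    have hz : d.z e ^ 2 = halfSecant (G.walkCurve ((e :: P) ++ (e :: P))) 0 := by
      rw [d.z_sq, List.cons_append, halfSecant_cons_zero]
    obtain ⟨g, hg, hgsq, hg0⟩ := exists_sqrt_halfSecant hQ (by simp) hz
    have hsub : Set.Icc (0 : ℝ) m ⊆ Set.Icc 0 (((e :: P) ++ (e :: P)).length - 1 / 2) :=
      Set.Icc_subset_Icc le_rfl (by rw [hQlen]; linarith)
    have hgm := sqrt_end_of_closed hL hcont
      (fun t ht => by rw [hright t ht.1, hleft t ht.2]) (fun s t h0 hst hts ht h => by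
        -- reduce both parameters modulo the period `m`
        rcases lt_or_ge s m with hs | hs
        · rw [hleft s hs.le] at h
          rcases lt_or_ge t m with ht' | ht'
          · rw [hleft t ht'.le] at h
            exact hst.ne' (hinj t s (by linarith) ht' h0 hs h)
          · have := hright (t - m) (by linarith)
            rw [sub_add_cancel] at this
            rw [this] at h
            have := hinj (t - m) s (by linarith) (by linarith) h0 hs h
            linarith
        · have h1 := hright (t - m) (by linarith)
          have h2 := hright (s - m) (by linarith)
          rw [sub_add_cancel] at h1 h2
          rw [h1, h2] at h
          rcases ht.eq_or_lt with rfl | ht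
          · rw [show 2 * m - m = m by ring, hper] at h
            have := hinj 0 (s - m) le_rfl (by linarith) (by linarith) (by linarith) h
            linarith
          · have := hinj (t - m) (s - m) (by linarith) (by linarith) (by linarith) (by linarith) h
            linarith) (hg.mono hsub) (fun t ht => hgsq t (hsub ht))
    have hPl : ((P ++ [e]).length : ℝ) = m := by rw [hm]; simp
    have hQ' : (e :: P) ++ (e :: P) = e :: ((P ++ [e]) ++ P) := by simp
    have hturn := d.sqrt_turns (P ++ [e]) P e (u := v) (v := v) (by rw [← hQ']; exact hQ)
      (g := g) (by rw [hPl]; exact hg.mono hsub)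
      (fun t ht => by rw [← hQ']; rw [hPl] at ht; exact hgsq t (hsub ht)) hg0
    have hlast : (e :: (P ++ [e])).getLast (by simp) = e := by
      rw [List.getLast_cons (by simp), List.getLast_append_singleton]
    rw [hPl, hgm, hg0, hlast] at hturn
    have hz0 : d.z e ≠ 0 := by
      intro h
      rw [h] at hz
      exact halfSecant_ne_zero hQ (by simp) ⟨le_rfl, by rw [hQlen]; linarith⟩ (by
        rw [← hz]; simp)
    have : ((turnSign d.σ e (P ++ [e]) : ℤ) : ℂ) = ((-1 : ℤ) : ℂ) := by
      apply mul_right_cancel₀ hz0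
      rw [← hturn]; push_cast; ring
    exact_mod_cast this

/-- The end points of two disjoint walks between boundary vertices do not separate each other. -/
theorem chordIndexSign_eq_of_disjoint {i j i' j' : Fin n} {P Q : List E}
    (hP : G.IsWalk (G.b i) P (G.b j)) (hPne : P ≠ []) (hQ : G.IsWalk (G.b i') Q (G.b j'))
    (hQne : Q ≠ []) (hdisj : ∀ e ∈ P, ∀ e' ∈ Q, G.src e ≠ G.src e') (hjj : j ≠ j') :
    chordIndexSign i' i * chordIndexSign j' i = chordIndexSign i' j * chordIndexSign j' j := by
  obtain ⟨φ, hφ, hφ2, hb⟩ := G.clockwise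
  have habs : ∀ i j, |φ i - φ j| < 2 * Real.pi := fun i j =>
    abs_lt.2 ⟨by linarith [hφ2 j i], hφ2 i j⟩
  have hj := sink_of_isWalk hP hPne
  have hj' := sink_of_isWalk hQ hQne
  have := chordSign_eq_of_disjoint (by positivity) (by positivity) (continuousOn_walkCurve hP)
    (continuousOn_walkCurve hQ) (fun t ht => norm_walkCurve_le hP hPne ht)
    (fun t ht => norm_walkCurve_le hQ hQne ht) (fun s hs t ht h => by
      rcases walkCurve_collision hP hPne hQ hQne hs ht h with
        ⟨k, l, hk, hl, h1, -⟩ | ⟨k, hk, l, hl, -, -, h3⟩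
      · exact hdisj _ (List.getElem_mem hk) _ (List.getElem_mem hl) (by rw [h1])
      · unfold walkVertex at h3
        split_ifs at h3 with hk' hl' hl'
        · exact hdisj _ (List.getElem_mem hk') _ (List.getElem_mem hl') h3
        · exact G.sink_no_out _ hj' _ h3
        · exact G.sink_no_out _ hj _ h3.symm
        · exact hjj (G.b_injective h3))
    ((walkCurve_zero hP hPne).trans (hb i)) ((walkCurve_length hP hPne).trans (hb j))
    ((walkCurve_zero hQ hQne).trans (hb i')) ((walkCurve_length hQ hQne).trans (hb j'))
    (habs _ _) (habs _ _) (habs _ _) (habs _ _)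
  simpa only [chordSign_eq_chordIndexSign hφ] using this

end PlanarCircularDigraph

/-! ### Generating series of lists and the transfer matrix -/

section ListSeries

variable {E : Type*}

open Classical in
/-- The formal power series `∑ c P * wt P` over all lists `P`. -/
noncomputable def listSeries (c : List E → ℤ) : MvPowerSeries E ℤ := fun m =>
  ∑ P ∈ (Finsupp.toMultiset m).lists.toFinset, c P

open Classical in
theorem coeff_listSeries (c : List E → ℤ) (m : E →₀ ℕ) :
    MvPowerSeries.coeff m (listSeries c) =
      ∑ P ∈ (Finsupp.toMultiset m).lists.toFinset, c P := rfl

open Classical in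
theorem mem_lists_toFinset {m : E →₀ ℕ} {P : List E} :
    P ∈ (Finsupp.toMultiset m).lists.toFinset ↔ Multiset.toFinsupp (P : Multiset E) = m := by
  simp only [Multiset.mem_toFinset, Multiset.mem_lists_iff, Multiset.quot_mk_to_coe]
  rw [Finsupp.toMultiset_eq_iff, eq_comm]

theorem listSeries_const_mul (a : ℤ) (c : List E → ℤ) :
    listSeries (fun P => a * c P) = MvPowerSeries.C a * listSeries c := by
  ext m
  rw [MvPowerSeries.coeff_C_mul, coeff_listSeries, coeff_listSeries, Finset.mul_sum]

theorem listSeries_zero : listSeries (fun _ : List E => 0) = 0 := by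
  ext m
  rw [coeff_listSeries]; simp

open Classical in
/-- Splitting off the first letter of a list. -/
theorem listSeries_eq [Fintype E] (c : List E → ℤ) :
    listSeries c = MvPowerSeries.C (c []) +
      ∑ e, MvPowerSeries.X e * listSeries (fun P => c (e :: P)) := by
  have hcons : ∀ (e : E) (P : List E), Multiset.toFinsupp ((e :: P : List E) : Multiset E) =
      Finsupp.single e 1 + Multiset.toFinsupp (P : Multiset E) := fun e P => by
    rw [← Multiset.cons_coe, ← Multiset.singleton_add, map_add, Multiset.toFinsupp_singleton]
  ext m
  rw [map_add, map_sum, MvPowerSeries.coeff_C]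
  simp only [MvPowerSeries.X, MvPowerSeries.coeff_monomial_mul, one_mul, coeff_listSeries]
  rw [← Finset.sum_filter, Finset.sum_sigma']
  rcases eq_or_ne m 0 with rfl | hm
  · rw [if_pos rfl, Finset.sum_eq_zero (s := Finset.sigma _ _), add_zero]
    · rw [Finset.sum_eq_single []]
      · intro P hP hne
        rw [mem_lists_toFinset] at hP
        exact absurd ((Multiset.coe_eq_zero P).1 (by simpa using hP)) hne
      · intro h
        exact absurd (mem_lists_toFinset.2 (by simp)) h
    · rintro ⟨e, P⟩ h
      simp at h
  · rw [if_neg hm, zero_add]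
    symm
    refine Finset.sum_nbij (fun x => x.1 :: x.2) ?_ ?_ ?_ ?_
    · rintro ⟨e, P⟩ h
      simp only [Finset.mem_sigma, Finset.mem_filter, Finset.mem_univ, true_and,
        mem_lists_toFinset] at h ⊢
      rw [hcons, h.2, add_tsub_cancel_of_le h.1]
    · rintro ⟨e, P⟩ - ⟨e', P'⟩ - h
      simp only [List.cons.injEq] at h
      obtain ⟨rfl, rfl⟩ := h
      rfl
    · intro P hP
      rw [Finset.mem_coe, mem_lists_toFinset] at hP
      cases P with
      | nil => exact absurd (by simpa using hP.symm) hm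
      | cons e P =>
        refine ⟨⟨e, P⟩, ?_, rfl⟩
        rw [hcons] at hP
        simp only [Finset.coe_sigma, Set.mem_sigma_iff, Finset.mem_coe, Finset.mem_filter,
          Finset.mem_univ, true_and, mem_lists_toFinset, ← hP]
        exact ⟨le_self_add, (add_tsub_cancel_left _ _).symm⟩
    · rintro ⟨e, P⟩ -
      rfl

end ListSeries

namespace PlanarCircularDigraph

variable {V E : Type*} {n : ℕ} {G : PlanarCircularDigraph V E n}

section Transfer

open Classical in
/-- The generating series of the signed walks from the end of the edge `e` to `b j`. -/
noncomputable def walkSeries (G : PlanarCircularDigraph V E n) (σ : E → E → ℤ) (η : E → ℤ) (e : E)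
    (j : Fin n) : MvPowerSeries E ℤ :=
  listSeries fun P => if G.IsWalk (G.tgt e) P (G.b j) then transferSign σ η e P else 0

open Classical in
/-- The transfer matrix: the entry at `(e, e')` is the signed weight of continuing along `e'` after
the edge `e`. -/
noncomputable def transferMatrix (G : PlanarCircularDigraph V E n) (σ : E → E → ℤ) :
    Matrix E E (MvPowerSeries E ℤ) :=
  fun e e' => MvPowerSeries.C (if G.src e' = G.tgt e then σ e e' else 0) * MvPowerSeries.X e'

open Classical in
/-- The recursion `(1 - T) N = C` for the signed walks. -/
theorem walkSeries_eq [Fintype E] (σ : E → E → ℤ) (η : E → ℤ) (e : E) (j : Fin n) :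
    G.walkSeries σ η e j = MvPowerSeries.C (if G.tgt e = G.b j then η e else 0) +
      ∑ e', G.transferMatrix σ e e' * G.walkSeries σ η e' j := by
  rw [walkSeries, listSeries_eq]
  congr 1
  refine Finset.sum_congr rfl fun e' _ => ?_
  rw [transferMatrix, mul_comm (MvPowerSeries.C _), mul_assoc, walkSeries, ← listSeries_const_mul]
  congr 2
  funext P
  simp only [IsWalk, transferSign]
  by_cases h : G.src e' = G.tgt e <;> simp [h]

open Classical in
theorem boundaryMeasurement_eq_listSeries (i j : Fin n) :
    G.boundaryMeasurement i j = listSeries fun P =>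
      if G.IsWalk (G.b i) P (G.b j) then ((G.wind P).negOnePow : ℤ) else 0 := by
  ext m
  rw [coeff_listSeries, ← Finset.sum_filter]
  refine Finset.sum_congr rfl fun P hP => ?_
  rw [coeff_walkWeight, if_pos (Finset.mem_filter.1 hP).1, mul_one]

/-- Only trivial walks end at a boundary source. -/
theorem boundaryMeasurement_of_mem [Fintype E] {i j : Fin n} (hj : j ∈ G.I) :
    G.boundaryMeasurement i j = MvPowerSeries.C (if i = j then 1 else 0) := by
  have h0 : ∀ (e : E) (P : List E), ¬ G.IsWalk (G.b i) (e :: P) (G.b j) :=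
    fun e P h => sink_of_isWalk h (by simp) hj
  rw [boundaryMeasurement_eq_listSeries, listSeries_eq]
  simp only [h0, if_false, listSeries_zero, mul_zero, Finset.sum_const_zero, add_zero]
  congr 1
  simp [IsWalk, wind, G.b_injective.eq_iff]

open Classical in
/-- The boundary measurement in terms of the walks following the first edge. -/
theorem boundaryMeasurement_eq_sum [Fintype E] {σ : E → E → ℤ} {η : E → ℤ} {i j : Fin n}
    (hj : j ∉ G.I) (hi : i ∈ G.I)
    (hw : ∀ (e : E) (P : List E), G.IsWalk (G.b i) (e :: P) (G.b j) →
      ((G.wind (e :: P)).negOnePow : ℤ) = chordIndexSign i j * transferSign σ η e P) :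
    G.boundaryMeasurement i j = ∑ e, MvPowerSeries.C
      (if G.src e = G.b i then chordIndexSign i j else 0) * MvPowerSeries.X e *
        G.walkSeries σ η e j := by
  rw [boundaryMeasurement_eq_listSeries, listSeries_eq, if_neg, map_zero, zero_add]
  · refine Finset.sum_congr rfl fun e _ => ?_
    rw [mul_comm (MvPowerSeries.C _), mul_assoc, walkSeries, ← listSeries_const_mul]
    congr 2
    funext P
    by_cases h : G.IsWalk (G.b i) (e :: P) (G.b j)
    · rw [if_pos h, hw e P h, if_pos h.1, if_pos h.2]
    · rw [if_neg h]
      simp only [IsWalk, not_and] at h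
      by_cases h1 : G.src e = G.b i
      · simp [h h1]
      · simp [h1]
  · intro h
    exact hj (G.b_injective (show G.b i = G.b j from h) ▸ hi)

end Transfer

end PlanarCircularDigraph

/-! ### Determinants with one variable per column -/

/-- The signed number of ways, weighted by `q`, to permute `Fin k ⊕ F` within `Fin k ⊕ E`, the
elements of `E` outside `F` being fixed. -/
noncomputable def permSum {k : ℕ} {E : Type*} [Fintype E] [DecidableEq E]
    (q : Fin k ⊕ E → Fin k ⊕ E → ℤ) (F : Finset E) : ℤ :=
  ∑ τ : Equiv.Perm (Fin k ⊕ E), (Equiv.Perm.sign τ : ℤ) *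
    ((∏ c : Fin k, q (τ (.inl c)) (.inl c)) * ((∏ e ∈ F, q (τ (.inr e)) (.inr e)) *
      ∏ e ∈ Fᶜ, if τ (.inr e) = .inr e then 1 else 0))

/-- The matrix over the formal power series with the integer entries `q`, the column of `e : E`
being scaled by the variable of `e` and then added to the column of the identity matrix. -/
noncomputable def columnMatrix {k : ℕ} {E : Type*} [DecidableEq E]
    (q : Fin k ⊕ E → Fin k ⊕ E → ℤ) :
    Matrix (Fin k ⊕ E) (Fin k ⊕ E) (MvPowerSeries E ℤ) := fun y x =>
  match x with
  | .inl c => MvPowerSeries.C (q y (.inl c))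
  | .inr e => MvPowerSeries.C (q y (.inr e)) * MvPowerSeries.X e + if y = .inr e then 1 else 0

/-- The determinant is expanded by choosing, in each column `e`, the multiple of `X e` if `e ∈ F` and
the unit vector otherwise. -/
theorem det_columnMatrix {k : ℕ} {E : Type*} [Fintype E] [DecidableEq E]
    (q : Fin k ⊕ E → Fin k ⊕ E → ℤ) :
    (columnMatrix q).det =
      ∑ F : Finset E, MvPowerSeries.C (permSum q F) * ∏ e ∈ F, MvPowerSeries.X e := by
  rw [Matrix.det_apply']
  simp only [Fintype.prod_sum_type, columnMatrix, Finset.prod_add, Finset.mul_sum,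
    Finset.powerset_univ]
  rw [Finset.sum_comm]
  refine Finset.sum_congr rfl fun F _ => ?_
  rw [permSum, map_sum, Finset.sum_mul]
  refine Finset.sum_congr rfl fun τ _ => ?_
  rw [Finset.prod_mul_distrib, ← Finset.compl_eq_univ_sdiff]
  simp only [map_mul, map_prod, apply_ite (MvPowerSeries.C (σ := E) (R := ℤ)), map_one, map_zero]
  rw [show MvPowerSeries.C ((Equiv.Perm.sign τ : ℤ)) =
    ((Equiv.Perm.sign τ : ℤ) : MvPowerSeries E ℤ) from by simp]
  ring

/-! ### Signs of permutations -/

/-- The cycle of `y` is listed by iterating up to the first return. -/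
theorem toList_eq_iterate {α : Type*} [Fintype α] [DecidableEq α] {u : Equiv.Perm α} {y : α}
    {m : ℕ} (hy : u y ≠ y) (hper : u^[m + 1] y = y) (hmin : ∀ i, 0 < i → i ≤ m → u^[i] y ≠ y) :
    u.toList y = List.iterate u y (m + 1) := by
  have hc := Equiv.Perm.isCycle_cycleOf u hy
  have hcy : u.cycleOf y y ≠ y := by rwa [Equiv.Perm.cycleOf_apply_self]
  have hpow : ∀ i, (u.cycleOf y) ^ i = 1 ↔ u^[i] y = y := fun i => by
    rw [hc.pow_eq_one_iff' hcy, Equiv.Perm.cycleOf_pow_apply_self, Equiv.Perm.iterate_eq_pow]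
  have hord : orderOf (u.cycleOf y) = m + 1 := by
    rw [orderOf_eq_iff (by omega)]
    exact ⟨(hpow _).2 hper, fun i hi h0 h => hmin i h0 (by omega) ((hpow i).1 h)⟩
  rw [Equiv.Perm.toList, ← hc.orderOf, hord]

/-- The sign of a permutation twisted by weights is `1` if this holds for each of its cycles; a cycle
of length `m + 1` has the sign `(-1) ^ m`. -/
theorem sign_mul_prod_eq_one {α : Type*} [Fintype α] [DecidableEq α] (u : Equiv.Perm α) (w : α → ℤ)
    (h : ∀ x, ∃ y m, u.SameCycle x y ∧ u^[m + 1] y = y ∧ (∀ i, 0 < i → i ≤ m → u^[i] y ≠ y) ∧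
      (-1) ^ m * ((List.iterate u y (m + 1)).map w).prod = 1) :
    (Equiv.Perm.sign u : ℤ) * ∏ x, w x = 1 := by
  have hfix : ∀ x, u x = x → w x = 1 := by
    intro x hx
    obtain ⟨y, m, hxy, -, hmin, hw⟩ := h x
    have hyx : y = x := (hxy.eq_of_left hx).symm
    subst hyx
    have hm : m = 0 := by
      by_contra hm
      exact hmin 1 one_pos (by omega) (by simpa using hx)
    subst hm
    simpa [List.iterate] using hw
  have hsupp : ∏ x, w x = ∏ x ∈ u.support, w x := by
    refine (Finset.prod_subset (Finset.subset_univ _) fun x _ hx => hfix x ?_).symm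
    simpa using hx
  have hfib : ∏ x ∈ u.support, w x = ∏ c ∈ u.cycleFactorsFinset, ∏ x ∈ c.support, w x := by
    rw [← Finset.prod_fiberwise_of_maps_to (t := u.cycleFactorsFinset) (g := u.cycleOf)
      (fun x hx => Equiv.Perm.cycleOf_mem_cycleFactorsFinset_iff.2 hx)]
    refine Finset.prod_congr rfl fun c hc => Finset.prod_congr ?_ fun _ _ => rfl
    ext x
    simp only [Finset.mem_filter]
    constructor
    · rintro ⟨hx, rfl⟩
      exact Equiv.Perm.mem_support_cycleOf_iff.2 ⟨Equiv.Perm.SameCycle.refl _ _, hx⟩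
    · intro hx
      exact ⟨Equiv.Perm.mem_cycleFactorsFinset_support_le hc hx,
        (Equiv.Perm.cycle_is_cycleOf hx hc).symm⟩
  have hsign : (Equiv.Perm.sign u : ℤ) = ∏ c ∈ u.cycleFactorsFinset, -(-1 : ℤ) ^ c.support.card := by
    rw [Equiv.Perm.sign_of_cycleType', Equiv.Perm.cycleType_def, Multiset.map_map]
    change (((∏ c ∈ u.cycleFactorsFinset, -(-1 : ℤˣ) ^ c.support.card : ℤˣ)) : ℤ) = _
    push_cast
    rfl
  rw [hsupp, hfib, hsign, ← Finset.prod_mul_distrib]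
  refine Finset.prod_eq_one fun c hc => ?_
  obtain ⟨x, hx⟩ := (Equiv.Perm.mem_cycleFactorsFinset_iff.1 hc).1.nonempty_support
  obtain ⟨y, m, hxy, hper, hmin, hw⟩ := h x
  have hcx := Equiv.Perm.cycle_is_cycleOf hx hc
  have hcy : c = u.cycleOf y := by rw [hcx, hxy.cycleOf_eq]
  have hys : y ∈ u.support := by
    have hxs := Equiv.Perm.mem_cycleFactorsFinset_support_le hc hx
    rw [Equiv.Perm.mem_support] at hxs ⊢
    intro hy
    exact hxs (by rw [hxy.eq_of_right hy]; exact hy)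
  have hl := toList_eq_iterate (Equiv.Perm.mem_support.1 hys) hper hmin
  have hcard : c.support.card = m + 1 := by
    rw [hcy, ← Equiv.Perm.length_toList, hl, List.length_iterate]
  have hprod : ∏ x ∈ c.support, w x = ((List.iterate u y (m + 1)).map w).prod := by
    rw [← hl, ← List.prod_toFinset w (Equiv.Perm.nodup_toList u y)]
    refine Finset.prod_congr ?_ fun _ _ => rfl
    ext z
    rw [List.mem_toFinset, Equiv.Perm.mem_toList_iff, hcy, Equiv.Perm.mem_support_cycleOf_iff]
  rw [hcard, hprod, pow_succ]
  linear_combination hw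

theorem prod_prod_eq_prod_Iio {k : ℕ} (f : Fin k → Fin k → ℤ) (h : ∀ i, f i i = 1) :
    ∏ j, ∏ i, f i j = ∏ j, ∏ i ∈ Finset.Iio j, (f i j * f j i) := by
  have h1 : ∀ j, ∏ i, f i j = (∏ i ∈ Finset.Iio j, f i j) * ∏ i ∈ Finset.Ioi j, f i j := by
    intro j
    rw [← Finset.prod_union (by
      rw [Finset.disjoint_left]; intro a ha hb
      rw [Finset.mem_Iio] at ha; rw [Finset.mem_Ioi] at hb; exact absurd ha hb.not_gt)]
    symm
    refine Finset.prod_subset (Finset.subset_univ _) fun i _ hi => ?_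
    have : i = j := by
      simp only [Finset.mem_union, Finset.mem_Iio, Finset.mem_Ioi, not_or, not_lt] at hi
      exact le_antisymm hi.2 hi.1
    rw [this, h]
  simp only [h1, Finset.prod_mul_distrib]
  congr 1
  refine Finset.prod_comm' fun i j => ?_
  simp

/-- The number of indices `r t` strictly between `i` and `j`. -/
def betweenCount {k n : ℕ} (r : Fin k → Fin n) (i j : Fin n) : ℕ :=
  (Finset.univ.filter fun t => min i j < r t ∧ r t < max i j).card

theorem betweenCount_self {k n : ℕ} (r : Fin k → Fin n) (i : Fin n) : betweenCount r i i = 0 := by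
  rw [betweenCount, Finset.card_eq_zero, Finset.filter_eq_empty_iff]
  intro t _ ht
  rw [min_self, max_self] at ht
  exact lt_asymm ht.1 ht.2

/-- Pairwise noncrossing chords from the points `r t` to the points `c (π t)` of a circle: the
inversions of `π` and the points jumped over by the chords have the same parity. -/
theorem sign_mul_prod_betweenCount {k n : ℕ} {r c : Fin k → Fin n} (hr : StrictMono r)
    (hc : StrictMono c) (π : Equiv.Perm (Fin k))
    (hdis : ∀ t, r t = c (π t) ∨ ∀ t', r t' ≠ c (π t))
    (hcross : ∀ t t', t ≠ t' → r t ≠ c (π t) → r t' ≠ c (π t') →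
      PlanarCircularDigraph.chordIndexSign (r t') (r t) *
        PlanarCircularDigraph.chordIndexSign (c (π t')) (r t) =
      PlanarCircularDigraph.chordIndexSign (r t') (c (π t)) *
        PlanarCircularDigraph.chordIndexSign (c (π t')) (c (π t))) :
    (Equiv.Perm.sign π : ℤ) * ∏ t, (-1) ^ betweenCount r (r t) (c (π t)) = 1 := by
  set f : Fin k → Fin k → ℤ := fun i t =>
    if min (r t) (c (π t)) < r i ∧ r i < max (r t) (c (π t)) then -1 else 1 with hf
  have h1 : ∀ t, (-1 : ℤ) ^ betweenCount r (r t) (c (π t)) = ∏ i, f i t := by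
    intro t
    rw [betweenCount, hf]
    simp only [Finset.prod_ite, Finset.prod_const, one_pow, mul_one]
  have h2 : ∀ i, f i i = 1 := by
    intro i
    simp only [hf]
    rw [if_neg]
    rintro ⟨h, h'⟩
    rcases min_lt_iff.1 h with h | h
    · exact lt_irrefl _ h
    · rcases lt_max_iff.1 h' with h' | h'
      · exact lt_irrefl _ h'
      · exact lt_asymm h h'
  rw [Finset.prod_congr rfl fun t _ => h1 t, prod_prod_eq_prod_Iio f h2,
    Equiv.Perm.sign_eq_prod_prod_Iio]
  push_cast
  rw [← Finset.prod_mul_distrib]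
  refine Finset.prod_eq_one fun j _ => ?_
  rw [← Finset.prod_mul_distrib]
  refine Finset.prod_eq_one fun i hi => ?_
  rw [Finset.mem_Iio] at hi
  have hrij : r i < r j := hr hi
  have hcne : c (π i) ≠ c (π j) := fun h => hi.ne (π.injective (hc.injective h))
  have hlt : π i < π j ↔ c (π i) < c (π j) := hc.lt_iff_lt.symm
  have hx := hcross i j hi.ne
  have hdi : r i = c (π i) ∨ (r i ≠ c (π i) ∧ r j ≠ c (π i)) :=
    (hdis i).imp_right fun h => ⟨h i, h j⟩
  have hdj : r j = c (π j) ∨ (r i ≠ c (π j) ∧ r j ≠ c (π j)) :=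
    (hdis j).imp_right fun h => ⟨h i, h j⟩
  have hx' : r i ≠ c (π i) → r j ≠ c (π j) →
      ((r i < r j ↔ r i < c (π j)) ↔ (c (π i) < r j ↔ c (π i) < c (π j))) := by
    intro h h'
    have := hx h h'
    unfold PlanarCircularDigraph.chordIndexSign at this
    split_ifs at this <;> omega
  clear hx
  simp only [hf, hlt, min_lt_iff, lt_max_iff]
  generalize r i = a at *
  generalize r j = b at *
  generalize c (π i) = a' at *
  generalize c (π j) = b' at *
  split_ifs <;> first | rfl | (exfalso; omega)

/-! ### Routings of a flow -/

theorem List.iterate_congr' {α : Type*} {f g : α → α} {a : α} {n : ℕ}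
    (h : ∀ i < n, f^[i] a = g^[i] a) : List.iterate f a n = List.iterate g a n := by
  rw [← List.range_map_iterate, ← List.range_map_iterate]
  exact List.map_congr_left fun i hi => h i (List.mem_range.1 hi)

theorem iterate_sub_eq {α : Type*} {u : α → α} (hu : Function.Injective u) {x y : α} {i j : ℕ}
    (hij : i ≤ j) (h : u^[i] x = u^[j] y) : x = u^[j - i] y := by
  apply hu.iterate i
  rw [h, ← Function.iterate_add_apply]
  congr 2; omega

theorem nodup_iterate {α : Type*} {u : α → α} (hu : Function.Injective u) {x : α} {m : ℕ}
    (hmin : ∀ i, 0 < i → i ≤ m → u^[i] x ≠ x) : (List.iterate u x (m + 1)).Nodup := by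
  rw [← List.range_map_iterate]
  refine List.Nodup.map_on ?_ List.nodup_range
  intro i hi j hj h
  rw [List.mem_range] at hi hj
  rcases lt_trichotomy i j with hij | hij | hij
  · exact absurd (iterate_sub_eq hu hij.le h).symm (hmin _ (by omega) (by omega))
  · exact hij
  · exact absurd (iterate_sub_eq hu hij.le h.symm).symm (hmin _ (by omega) (by omega))

namespace PlanarCircularDigraph

variable {V E : Type*} {n : ℕ} {G : PlanarCircularDigraph V E n} {k : ℕ}

/-- The elements of `Fin k ⊕ E` that can follow each other in a routing from the boundary vertices
`b (r t)` to the boundary vertices `b (c s)`: edges continuing each other, first edges, last edges,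
and trivial walks. -/
def Follows (G : PlanarCircularDigraph V E n) (r c : Fin k → Fin n) : Fin k ⊕ E → Fin k ⊕ E → Prop
  | .inl t, .inl s => r t = c s
  | .inl t, .inr e => G.src e = G.b (r t)
  | .inr e, .inl s => G.tgt e = G.b (c s)
  | .inr e, .inr e' => G.src e' = G.tgt e

/-- A permutation of `Fin k ⊕ E` that sends every edge of `F` to its predecessor and every end
point `c s` to the last edge of a walk ending there, or to its starting point `r t = c s` if this
walk is trivial. The edges outside `F` are fixed. -/
structure IsRouting (G : PlanarCircularDigraph V E n) (r c : Fin k → Fin n) (F : Finset E)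
    (τ : Equiv.Perm (Fin k ⊕ E)) : Prop where
  follows_inl : ∀ s, G.Follows r c (τ (.inl s)) (.inl s)
  follows_inr : ∀ e ∈ F, G.Follows r c (τ (.inr e)) (.inr e)
  apply_of_notMem : ∀ e, e ∉ F → τ (.inr e) = .inr e

/-- In a perfectly oriented graph at most one edge of a flow leaves a given vertex: at an interior
vertex with only one incoming edge this follows from the balance of the flow. -/
theorem src_injOn_of_isFlow (hG : G.PerfectlyOriented) {F : Finset E} (hF : G.IsFlow F) {e e' : E}
    (he : e ∈ F) (he' : e' ∈ F) (h : G.src e = G.src e') : e = e' := by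
  classical
  by_cases hv : G.src e ∈ Set.range G.b
  · obtain ⟨i, hi⟩ := hv
    exact G.boundary_deg i e e' (.inl hi.symm) (.inl (h ▸ hi.symm))
  · rcases hG _ hv with hu | hu
    · exact hu.unique rfl h.symm
    · have hcard : (F.filter (G.src · = G.src e)).card ≤ 1 := by
        have := hF _ hv
        rw [← show (F.filter (G.tgt · = G.src e)).card = (F.filter (G.src · = G.src e)).card by
          convert! this]
        exact Finset.card_le_one.2 fun a ha b hb =>
          hu.unique (Finset.mem_filter.1 ha).2 (Finset.mem_filter.1 hb).2
      exact Finset.card_le_one.1 hcard _ (Finset.mem_filter.2 ⟨he, rfl⟩) _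
        (Finset.mem_filter.2 ⟨he', h.symm⟩)

theorem tgt_injOn_of_isFlow (hG : G.PerfectlyOriented) {F : Finset E} (hF : G.IsFlow F) {e e' : E}
    (he : e ∈ F) (he' : e' ∈ F) (h : G.tgt e = G.tgt e') : e = e' := by
  classical
  by_cases hv : G.tgt e ∈ Set.range G.b
  · obtain ⟨i, hi⟩ := hv
    exact G.boundary_deg i e e' (.inr hi.symm) (.inr (h ▸ hi.symm))
  · rcases hG _ hv with hu | hu
    · have hcard : (F.filter (G.tgt · = G.tgt e)).card ≤ 1 := by
        have := hF _ hv
        rw [show (F.filter (G.tgt · = G.tgt e)).card = (F.filter (G.src · = G.tgt e)).card by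
          convert! this]
        exact Finset.card_le_one.2 fun a ha b hb =>
          hu.unique (Finset.mem_filter.1 ha).2 (Finset.mem_filter.1 hb).2
      exact Finset.card_le_one.1 hcard _ (Finset.mem_filter.2 ⟨he, rfl⟩) _
        (Finset.mem_filter.2 ⟨he', h.symm⟩)
    · exact hu.unique rfl h.symm

/-- The elements of `Fin k ⊕ E` that take part in a routing of `F`. -/
def IsActive (F : Finset E) (x : Fin k ⊕ E) : Prop := ∀ e, x = .inr e → e ∈ F

theorem isActive_inl (F : Finset E) (t : Fin k) : IsActive F (.inl t : Fin k ⊕ E) := by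
  intro e h; cases h

theorem isActive_inr {F : Finset E} {e : E} : IsActive F (.inr e : Fin k ⊕ E) ↔ e ∈ F :=
  ⟨fun h => h e rfl, fun h e' he => by cases he; exact h⟩

namespace IsRouting

variable {r c : Fin k → Fin n} {F : Finset E} {τ : Equiv.Perm (Fin k ⊕ E)}

theorem follows (hτ : G.IsRouting r c F τ) {x : Fin k ⊕ E} (hx : IsActive F x) :
    G.Follows r c (τ x) x := by
  cases x with
  | inl s => exact hτ.follows_inl s
  | inr e => exact hτ.follows_inr e (isActive_inr.1 hx)

theorem isActive_apply_iff (hτ : G.IsRouting r c F τ) {x : Fin k ⊕ E} :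
    IsActive F (τ x) ↔ IsActive F x := by
  constructor
  · rintro h e rfl
    by_contra he
    rw [hτ.apply_of_notMem e he, isActive_inr] at h
    exact he h
  · intro h e he
    by_contra hn
    have := τ.injective (he.trans (hτ.apply_of_notMem e hn).symm)
    subst this
    exact hn (isActive_inr.1 h)

theorem isActive_symm (hτ : G.IsRouting r c F τ) {x : Fin k ⊕ E} (hx : IsActive F x) :
    IsActive F (τ.symm x) := by
  rwa [← hτ.isActive_apply_iff, Equiv.apply_symm_apply]

theorem follows_symm (hτ : G.IsRouting r c F τ) {x : Fin k ⊕ E} (hx : IsActive F x) :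
    G.Follows r c x (τ.symm x) := by
  have := hτ.follows (hτ.isActive_symm hx)
  rwa [Equiv.apply_symm_apply] at this

theorem isFlow (hτ : G.IsRouting r c F τ) : G.IsFlow F := by
  classical
  intro v hv
  symm
  refine Finset.card_nbij (fun e => Sum.elim (fun _ => e) id (τ (.inr e))) ?_ ?_ ?_
  · intro e he
    obtain ⟨he, hev⟩ := Finset.mem_filter.1 he
    have h1 := hτ.follows_inr e he
    have h2 := hτ.isActive_apply_iff.2 (isActive_inr.2 he)
    rcases hx : τ (.inr e) with t | e'
    · rw [hx] at h1
      exact absurd ⟨r t, h1.symm.trans hev⟩ hv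
    · rw [hx] at h1 h2
      change Sum.elim (fun _ => e) id (τ (.inr e)) ∈ _
      rw [hx]
      exact Finset.mem_filter.2 ⟨isActive_inr.1 h2, h1.symm.trans hev⟩
  · intro e he e' he' h
    obtain ⟨he, hev⟩ := Finset.mem_filter.1 he
    obtain ⟨he', hev'⟩ := Finset.mem_filter.1 he'
    have h1 := hτ.follows_inr e he
    have h2 := hτ.follows_inr e' he'
    rcases hx : τ (.inr e) with t | f
    · rw [hx] at h1
      exact absurd ⟨r t, h1.symm.trans hev⟩ hv
    rcases hx' : τ (.inr e') with t | f'
    · rw [hx'] at h2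
      exact absurd ⟨r t, h2.symm.trans hev'⟩ hv
    simp only [hx, hx', Sum.elim_inr, id] at h
    subst h
    exact Sum.inr_injective (τ.injective (hx.trans hx'.symm))
  · intro e' he'
    obtain ⟨he', hev⟩ := Finset.mem_filter.1 he'
    have h1 := hτ.follows_symm (isActive_inr.2 he')
    have h2 := hτ.isActive_symm (isActive_inr.2 he')
    rcases hx : τ.symm (.inr e') with s | e
    · rw [hx] at h1
      exact absurd ⟨c s, h1.symm.trans hev⟩ hv
    · rw [hx] at h1 h2
      refine ⟨e, Finset.mem_coe.2 (Finset.mem_filter.2 ⟨isActive_inr.1 h2, h1.trans hev⟩), ?_⟩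
      have : τ (.inr e) = .inr e' := by rw [← hx, Equiv.apply_symm_apply]
      simp [this]

end IsRouting

/-- Within a flow, predecessors are unique. -/
theorem follows_left_unique (hG : G.PerfectlyOriented) {r c : Fin k → Fin n} {F : Finset E}
    (hF : G.IsFlow F) (hrI : ∀ t, r t ∈ G.I) (hr : Function.Injective r) {x y y' : Fin k ⊕ E}
    (hy : IsActive F y) (hy' : IsActive F y') (h : G.Follows r c y x) (h' : G.Follows r c y' x) :
    y = y' := by
  cases x with
  | inl s =>
    cases y with
    | inl t =>
      cases y' with
      | inl t' => rw [hr (Eq.trans h (Eq.symm h'))]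
      | inr e' =>
        have h1 : r t = c s := h
        exact absurd (show G.tgt e' = G.b (r t) from h1 ▸ h') (G.source_no_in _ (hrI t) e')
    | inr e =>
      cases y' with
      | inl t' =>
        have h1 : r t' = c s := h'
        exact absurd (show G.tgt e = G.b (r t') from h1 ▸ h) (G.source_no_in _ (hrI t') e)
      | inr e' => rw [G.boundary_deg (c s) e e' (.inr h) (.inr h')]
  | inr f =>
    cases y with
    | inl t =>
      cases y' with
      | inl t' => rw [hr (G.b_injective (Eq.trans (Eq.symm h) h'))]
      | inr e' => exact absurd (Eq.trans (Eq.symm h') h) (G.source_no_in _ (hrI t) e')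
    | inr e =>
      cases y' with
      | inl t' => exact absurd (Eq.trans (Eq.symm h) h') (G.source_no_in _ (hrI t') e)
      | inr e' =>
        rw [tgt_injOn_of_isFlow hG hF (isActive_inr.1 hy) (isActive_inr.1 hy')
          (Eq.trans (Eq.symm h) h')]

theorem IsRouting.unique (hG : G.PerfectlyOriented) {r c : Fin k → Fin n} {F : Finset E}
    (hrI : ∀ t, r t ∈ G.I) (hr : Function.Injective r) {τ τ' : Equiv.Perm (Fin k ⊕ E)}
    (hτ : G.IsRouting r c F τ) (hτ' : G.IsRouting r c F τ') : τ = τ' := by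
  ext1 x
  by_cases hx : IsActive F x
  · exact follows_left_unique hG hτ.isFlow hrI hr (hτ.isActive_apply_iff.2 hx)
      (hτ'.isActive_apply_iff.2 hx) (hτ.follows hx) (hτ'.follows hx)
  · unfold IsActive at hx
    push Not at hx
    obtain ⟨e, rfl, he⟩ := hx
    rw [hτ.apply_of_notMem e he, hτ'.apply_of_notMem e he]

/-- The signs of the entries of the matrix whose determinant sums over the routings. The factor `η`
and the row signs `(-1) ^ t` are those of a walk; the column signs `(-1) ^ #{t | r t < c s}` turn
them into the signs of the boundary measurement matrix, see `neg_one_pow_mul_chordIndexSign`. -/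
def linkSign {k n : ℕ} (r c : Fin k → Fin n) (σ : E → E → ℤ) (η : E → ℤ) :
    Fin k ⊕ E → Fin k ⊕ E → ℤ
  | .inl _, .inl _ => 1
  | .inl t, .inr _ => -(-1) ^ (t : ℕ)
  | .inr e, .inl s => (-1) ^ (Finset.univ.filter fun t => r t < c s).card * η e
  | .inr e, .inr e' => -σ e e'

/-- The walk along the edges following an edge `e` in a routing. -/
theorem IsRouting.exists_segment {r c : Fin k → Fin n} {F : Finset E}
    {τ : Equiv.Perm (Fin k ⊕ E)} (hτ : G.IsRouting r c F τ) (σ : E → E → ℤ) (η : E → ℤ) :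
    ∀ (m : ℕ) (e : E), e ∈ F → (∀ i ≤ m, ∃ f, τ.symm^[i] (.inr e) = .inr f) →
    ∃ P : List E, (e :: P).map .inr = List.iterate τ.symm (.inr e) (m + 1) ∧
      (∀ f ∈ e :: P, f ∈ F) ∧
      (∀ s, τ.symm^[m + 1] (.inr e) = .inl s → G.IsWalk (G.src e) (e :: P) (G.b (c s)) ∧
        ((List.iterate τ.symm (.inr e) (m + 1)).map
          fun x => linkSign r c σ η x (τ.symm x)).prod =
            (-1) ^ m * (-1) ^ (Finset.univ.filter fun t => r t < c s).card *
              transferSign σ η e P) ∧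
      (∀ e₀, τ.symm^[m + 1] (.inr e) = .inr e₀ → G.IsWalk (G.src e) (e :: P) (G.src e₀) ∧
        ((List.iterate τ.symm (.inr e) (m + 1)).map
          fun x => linkSign r c σ η x (τ.symm x)).prod =
            (-1) ^ (m + 1) * turnSign σ e (P ++ [e₀]))
  | 0, e, he, _ => by
    refine ⟨[], by simp [List.iterate], by simpa using he, fun s hs => ?_, fun e₀ hs => ?_⟩
    · have h1 := hτ.follows_symm (isActive_inr.2 he)
      simp only [zero_add, Function.iterate_one] at hs
      rw [hs] at h1
      exact ⟨⟨rfl, h1⟩, by simp [List.iterate, hs, linkSign, transferSign]⟩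
    · have h1 := hτ.follows_symm (isActive_inr.2 he)
      simp only [zero_add, Function.iterate_one] at hs
      rw [hs] at h1
      exact ⟨⟨rfl, h1.symm⟩, by simp [List.iterate, hs, linkSign, turnSign]⟩
  | m + 1, e, he, hm => by
    obtain ⟨e', he'⟩ := hm 1 (by omega)
    rw [Function.iterate_one] at he'
    have h1 := hτ.follows_symm (isActive_inr.2 he)
    have h2 := hτ.isActive_symm (isActive_inr.2 he)
    rw [he'] at h1 h2
    obtain ⟨P, hP, hPF, hPs, hPe⟩ := hτ.exists_segment σ η m e' (isActive_inr.1 h2) fun i hi => by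
      obtain ⟨f, hf⟩ := hm (i + 1) (by omega)
      rw [Function.iterate_succ_apply, he'] at hf
      exact ⟨f, hf⟩
    refine ⟨e' :: P, ?_, ?_, fun s hs => ?_, fun e₀ hs => ?_⟩
    · change _ = .inr e :: List.iterate τ.symm (τ.symm (.inr e)) (m + 1)
      rw [List.map_cons, hP, he']
    · intro f hf
      rcases List.mem_cons.1 hf with rfl | hf
      · exact he
      · exact hPF f hf
    · rw [Function.iterate_succ_apply, he'] at hs
      obtain ⟨h3, h4⟩ := hPs s hs
      refine ⟨⟨rfl, by rw [← show G.src e' = G.tgt e from h1]; exact h3⟩, ?_⟩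
      rw [List.iterate, List.map_cons, List.prod_cons, he', h4, linkSign, transferSign]
      ring
    · rw [Function.iterate_succ_apply, he'] at hs
      obtain ⟨h3, h4⟩ := hPe e₀ hs
      refine ⟨⟨rfl, by rw [← show G.src e' = G.tgt e from h1]; exact h3⟩, ?_⟩
      rw [List.iterate, List.map_cons, List.prod_cons, he', h4, linkSign, List.cons_append,
        turnSign]
      ring

/-- A routing leads from every starting point to an end point. -/
theorem exists_exit [Finite E] (u : Equiv.Perm (Fin k ⊕ E)) (t : Fin k) :
    ∃ m s, u^[m + 1] (.inl t) = .inl s ∧ ∀ i < m, ∃ f, u^[i + 1] (.inl t) = .inr f := by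
  classical
  have hex : ∃ m, ∃ s, u^[m + 1] (.inl t) = .inl s := by
    refine ⟨orderOf u - 1, t, ?_⟩
    rw [Nat.sub_add_cancel (orderOf_pos u), Equiv.Perm.iterate_eq_pow, pow_orderOf_eq_one]
    rfl
  obtain ⟨s, hs⟩ := Nat.find_spec hex
  refine ⟨Nat.find hex, s, hs, fun i hi => ?_⟩
  rcases h : u^[i + 1] (.inl t) with s' | f
  · exact absurd ⟨s', h⟩ (Nat.find_min hex hi)
  · exact ⟨f, rfl⟩

/-- Walks from different starting points do not meet. -/
theorem exit_disjoint {u : Equiv.Perm (Fin k ⊕ E)} {t t' : Fin k} {m m' i j : ℕ}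
    (hm : ∀ i < m, ∃ f, u^[i + 1] (.inl t) = .inr f)
    (hm' : ∀ i < m', ∃ f, u^[i + 1] (.inl t') = .inr f) (hi : i ≤ m) (hj : j ≤ m')
    (h : u^[i] (.inl t) = u^[j] (.inl t')) : t = t' := by
  wlog hij : i ≤ j generalizing t t' m m' i j
  · exact (this hm' hm hj hi h.symm (by omega)).symm
  have h1 := iterate_sub_eq u.injective hij h
  rcases Nat.eq_zero_or_pos (j - i) with h0 | h0
  · rw [h0] at h1
    exact Sum.inl_injective h1
  · obtain ⟨f, hf⟩ := hm' (j - i - 1) (by omega)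
    rw [Nat.sub_add_cancel h0, ← h1] at hf
    cases hf

end PlanarCircularDigraph

/-! ### The sign of a routing -/

namespace PlanarCircularDigraph

/-- The sign of an entry of the boundary measurement matrix splits into a row factor, a column
factor and the orientation of the chord. -/
theorem neg_one_pow_mul_chordIndexSign {k n : ℕ} {r : Fin k → Fin n} (hr : StrictMono r) (t : Fin k)
    {j : Fin n} (hj : ∀ s, r s ≠ j) :
    (-1 : ℤ) ^ (t : ℕ) * (-1) ^ (Finset.univ.filter fun s => r s < j).card *
      chordIndexSign (r t) j = (-1) ^ betweenCount r (r t) j := by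
  rcases lt_or_gt_of_ne (hj t) with h | h
  · have hset : (Finset.univ.filter fun s => r s < j) = Finset.Iic t ∪
        Finset.univ.filter fun s => min (r t) j < r s ∧ r s < max (r t) j := by
      ext s
      simp only [Finset.mem_filter, Finset.mem_univ, true_and, Finset.mem_union, Finset.mem_Iic,
        min_eq_left h.le, max_eq_right h.le]
      rw [hr.lt_iff_lt]
      constructor
      · intro hs
        rcases le_or_gt s t with hst | hst
        · exact .inl hst
        · exact .inr ⟨hst, hs⟩
      · rintro (hs | hs)
        · exact (hr.monotone hs).trans_lt h
        · exact hs.2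
    have hcard : (Finset.univ.filter fun s => r s < j).card = t + 1 + betweenCount r (r t) j := by
      rw [hset, Finset.card_union_of_disjoint, Fin.card_Iic]
      · rfl
      · rw [Finset.disjoint_left]
        intro s hs hs'
        rw [Finset.mem_Iic] at hs
        rw [Finset.mem_filter, min_eq_left h.le, hr.lt_iff_lt] at hs'
        exact absurd hs hs'.2.1.not_ge
    rw [hcard, chordIndexSign, if_neg h.not_gt, pow_add, pow_succ]
    have : (-1 : ℤ) ^ (t : ℕ) * (-1) ^ (t : ℕ) = 1 := by rw [← mul_pow]; simp
    linear_combination ((-1) ^ betweenCount r (r t) j) * this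
  · have hset : Finset.Iio t = (Finset.univ.filter fun s => r s < j) ∪
        Finset.univ.filter fun s => min (r t) j < r s ∧ r s < max (r t) j := by
      ext s
      simp only [Finset.mem_filter, Finset.mem_univ, true_and, Finset.mem_union, Finset.mem_Iio,
        min_eq_right h.le, max_eq_left h.le]
      rw [hr.lt_iff_lt]
      constructor
      · intro hs
        rcases lt_or_gt_of_ne (hj s) with hst | hst
        · exact .inl hst
        · exact .inr ⟨hst, hs⟩
      · rintro (hs | hs)
        · exact hr.lt_iff_lt.1 (hs.trans h)
        · exact hs.2
    have hcard : (t : ℕ) = (Finset.univ.filter fun s => r s < j).card + betweenCount r (r t) j := by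
      rw [← Fin.card_Iio, hset, Finset.card_union_of_disjoint]
      · rfl
      · rw [Finset.disjoint_left]
        intro s hs hs'
        rw [Finset.mem_filter] at hs
        rw [Finset.mem_filter, min_eq_right h.le] at hs'
        exact absurd hs.2 hs'.2.1.not_gt
    rw [chordIndexSign, if_pos h]
    nth_rw 1 [hcard]
    rw [pow_add]
    have : ∀ a : ℕ, (-1 : ℤ) ^ a * (-1) ^ a = 1 := fun a => by rw [← mul_pow]; simp
    linear_combination ((-1) ^ betweenCount r (r t) j) *
      this (Finset.univ.filter fun s => r s < j).card

variable {V E : Type*} {n : ℕ} {G : PlanarCircularDigraph V E n} {k : ℕ}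

/-- The walk of a routing from its `t`-th starting point, if it is not trivial. -/
theorem IsRouting.exists_path {r c : Fin k → Fin n} {F : Finset E}
    {τ : Equiv.Perm (Fin k ⊕ E)} (hτ : G.IsRouting r c F τ) (σ : E → E → ℤ) (η : E → ℤ)
    {t s : Fin k} {m : ℕ} (hs : τ.symm^[m + 1 + 1] (.inl t) = .inl s)
    (hm : ∀ i < m + 1, ∃ f, τ.symm^[i + 1] (.inl t) = .inr f) :
    ∃ (e : E) (P : List E), G.IsWalk (G.b (r t)) (e :: P) (G.b (c s)) ∧ (∀ f ∈ e :: P, f ∈ F) ∧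
      (.inl t :: (e :: P).map .inr) = List.iterate τ.symm (.inl t) (m + 1 + 1) ∧
      ((List.iterate τ.symm (.inl t) (m + 1 + 1)).map
          fun x => linkSign r c σ η x (τ.symm x)).prod =
        (-1) ^ (m + 1) * ((-1) ^ (t : ℕ) *
          (-1) ^ (Finset.univ.filter fun t => r t < c s).card * transferSign σ η e P) := by
  obtain ⟨e, he⟩ := hm 0 (by omega)
  rw [zero_add, Function.iterate_one] at he
  have h1 := hτ.follows_symm (isActive_inl F t)
  have h2 := hτ.isActive_symm (isActive_inl F t)
  rw [he] at h1 h2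
  obtain ⟨P, hP, hPF, hPs, -⟩ := hτ.exists_segment σ η m e (isActive_inr.1 h2) fun i hi => by
    obtain ⟨f, hf⟩ := hm i (by omega)
    rw [Function.iterate_succ_apply, he] at hf
    exact ⟨f, hf⟩
  rw [Function.iterate_succ_apply, he] at hs
  obtain ⟨h3, h4⟩ := hPs s hs
  have hit : List.iterate τ.symm (.inl t) (m + 1 + 1) =
      .inl t :: List.iterate τ.symm (.inr e) (m + 1) := by rw [← he]; rfl
  refine ⟨e, P, by rw [← show G.src e = G.b (r t) from h1]; exact h3, hPF, by rw [hP, hit], ?_⟩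
  rw [hit, List.map_cons, List.prod_cons, h4, he, linkSign]
  ring

/-- A routing contributes with the sign `+1`: its walks are simple and pairwise disjoint, so that
the turns of each of them are determined by its end points, and its cycles are simple. -/
theorem IsRouting.sign_mul_prod_linkSign [Fintype E] [DecidableEq E] (hG : G.PerfectlyOriented)
    {r c : Fin k → Fin n}
    (hr : StrictMono r) (hc : StrictMono c) (hrI : ∀ t, r t ∈ G.I) {F : Finset E}
    {τ : Equiv.Perm (Fin k ⊕ E)} (hτ : G.IsRouting r c F τ) {σ : E → E → ℤ} {η : E → ℤ}
    (hpath : ∀ (i j : Fin n) (e : E) (P : List E), G.IsWalk (G.b i) (e :: P) (G.b j) →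
      (e :: P).Nodup → (∀ f ∈ e :: P, ∀ f' ∈ e :: P, G.src f = G.src f' → f = f') →
      transferSign σ η e P = chordIndexSign i j)
    (hcycle : ∀ (v : V) (e : E) (P : List E), G.IsWalk v (e :: P) v → (e :: P).Nodup →
      (∀ f ∈ e :: P, ∀ f' ∈ e :: P, G.src f = G.src f' → f = f') →
      turnSign σ e (P ++ [e]) = -1) :
    (Equiv.Perm.sign τ : ℤ) * ((∏ s, linkSign r c σ η (τ (.inl s)) (.inl s)) *
      ∏ e ∈ F, linkSign r c σ η (τ (.inr e)) (.inr e)) = 1 := by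
  classical
  have hsrc : ∀ e ∈ F, ∀ e' ∈ F, G.src e = G.src e' → e = e' :=
    fun e he e' he' => src_injOn_of_isFlow hG hτ.isFlow he he'
  set u : Equiv.Perm (Fin k ⊕ E) := τ.symm with hu
  choose m p hp hm using exists_exit u
  -- the permutation of the starting points and the end points
  have hpinj : Function.Injective p := by
    intro t t' h
    have h1 : u^[m t + 1] (.inl t) = u^[m t' + 1] (.inl t') := by rw [hp, hp, h]
    refine exit_disjoint (hm t) (hm t') le_rfl le_rfl (u.injective ?_)
    rw [← Function.iterate_succ_apply' u, ← Function.iterate_succ_apply' u]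
    exact h1
  let π : Equiv.Perm (Fin k) := Equiv.ofBijective p (Finite.injective_iff_bijective.1 hpinj)
  have hπ : ∀ t, π t = p t := fun t => rfl
  -- the walk from a starting point
  have hwalk : ∀ t, (m t = 0 ∧ r t = c (π t)) ∨ (∃ m', m t = m' + 1 ∧
      ∃ (e : E) (P : List E), G.IsWalk (G.b (r t)) (e :: P) (G.b (c (π t))) ∧
        (∀ f ∈ e :: P, f ∈ F) ∧
        (.inl t :: (e :: P).map .inr) = List.iterate u (.inl t) (m' + 1 + 1) ∧
        ((List.iterate u (.inl t) (m' + 1 + 1)).map fun x => linkSign r c σ η x (u x)).prod =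
          (-1) ^ (m' + 1) * ((-1) ^ (t : ℕ) *
            (-1) ^ (Finset.univ.filter fun s => r s < c (π t)).card * transferSign σ η e P)) := by
    intro t
    rcases hmt : m t with _ | m'
    · have h := hp t
      rw [hmt, zero_add, Function.iterate_one] at h
      have := hτ.follows_symm (isActive_inl F t)
      rw [← hu, h] at this
      exact .inl ⟨rfl, this⟩
    · right
      have h := hp t
      have h' := hm t
      rw [hmt] at h h'
      exact ⟨m', rfl, hτ.exists_path σ η h h'⟩
  have hrc : ∀ t, r t = c (π t) ∨ ∀ t', r t' ≠ c (π t) := by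
    intro t
    rcases hwalk t with h | ⟨m', -, e, P, hP, -⟩
    · exact .inl h.2
    · exact .inr fun t' h => sink_of_isWalk hP (by simp) (h ▸ hrI t')
  -- `u'` returns from the end of each walk to its starting point, so that the walks become cycles;
  -- the signs `κ` compensate for the signs of the walks
  set u' : Equiv.Perm (Fin k ⊕ E) := Equiv.Perm.sumCongr π⁻¹ 1 * u with hu'
  have hu'r : ∀ x f, u x = .inr f → u' x = .inr f := fun x f h => by
    simp [hu', Equiv.Perm.mul_apply, h]
  have hu'l : ∀ x s, u x = .inl s → u' x = .inl (π⁻¹ s) := fun x s h => by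
    simp [hu', Equiv.Perm.mul_apply, h]
  have hit : ∀ t, ∀ i ≤ m t, u'^[i] (.inl t) = u^[i] (.inl t) := by
    intro t i
    induction i with
    | zero => simp
    | succ i ih =>
      intro hi
      obtain ⟨f, hf⟩ := hm t i (by omega)
      rw [hf, Function.iterate_succ_apply', ih (by omega)]
      rw [Function.iterate_succ_apply'] at hf
      exact hu'r _ _ hf
  set κ : Fin k ⊕ E → ℤ :=
    Sum.elim (fun t => (-1) ^ betweenCount r (r t) (c (π t))) (fun _ => 1) with hκ
  set W : Fin k ⊕ E → ℤ := fun x => if IsActive F x then linkSign r c σ η x (u x) else 1 with hW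
  have key : (Equiv.Perm.sign u' : ℤ) * ∏ x, W x * κ x = 1 := by
    refine sign_mul_prod_eq_one u' _ fun x => ?_
    by_cases hx : ∃ t, u'.SameCycle x (.inl t)
    · obtain ⟨t, ht⟩ := hx
      have hper : u'^[m t + 1] (.inl t) = .inl t := by
        rw [Function.iterate_succ_apply', hit t _ le_rfl]
        have := hp t
        rw [Function.iterate_succ_apply'] at this
        rw [hu'l _ _ this, ← hπ]
        simp
      have hmin : ∀ i, 0 < i → i ≤ m t → u'^[i] (.inl t) ≠ .inl t := by
        intro i h0 hi h
        rw [hit t i hi] at h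
        obtain ⟨f, hf⟩ := hm t (i - 1) (by omega)
        rw [Nat.sub_add_cancel h0, h] at hf
        cases hf
      refine ⟨.inl t, m t, ht, hper, hmin, ?_⟩
      have hnd := nodup_iterate u'.injective hmin
      rw [List.iterate_congr' (g := u) fun i hi => hit t i (by omega)] at hnd ⊢
      rcases hwalk t with ⟨h0, hrt⟩ | ⟨m', hm', e, P, hP, hPF, hl, hprod⟩
      · have hb : betweenCount r (r t) (c (π t)) = 0 := by
          rw [hrt, betweenCount_self]
        have h1 := hp t
        rw [h0, zero_add, Function.iterate_one] at h1
        simp [h0, List.iterate, hW, hκ, isActive_inl, h1, linkSign, hb]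
      · rw [hm'] at hnd ⊢
        have hW' : ((List.iterate u (.inl t) (m' + 1 + 1)).map W).prod =
            ((List.iterate u (.inl t) (m' + 1 + 1)).map
              fun x => linkSign r c σ η x (u x)).prod := by
          rw [← hl]
          congr 1
          refine List.map_congr_left fun x hx => ?_
          rw [hW]
          refine if_pos ?_
          rcases List.mem_cons.1 hx with rfl | hx
          · exact isActive_inl F t
          · obtain ⟨f, hf, rfl⟩ := List.mem_map.1 hx
            exact isActive_inr.2 (hPF f hf)
        have hκ' : ((List.iterate u (.inl t) (m' + 1 + 1)).map κ).prod =
            (-1) ^ betweenCount r (r t) (c (π t)) := by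
          rw [← hl]
          simp [hκ, Function.comp_def]
        have hne : ∀ s, r s ≠ c (π t) := fun s h => sink_of_isWalk hP (by simp) (h ▸ hrI s)
        have hnd' : (e :: P).Nodup := by
          rw [← hl] at hnd
          exact (List.nodup_cons.1 hnd).2.of_map _
        rw [List.prod_map_mul, hW', hκ', hprod, hpath _ _ e P hP hnd' fun f hf f' hf' =>
          hsrc f (hPF f hf) f' (hPF f' hf'), neg_one_pow_mul_chordIndexSign hr t hne]
        have : ∀ a : ℕ, (-1 : ℤ) ^ a * (-1) ^ a = 1 := fun a => by rw [← mul_pow]; simp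
        linear_combination ((-1) ^ (m' + 1) * (-1) ^ (m' + 1)) *
          this (betweenCount r (r t) (c (π t))) + this (m' + 1)
    · have hinr : ∀ i, ∃ f, u'^[i] x = .inr f := by
        intro i
        rcases h : u'^[i] x with t | f
        · refine absurd ⟨t, ?_⟩ hx
          rw [← h, Equiv.Perm.iterate_eq_pow]
          exact (Equiv.Perm.SameCycle.refl _ _).pow_right
        · exact ⟨f, rfl⟩
      have hxu : ∀ i, u'^[i] x = u^[i] x := by
        intro i
        induction i with
        | zero => rfl
        | succ i ih =>
          obtain ⟨f, hf⟩ := hinr (i + 1)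
          rw [Function.iterate_succ_apply', ih] at hf ⊢
          rw [Function.iterate_succ_apply', hf]
          rcases h : u (u^[i] x) with s | f'
          · rw [hu'l _ _ h] at hf; cases hf
          · rw [← hf, hu'r _ _ h]
      obtain ⟨e, he⟩ := hinr 0
      rw [Function.iterate_zero, id] at he
      by_cases heF : e ∈ F
      · have hex : ∃ m, u'^[m + 1] x = x := by
          refine ⟨orderOf u' - 1, ?_⟩
          rw [Nat.sub_add_cancel (orderOf_pos u'), Equiv.Perm.iterate_eq_pow, pow_orderOf_eq_one]
          rfl
        have hper := Nat.find_spec hex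
        have hmin : ∀ i, 0 < i → i ≤ Nat.find hex → u'^[i] x ≠ x := by
          intro i h0 hi h
          refine Nat.find_min hex (m := i - 1) (by omega) ?_
          rwa [Nat.sub_add_cancel h0]
        refine ⟨x, Nat.find hex, .refl _ _, hper, hmin, ?_⟩
        have hnd := nodup_iterate u'.injective hmin
        rw [List.iterate_congr' (g := u) fun i hi => hxu i] at hnd ⊢
        rw [hxu] at hper
        subst he
        obtain ⟨P, hP, hPF, -, hPe⟩ := hτ.exists_segment σ η (Nat.find hex) e heF fun i hi => by
          obtain ⟨f, hf⟩ := hinr i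
          exact ⟨f, by rw [← hf, hxu]⟩
        obtain ⟨hPw, hprod⟩ := hPe e hper
        have hnd' : (e :: P).Nodup := by
          rw [← hP] at hnd
          exact hnd.of_map _
        have hW' : ((List.iterate u (.inr e) (Nat.find hex + 1)).map fun x => W x * κ x) =
            (List.iterate u (.inr e) (Nat.find hex + 1)).map
              fun x => linkSign r c σ η x (u x) := by
          rw [← hP]
          refine List.map_congr_left fun x hx => ?_
          obtain ⟨f, hf, rfl⟩ := List.mem_map.1 hx
          simp [hW, hκ, isActive_inr.2 (hPF f hf)]
        rw [hW', hprod, hcycle _ e P hPw hnd' fun f hf f' hf' =>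
          hsrc f (hPF f hf) f' (hPF f' hf')]
        have : ∀ a : ℕ, (-1 : ℤ) ^ a * (-1) ^ a = 1 := fun a => by rw [← mul_pow]; simp
        rw [pow_succ]
        linear_combination this (Nat.find hex)
      · have hfix : u' x = x := by
          rw [he]
          refine hu'r _ _ ?_
          rw [hu, Equiv.symm_apply_eq, hτ.apply_of_notMem e heF]
        refine ⟨x, 0, .refl _ _, by simpa using hfix, fun i h0 hi => by omega, ?_⟩
        have hna : ¬ IsActive F (.inr e : Fin k ⊕ E) := fun h => heF (isActive_inr.1 h)
        simp [List.iterate, hW, hκ, he, hna]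
  -- the walks do not cross, which determines the sign of `π`
  have hsign := sign_mul_prod_betweenCount hr hc π hrc fun t t' htt h h' => by
    rcases hwalk t with h0 | ⟨m₁, hm₁, e, P, hP, hPF, hl, -⟩
    · exact absurd h0.2 h
    rcases hwalk t' with h0 | ⟨m₂, hm₂, e', P', hP', hPF', hl', -⟩
    · exact absurd h0.2 h'
    refine chordIndexSign_eq_of_disjoint hP (by simp) hP' (by simp) ?_
      fun h => htt (π.injective (hc.injective h))
    intro f hf f' hf' hff
    have hff' := hsrc f (hPF f hf) f' (hPF' f' hf') hff
    have h1 : (.inr f : Fin k ⊕ E) ∈ List.iterate u (.inl t) (m₁ + 1 + 1) := by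
      rw [← hl]; exact List.mem_cons_of_mem _ (List.mem_map_of_mem hf)
    have h2 : (.inr f' : Fin k ⊕ E) ∈ List.iterate u (.inl t') (m₂ + 1 + 1) := by
      rw [← hl']; exact List.mem_cons_of_mem _ (List.mem_map_of_mem hf')
    obtain ⟨i, hi, hi'⟩ := List.mem_iterate.1 h1
    obtain ⟨j, hj, hj'⟩ := List.mem_iterate.1 h2
    have hi2 : i ≤ m t := by omega
    have hj2 : j ≤ m t' := by omega
    exact htt (exit_disjoint (hm t) (hm t') hi2 hj2 (by rw [← hi', ← hj', hff']))
  have hWprod : ∏ x, W x = (∏ s, linkSign r c σ η (τ (.inl s)) (.inl s)) *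
      ∏ e ∈ F, linkSign r c σ η (τ (.inr e)) (.inr e) := by
    rw [← Equiv.prod_comp τ, Fintype.prod_sum_type]
    congr 1
    · refine Finset.prod_congr rfl fun s _ => ?_
      simp [hW, hτ.isActive_apply_iff, isActive_inl, hu]
    · simp only [hW, hτ.isActive_apply_iff, isActive_inr, hu, Equiv.symm_apply_apply]
      rw [Finset.prod_ite_mem, Finset.univ_inter]
  have hκprod : ∏ x, κ x = ∏ t, (-1) ^ betweenCount r (r t) (c (π t)) := by
    rw [Fintype.prod_sum_type]
    simp [hκ]
  have hsu : (Equiv.Perm.sign u' : ℤ) = Equiv.Perm.sign π * Equiv.Perm.sign τ := by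
    rw [hu', Equiv.Perm.sign_mul, Equiv.Perm.sign_sumCongr, Equiv.Perm.sign_inv, hu,
      Equiv.Perm.sign_symm]
    simp
  rw [Finset.prod_mul_distrib, hWprod, hκprod, hsu] at key
  linear_combination key - ((Equiv.Perm.sign τ : ℤ) *
    ((∏ s, linkSign r c σ η (τ (.inl s)) (.inl s)) *
      ∏ e ∈ F, linkSign r c σ η (τ (.inr e)) (.inr e))) * hsign

end PlanarCircularDigraph

namespace PlanarCircularDigraph

variable {V E : Type*} {n : ℕ} {G : PlanarCircularDigraph V E n} {k : ℕ}

/-! ### Flows and routings -/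

open Classical in
/-- Every flow with suitable ends at the boundary is the edge set of a routing. -/
theorem exists_isRouting [Finite E] (hG : G.PerfectlyOriented) {r c : Fin k → Fin n}
    (hc : Function.Injective c) {F : Finset E} (hF : G.IsFlow F)
    (hsrc : ∀ e ∈ F, ∀ i, G.src e = G.b i → ∃ t, r t = i)
    (hstart : ∀ s, ∃ y : Fin k ⊕ E, IsActive F y ∧ G.Follows r c y (.inl s))
    (hend : ∀ s, ∀ e ∈ F, G.src e ≠ G.b (c s)) : ∃ τ, G.IsRouting r c F τ := by
  have hex : ∀ x : Fin k ⊕ E, ∃ y, (IsActive F y ↔ IsActive F x) ∧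
      (IsActive F x → G.Follows r c y x) ∧ (¬ IsActive F x → y = x) := by
    rintro (s | e)
    · obtain ⟨y, hy, h⟩ := hstart s
      exact ⟨y, iff_of_true hy (isActive_inl F s), fun _ => h,
        fun h => absurd (isActive_inl F s) h⟩
    · by_cases he : e ∈ F
      · have hact : IsActive F (.inr e : Fin k ⊕ E) := isActive_inr.2 he
        suffices ∃ y : Fin k ⊕ E, IsActive F y ∧ G.Follows r c y (.inr e) by
          obtain ⟨y, hy, h⟩ := this
          exact ⟨y, iff_of_true hy hact, fun _ => h, fun h => absurd hact h⟩
        by_cases hv : G.src e ∈ Set.range G.b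
        · obtain ⟨i, hi⟩ := hv
          obtain ⟨t, rfl⟩ := hsrc e he i hi.symm
          exact ⟨.inl t, isActive_inl F t, hi.symm⟩
        · have hpos : 0 < (F.filter (G.tgt · = G.src e)).card := by
            rw [hF _ hv]
            exact Finset.card_pos.2 ⟨e, Finset.mem_filter.2 ⟨he, rfl⟩⟩
          obtain ⟨e', he'⟩ := Finset.card_pos.1 hpos
          rw [Finset.mem_filter] at he'
          exact ⟨.inr e', isActive_inr.2 he'.1, he'.2.symm⟩
      · exact ⟨.inr e, Iff.rfl, fun h => absurd (isActive_inr.1 h) he, fun _ => rfl⟩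
  choose p hp1 hp2 hp3 using hex
  have hinj : Function.Injective p := by
    intro x x' h
    by_cases hx : IsActive F x
    · have hx' : IsActive F x' := by rwa [← hp1, ← h, hp1]
      have h1 := hp2 x hx
      have h2 := hp2 x' hx'
      rw [← h] at h2
      generalize p x = y at h1 h2
      cases x with
      | inl s =>
        cases x' with
        | inl s' =>
          cases y with
          | inl t => rw [hc (Eq.trans (Eq.symm h1) h2)]
          | inr e => rw [hc (G.b_injective (Eq.trans (Eq.symm h1) h2))]
        | inr e' =>
          cases y with
          | inl t =>
            have h3 : r t = c s := h1
            exact absurd (h3 ▸ h2) (hend s e' (isActive_inr.1 hx'))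
          | inr e => exact absurd (Eq.trans h2 h1) (hend s e' (isActive_inr.1 hx'))
      | inr e =>
        cases x' with
        | inl s' =>
          cases y with
          | inl t =>
            have h3 : r t = c s' := h2
            exact absurd (h3 ▸ h1) (hend s' e (isActive_inr.1 hx))
          | inr e' => exact absurd (Eq.trans h1 h2) (hend s' e (isActive_inr.1 hx))
        | inr e' =>
          have h3 : G.src e = G.src e' := by
            cases y with
            | inl t => exact Eq.trans h1 (Eq.symm h2)
            | inr f => exact Eq.trans h1 (Eq.symm h2)
          rw [src_injOn_of_isFlow hG hF (isActive_inr.1 hx) (isActive_inr.1 hx') h3]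
    · have hx' : ¬ IsActive F x' := by rwa [← hp1, ← h, hp1]
      rw [← hp3 x hx, ← hp3 x' hx', h]
  refine ⟨Equiv.ofBijective p (Finite.injective_iff_bijective.1 hinj), fun s => ?_,
    fun e he => ?_, fun e he => ?_⟩
  · exact hp2 _ (isActive_inl F s)
  · exact hp2 _ (isActive_inr.2 he)
  · exact hp3 _ fun h => he (isActive_inr.1 h)

/-- Walks within a flow that start at boundary sources can be traced back from their end. -/
theorem eq_of_isWalk_of_isWalk (hG : G.PerfectlyOriented) {F : Finset E} (hF : G.IsFlow F)
    {i i' : Fin n} (hi : i ∈ G.I) (hi' : i' ∈ G.I) {P P' : List E} {v : V}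
    (hP : G.IsWalk (G.b i) P v) (hPF : ∀ e ∈ P, e ∈ F)
    (hP' : G.IsWalk (G.b i') P' v) (hPF' : ∀ e ∈ P', e ∈ F) : i = i' := by
  induction P using List.reverseRecOn generalizing P' v with
  | nil =>
    obtain rfl : G.b i = v := hP
    rcases List.eq_nil_or_concat P' with rfl | ⟨Q, e, rfl⟩
    · exact (G.b_injective hP').symm
    · rw [List.concat_eq_append, isWalk_append] at hP'
      obtain ⟨w, -, -, h⟩ := hP'
      exact absurd h (G.source_no_in i hi e)
  | append_singleton Q e ih =>
    rw [isWalk_append] at hP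
    obtain ⟨w, hQ, rfl, rfl⟩ := hP
    rcases List.eq_nil_or_concat P' with rfl | ⟨Q', e', rfl⟩
    · exact absurd (Eq.symm hP') (G.source_no_in i' hi' e)
    · rw [List.concat_eq_append, isWalk_append] at hP'
      obtain ⟨w, hQ', rfl, h⟩ := hP'
      have he : e' = e := tgt_injOn_of_isFlow hG hF (hPF' e' (by simp)) (hPF e (by simp)) h
      subst he
      exact ih hQ (fun f hf => hPF f (by simp [hf])) hQ' fun f hf => hPF' f (by simp [hf])

/-- The flows from `I` to `J` are the edge sets of the routings from `I` to `J`. -/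
theorem exists_isRouting_iff_isFlowTo [Finite E] (hG : G.PerfectlyOriented) {r c : Fin k → Fin n}
    (hr : Function.Injective r) (hc : Function.Injective c) {J : Finset (Fin n)}
    (hrI : ∀ i, i ∈ G.I ↔ ∃ t, r t = i) (hcJ : ∀ j, j ∈ J ↔ ∃ s, c s = j) (F : Finset E) :
    (∃ τ, G.IsRouting r c F τ) ↔ G.IsFlowTo J F := by
  have hrI' : ∀ t, r t ∈ G.I := fun t => (hrI _).2 ⟨t, rfl⟩
  constructor
  · rintro ⟨τ, hτ⟩
    refine ⟨hτ.isFlow, fun i hi => ?_⟩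
    obtain ⟨t, rfl⟩ := (hrI i).1 hi
    obtain ⟨m, s, hs, hm⟩ := exists_exit τ.symm t
    refine ⟨c s, (hcJ _).2 ⟨s, rfl⟩, ?_, fun e he h => ?_⟩
    · cases m with
      | zero =>
        have h := hτ.follows_symm (isActive_inl F t)
        rw [zero_add, Function.iterate_one] at hs
        rw [hs] at h
        exact ⟨[], congrArg G.b (show r t = c s from h), by simp⟩
      | succ m =>
        obtain ⟨e, P, hP, hPF, -⟩ := hτ.exists_path (fun _ _ => 1) (fun _ => 1) hs hm
        exact ⟨e :: P, hP, hPF⟩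
    · have hcs : c s ∈ G.I := by
        by_contra hcs
        exact G.sink_no_out _ hcs e h
      obtain ⟨t', ht'⟩ := (hrI _).1 hcs
      have h1 : τ (.inl s) = .inl t' := follows_left_unique hG hτ.isFlow hrI' hr
        (hτ.isActive_apply_iff.2 (isActive_inl F s)) (isActive_inl F t') (hτ.follows_inl s) ht'
      have h2 : τ (.inr e) = .inl t' := follows_left_unique hG hτ.isFlow hrI' hr
        (hτ.isActive_apply_iff.2 (isActive_inr.2 he)) (isActive_inl F t') (hτ.follows_inr e he)
        (show G.src e = G.b (r t') by rw [h, ht'])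
      cases τ.injective (h1.trans h2.symm)
  · rintro ⟨hF, hcon⟩
    have hex : ∀ t, ∃ s, G.Connects F (r t) (c s) := fun t => by
      obtain ⟨j, hj, h⟩ := hcon _ (hrI' t)
      obtain ⟨s, rfl⟩ := (hcJ j).1 hj
      exact ⟨s, h⟩
    choose p hp using hex
    have hpinj : Function.Injective p := by
      intro t t' h
      obtain ⟨P, hP, hPF⟩ := (hp t).1
      obtain ⟨P', hP', hPF'⟩ := (hp t').1
      rw [← h] at hP'
      exact hr (eq_of_isWalk_of_isWalk hG hF (hrI' t) (hrI' t') hP hPF hP' hPF')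
    have hpsurj := Finite.surjective_of_injective hpinj
    refine exists_isRouting hG hc hF (fun e _ i hi => ?_) (fun s => ?_) fun s => ?_
    · refine (hrI i).1 ?_
      by_contra h
      exact G.sink_no_out i h e hi
    · obtain ⟨t, rfl⟩ := hpsurj s
      obtain ⟨P, hP, hPF⟩ := (hp t).1
      rcases List.eq_nil_or_concat P with rfl | ⟨Q, e, rfl⟩
      · exact ⟨.inl t, isActive_inl F t, G.b_injective hP⟩
      · rw [List.concat_eq_append, isWalk_append] at hP
        obtain ⟨w, -, -, h⟩ := hP
        exact ⟨.inr e, isActive_inr.2 (hPF e (by simp)), h⟩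
    · obtain ⟨t, rfl⟩ := hpsurj s
      exact (hp t).2

/-- The conservative flows are the edge sets of the routings without walks. -/
theorem exists_isRouting_iff_isConservativeFlow [Finite E] (hG : G.PerfectlyOriented)
    {r c : Fin 0 → Fin n} (F : Finset E) :
    (∃ τ, G.IsRouting r c F τ) ↔ G.IsConservativeFlow F := by
  constructor
  · rintro ⟨τ, hτ⟩
    refine ⟨hτ.isFlow, fun e he => ⟨?_, ?_⟩⟩
    · rintro ⟨i, hi⟩
      have h1 := hτ.follows_inr e he
      rcases hx : τ (.inr e) with t | e'
      · exact t.elim0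
      · rw [hx] at h1
        refine G.source_no_in i ?_ e' (Eq.trans (Eq.symm h1) hi.symm)
        by_contra h
        exact G.sink_no_out i h e hi.symm
    · rintro ⟨i, hi⟩
      have h1 := hτ.follows_symm (isActive_inr.2 he)
      rcases hx : τ.symm (.inr e) with t | e'
      · exact t.elim0
      · rw [hx] at h1
        have h2 : G.src e' = G.b i := Eq.trans h1 hi.symm
        refine G.source_no_in i ?_ e hi.symm
        by_contra h
        exact G.sink_no_out i h e' h2
  · rintro ⟨hF, h⟩
    exact exists_isRouting hG (fun s => s.elim0) hF
      (fun e he i hi => absurd ⟨i, hi.symm⟩ (h e he).1) (fun s => s.elim0) fun s => s.elim0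

/-! ### The determinant of the linking matrix -/

open Classical in
/-- The integer entries of the matrix whose determinant is the generating function of the edge sets
of routings. -/
noncomputable def linkEntry (G : PlanarCircularDigraph V E n) (r c : Fin k → Fin n)
    (σ : E → E → ℤ) (η : E → ℤ) (y x : Fin k ⊕ E) : ℤ :=
  if G.Follows r c y x then linkSign r c σ η y x else 0

open Classical in
/-- A set of edges contributes if and only if it has a routing, which is then unique. -/
theorem permSum_linkEntry [Fintype E] (hG : G.PerfectlyOriented)
    {r c : Fin k → Fin n} (hr : StrictMono r) (hc : StrictMono c) (hrI : ∀ t, r t ∈ G.I)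
    {σ : E → E → ℤ} {η : E → ℤ}
    (hpath : ∀ (i j : Fin n) (e : E) (P : List E), G.IsWalk (G.b i) (e :: P) (G.b j) →
      (e :: P).Nodup → (∀ f ∈ e :: P, ∀ f' ∈ e :: P, G.src f = G.src f' → f = f') →
      transferSign σ η e P = chordIndexSign i j)
    (hcycle : ∀ (v : V) (e : E) (P : List E), G.IsWalk v (e :: P) v → (e :: P).Nodup →
      (∀ f ∈ e :: P, ∀ f' ∈ e :: P, G.src f = G.src f' → f = f') →
      turnSign σ e (P ++ [e]) = -1) (F : Finset E) :
    permSum (G.linkEntry r c σ η) F = if ∃ τ, G.IsRouting r c F τ then 1 else 0 := by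
  have hterm : ∀ τ : Equiv.Perm (Fin k ⊕ E), (Equiv.Perm.sign τ : ℤ) *
      ((∏ s, G.linkEntry r c σ η (τ (.inl s)) (.inl s)) *
        ((∏ e ∈ F, G.linkEntry r c σ η (τ (.inr e)) (.inr e)) *
          ∏ e ∈ Fᶜ, if τ (.inr e) = .inr e then 1 else 0)) =
      if G.IsRouting r c F τ then 1 else 0 := by
    intro τ
    split_ifs with hτ
    · have h1 : ∀ s, G.linkEntry r c σ η (τ (.inl s)) (.inl s) =
          linkSign r c σ η (τ (.inl s)) (.inl s) := fun s => if_pos (hτ.follows_inl s)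
      have h2 : ∀ e ∈ F, G.linkEntry r c σ η (τ (.inr e)) (.inr e) =
          linkSign r c σ η (τ (.inr e)) (.inr e) := fun e he => if_pos (hτ.follows_inr e he)
      rw [Finset.prod_congr rfl fun s _ => h1 s, Finset.prod_congr rfl h2,
        Finset.prod_eq_one (s := Fᶜ) fun e he =>
          if_pos (hτ.apply_of_notMem e (Finset.mem_compl.1 he)), mul_one,
        hτ.sign_mul_prod_linkSign hG hr hc hrI hpath hcycle]
    · by_cases h1 : ∀ s, G.Follows r c (τ (.inl s)) (.inl s)
      · by_cases h2 : ∀ e ∈ F, G.Follows r c (τ (.inr e)) (.inr e)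
        · have h3 : ¬ ∀ e, e ∉ F → τ (.inr e) = .inr e := fun h3 => hτ ⟨h1, h2, h3⟩
          push Not at h3
          obtain ⟨e, he, h⟩ := h3
          rw [Finset.prod_eq_zero (Finset.mem_compl.2 he) (if_neg h)]
          simp
        · push Not at h2
          obtain ⟨e, he, h⟩ := h2
          rw [Finset.prod_eq_zero he (if_neg h)]
          simp
      · push Not at h1
        obtain ⟨s, h⟩ := h1
        rw [Finset.prod_eq_zero (Finset.mem_univ s) (if_neg h)]
        simp
  rw [permSum, Finset.sum_congr rfl fun τ _ => hterm τ]
  split_ifs with h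
  · obtain ⟨τ, hτ⟩ := h
    rw [Finset.sum_eq_single τ, if_pos hτ]
    · exact fun τ' _ hne => if_neg fun h => hne (h.unique hG hrI hr.injective hτ)
    · exact fun h => absurd (Finset.mem_univ τ) h
  · exact Finset.sum_eq_zero fun τ _ => if_neg fun hτ => h ⟨τ, hτ⟩

open Classical in
/-- Modulo the variables, the matrix `1 - T` is the identity. -/
theorem isUnit_det_one_sub_transferMatrix [Fintype E] (σ : E → E → ℤ) :
    IsUnit (1 - G.transferMatrix σ).det := by
  have h : (MvPowerSeries.constantCoeff (σ := E) (R := ℤ)).mapMatrix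
      (1 - G.transferMatrix σ) = 1 := by
    rw [map_sub, map_one]
    ext e e'
    simp [transferMatrix, -eq_intCast]
  rw [MvPowerSeries.isUnit_iff_constantCoeff, RingHom.map_det, h, Matrix.det_one]
  exact isUnit_one

theorem walkSeries_of_mem {j : Fin n} (hj : j ∈ G.I) (σ : E → E → ℤ) (η : E → ℤ) (e : E) :
    G.walkSeries σ η e j = 0 := by
  rw [walkSeries, ← listSeries_zero]
  congr 1
  funext P
  refine if_neg fun h => ?_
  cases P with
  | nil => exact G.source_no_in j hj e h
  | cons e' P => exact sink_of_isWalk h (by simp) hj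

open Classical in
/-- Eliminating the edges from the linking matrix leaves a block of boundary measurements. -/
theorem det_columnMatrix_linkEntry [Fintype E] {r c : Fin k → Fin n} (hr : StrictMono r)
    (hrI : ∀ t, r t ∈ G.I) {σ : E → E → ℤ} {η : E → ℤ}
    (hw : ∀ (i j : Fin n) (e : E) (P : List E), G.IsWalk (G.b i) (e :: P) (G.b j) →
      ((G.wind (e :: P)).negOnePow : ℤ) = chordIndexSign i j * transferSign σ η e P) :
    (columnMatrix (G.linkEntry r c σ η)).det = (1 - G.transferMatrix σ).det *
      (Matrix.of fun t s => (-1) ^ betweenCount r (r t) (c s) *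
        G.boundaryMeasurement (r t) (c s)).det := by
  set χ : Fin k → ℤ := fun s => (-1) ^ (Finset.univ.filter fun t => r t < c s).card with hχ
  set M : Matrix (Fin k ⊕ E) (Fin k ⊕ E) (MvPowerSeries E ℤ) :=
    columnMatrix (G.linkEntry r c σ η) with hM
  set N : Matrix E (Fin k) (MvPowerSeries E ℤ) :=
    fun e s => MvPowerSeries.C (χ s) * G.walkSeries σ η e (c s) with hN
  have h22 : M.toBlocks₂₂ = 1 - G.transferMatrix σ := by
    ext1 e e'
    have h1 : M (.inr e) (.inr e') = MvPowerSeries.C (G.linkEntry r c σ η (.inr e) (.inr e')) *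
      MvPowerSeries.X e' + if (.inr e : Fin k ⊕ E) = .inr e' then 1 else 0 := rfl
    have h2 : G.linkEntry r c σ η (.inr e) (.inr e') =
        -if G.src e' = G.tgt e then σ e e' else 0 := by
      by_cases h : G.src e' = G.tgt e
      · rw [linkEntry, if_pos (show G.Follows r c (.inr e) (.inr e') from h), if_pos h, linkSign]
      · rw [linkEntry, if_neg (show ¬ G.Follows r c (.inr e) (.inr e') from h), if_neg h, neg_zero]
    rw [Matrix.toBlocks₂₂, Matrix.of_apply, h1, h2, Matrix.sub_apply, Matrix.one_apply,
      transferMatrix, map_neg]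
    simp only [Sum.inr.injEq]
    ring
  have h21 : M.toBlocks₂₁ = M.toBlocks₂₂ * N := by
    ext1 e s
    have h2 : G.linkEntry r c σ η (.inr e) (.inl s) =
        χ s * if G.tgt e = G.b (c s) then η e else 0 := by
      by_cases h : G.tgt e = G.b (c s)
      · rw [linkEntry, if_pos (show G.Follows r c (.inr e) (.inl s) from h), if_pos h, linkSign]
      · rw [linkEntry, if_neg (show ¬ G.Follows r c (.inr e) (.inl s) from h), if_neg h, mul_zero]
    have h3 : (G.transferMatrix σ * N) e s =
        MvPowerSeries.C (χ s) * ∑ e', G.transferMatrix σ e e' * G.walkSeries σ η e' (c s) := by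
      rw [Matrix.mul_apply, Finset.mul_sum]
      exact Finset.sum_congr rfl fun e' _ => by rw [hN]; ring
    have h5 : M.toBlocks₂₁ e s = MvPowerSeries.C (G.linkEntry r c σ η (.inr e) (.inl s)) := rfl
    rw [h22, Matrix.sub_mul, Matrix.one_mul, Matrix.sub_apply, h3, h5, h2, map_mul]
    have h4 := walkSeries_eq (G := G) σ η e (c s)
    rw [hN]
    linear_combination -(MvPowerSeries.C (χ s)) * h4
  let _ : Invertible M.toBlocks₂₂ := Matrix.invertibleOfIsUnitDet _
    (h22 ▸ isUnit_det_one_sub_transferMatrix σ)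
  rw [← Matrix.fromBlocks_toBlocks M, Matrix.det_fromBlocks₂₂, Matrix.mul_assoc, h21,
    Matrix.invOf_mul_cancel_left, h22]
  congr 2
  ext1 t s
  have h11 : M.toBlocks₁₁ t s = MvPowerSeries.C (if r t = c s then 1 else 0) := by
    have h1 : M.toBlocks₁₁ t s = MvPowerSeries.C (G.linkEntry r c σ η (.inl t) (.inl s)) := rfl
    rw [h1]
    congr 1
    by_cases h : r t = c s
    · rw [linkEntry, if_pos (show G.Follows r c (.inl t) (.inl s) from h), if_pos h, linkSign]
    · rw [linkEntry, if_neg (show ¬ G.Follows r c (.inl t) (.inl s) from h), if_neg h]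
  have h12 : (M.toBlocks₁₂ * N) t s = -(MvPowerSeries.C ((-1) ^ (t : ℕ) * χ s) *
      ∑ e, MvPowerSeries.C (if G.src e = G.b (r t) then 1 else 0) * MvPowerSeries.X e *
        G.walkSeries σ η e (c s)) := by
    rw [Matrix.mul_apply, Finset.mul_sum, ← Finset.sum_neg_distrib]
    refine Finset.sum_congr rfl fun e _ => ?_
    have h0 : (.inl t : Fin k ⊕ E) ≠ .inr e := by simp
    have h1 : M.toBlocks₁₂ t e = MvPowerSeries.C (G.linkEntry r c σ η (.inl t) (.inr e)) *
      MvPowerSeries.X e + if (.inl t : Fin k ⊕ E) = .inr e then 1 else 0 := rfl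
    have h2 : G.linkEntry r c σ η (.inl t) (.inr e) =
        -((-1) ^ (t : ℕ) * if G.src e = G.b (r t) then 1 else 0) := by
      by_cases h : G.src e = G.b (r t)
      · rw [linkEntry, if_pos (show G.Follows r c (.inl t) (.inr e) from h), if_pos h, linkSign,
          mul_one]
      · rw [linkEntry, if_neg (show ¬ G.Follows r c (.inl t) (.inr e) from h), if_neg h, mul_zero,
          neg_zero]
    rw [h1, if_neg h0, h2, hN, map_neg, map_mul, map_mul]
    ring
  rw [Matrix.sub_apply, h11, h12, Matrix.of_apply]
  by_cases hj : c s ∈ G.I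
  · simp only [walkSeries_of_mem hj, mul_zero, Finset.sum_const_zero, neg_zero, sub_zero]
    rw [boundaryMeasurement_of_mem hj]
    split_ifs with h
    · rw [h, betweenCount_self, pow_zero, map_one, mul_one]
    · simp
  · have hne : ∀ t', r t' ≠ c s := fun t' h => hj (h ▸ hrI t')
    have h1 : (∑ e, MvPowerSeries.C (if G.src e = G.b (r t) then chordIndexSign (r t) (c s) else 0) *
        MvPowerSeries.X e * G.walkSeries σ η e (c s)) =
        MvPowerSeries.C (chordIndexSign (r t) (c s)) *
          ∑ e, MvPowerSeries.C (if G.src e = G.b (r t) then 1 else 0) * MvPowerSeries.X e *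
            G.walkSeries σ η e (c s) := by
      rw [Finset.mul_sum]
      refine Finset.sum_congr rfl fun e _ => ?_
      split_ifs <;> simp [mul_assoc]
    have h2 : (-1 : MvPowerSeries E ℤ) ^ betweenCount r (r t) (c s) *
        MvPowerSeries.C (chordIndexSign (r t) (c s)) = MvPowerSeries.C ((-1) ^ (t : ℕ) * χ s) := by
      rw [← map_one (MvPowerSeries.C (σ := E) (R := ℤ)), ← map_neg, ← map_pow, ← map_mul,
        ← neg_one_pow_mul_chordIndexSign hr t hne, mul_assoc, chordIndexSign_sq, mul_one]
    rw [if_neg (hne t), boundaryMeasurement_eq_sum hj (hrI t) fun e P hP => hw _ _ e P hP, h1,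
      ← mul_assoc, h2]
    simp

/-- The determinant of the linking matrix is the generating function of the edge sets of
routings. -/
theorem sum_routings_eq [Fintype E] (hG : G.PerfectlyOriented) {r c : Fin k → Fin n}
    (hr : StrictMono r) (hc : StrictMono c) (hrI : ∀ t, r t ∈ G.I) {σ : E → E → ℤ} {η : E → ℤ}
    (hpath : ∀ (i j : Fin n) (e : E) (P : List E), G.IsWalk (G.b i) (e :: P) (G.b j) →
      (e :: P).Nodup → (∀ f ∈ e :: P, ∀ f' ∈ e :: P, G.src f = G.src f' → f = f') →
      transferSign σ η e P = chordIndexSign i j)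
    (hcycle : ∀ (v : V) (e : E) (P : List E), G.IsWalk v (e :: P) v → (e :: P).Nodup →
      (∀ f ∈ e :: P, ∀ f' ∈ e :: P, G.src f = G.src f' → f = f') →
      turnSign σ e (P ++ [e]) = -1) (p : Finset E → Prop) [DecidablePred p]
    (hp : ∀ F, (∃ τ, G.IsRouting r c F τ) ↔ p F) [DecidableEq E] :
    (columnMatrix (G.linkEntry r c σ η)).det =
      ((∑ F with p F, ∏ e ∈ F, MvPolynomial.X e : MvPolynomial E ℤ) : MvPowerSeries E ℤ) := by
  classical
  have h : ((∑ F with p F, ∏ e ∈ F, MvPolynomial.X e : MvPolynomial E ℤ) : MvPowerSeries E ℤ) =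
      MvPolynomial.coeToMvPowerSeries.ringHom
        (∑ F with p F, ∏ e ∈ F, MvPolynomial.X e : MvPolynomial E ℤ) := rfl
  rw [h, map_sum, Finset.sum_filter, det_columnMatrix]
  refine Finset.sum_congr rfl fun F _ => ?_
  have h2 := permSum_linkEntry hG hr hc hrI hpath hcycle F
  simp only [hp] at h2
  rw [show permSum (G.linkEntry r c σ η) F = if p F then 1 else 0 by convert! h2, map_prod]
  split_ifs <;> simp

end PlanarCircularDigraph

theorem betweenCount_eq_between {V E : Type*} {n : ℕ} (G : PlanarCircularDigraph V E n)
    (i j : Fin n) : betweenCount (G.I.orderEmbOfFin rfl) i j = G.between i j := by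
  rw [betweenCount, PlanarCircularDigraph.between]
  refine Finset.card_nbij (G.I.orderEmbOfFin rfl) ?_ ?_ ?_
  · intro t ht
    exact Finset.mem_inter.2 ⟨Finset.orderEmbOfFin_mem _ _ _,
      Finset.mem_Ioo.2 (Finset.mem_filter.1 ht).2⟩
  · exact (G.I.orderEmbOfFin rfl).injective.injOn
  · intro i hi
    obtain ⟨h1, h2⟩ := Finset.mem_inter.1 hi
    have : i ∈ Set.range (G.I.orderEmbOfFin rfl) := by simpa using h1
    obtain ⟨t, rfl⟩ := this
    exact ⟨t, by simpa using h2, rfl⟩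

/-- The quotient `f / g` is formed in the ring of formal power series, in which `g` is a unit. -/
theorem theorem3p2 {V E : Type*} [Finite V] [Fintype E] {n : ℕ}
    (G : PlanarCircularDigraph V E n) (hG : G.PerfectlyOriented)
    (J : Finset (Fin n)) (hJ : J.card = G.I.card) :
    IsUnit (G.conservativeFlowPolynomial : MvPowerSeries E ℤ) ∧
      G.maximalMinor J hJ * (G.conservativeFlowPolynomial : MvPowerSeries E ℤ) =
        (G.flowPolynomial J : MvPowerSeries E ℤ) := by
  classical
  obtain ⟨σ, η, hw, hpath, hcycle⟩ := G.exists_turning_signs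
  have hr : StrictMono (G.I.orderEmbOfFin rfl) := (G.I.orderEmbOfFin rfl).strictMono
  have hc : StrictMono (J.orderEmbOfFin hJ) := (J.orderEmbOfFin hJ).strictMono
  have hrI : ∀ i, i ∈ G.I ↔ ∃ t, G.I.orderEmbOfFin rfl t = i := fun i => by
    rw [← Set.mem_range, Finset.range_orderEmbOfFin, Finset.mem_coe]
  have hcJ : ∀ j, j ∈ J ↔ ∃ s, J.orderEmbOfFin hJ s = j := fun j => by
    rw [← Set.mem_range, Finset.range_orderEmbOfFin, Finset.mem_coe]
  have hrI' : ∀ t, G.I.orderEmbOfFin rfl t ∈ G.I := fun t => (hrI _).2 ⟨t, rfl⟩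
  have hflow := PlanarCircularDigraph.sum_routings_eq hG hr hc hrI' hpath hcycle
    (G.IsFlowTo J) (PlanarCircularDigraph.exists_isRouting_iff_isFlowTo hG hr.injective
      hc.injective hrI hcJ)
  have hcons := PlanarCircularDigraph.sum_routings_eq hG (r := Fin.elim0) (c := Fin.elim0)
    (fun t => t.elim0) (fun t => t.elim0) (fun t => t.elim0) hpath hcycle G.IsConservativeFlow
    (PlanarCircularDigraph.exists_isRouting_iff_isConservativeFlow hG)
  have hflow' := PlanarCircularDigraph.det_columnMatrix_linkEntry (c := J.orderEmbOfFin hJ)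
    hr hrI' hw
  have hcons' := PlanarCircularDigraph.det_columnMatrix_linkEntry (G := G) (r := Fin.elim0)
    (c := Fin.elim0) (fun t => t.elim0) (fun t => t.elim0) hw
  rw [Matrix.det_fin_zero, mul_one] at hcons'
  have hC : (G.conservativeFlowPolynomial : MvPowerSeries E ℤ) = (1 - G.transferMatrix σ).det := by
    rw [← hcons', hcons, PlanarCircularDigraph.conservativeFlowPolynomial]
  have hF : (G.flowPolynomial J : MvPowerSeries E ℤ) =
      (1 - G.transferMatrix σ).det * G.maximalMinor J hJ := by
    have hM : G.maximalMinor J hJ = (Matrix.of fun t s =>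
        (-1) ^ betweenCount (G.I.orderEmbOfFin rfl) (G.I.orderEmbOfFin rfl t)
          (J.orderEmbOfFin hJ s) * G.boundaryMeasurement (G.I.orderEmbOfFin rfl t)
            (J.orderEmbOfFin hJ s)).det := by
      rw [PlanarCircularDigraph.maximalMinor]
      congr 1
      ext1 t s
      rw [Matrix.of_apply, betweenCount_eq_between]
      rfl
    rw [hM, ← hflow', hflow, PlanarCircularDigraph.flowPolynomial]
  rw [hC, hF]
  exact ⟨PlanarCircularDigraph.isUnit_det_one_sub_transferMatrix σ, mul_comm _ _⟩
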